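/- **Theorem (circuit implementing the random Stinespring superchannel).** Let $n,r\ge 1$, let $\mathcal H_A,\mathcal H_B$ be Hilbert spaces of finite dimensions $d_A,d_B$, and let $\mathcal H_E=\mathbb C^r$. For $\lambda\vdash n$ let $l(\lambda)$ be the number of parts of $\lambda$ and let $[\lambda]$ be the corresponding irreducible representation of $S_n$ (the Specht module), with a real orthonormal basis for the invariant inner product (for instance the Young–Yamanouchi basis) and real matrix elements $R_\lambda(\sigma)_{i,j}$. Let $U_\sigma$ be the unitary permuting the factors of an $n$-fold tensor power by $\sigma$, let $\mathcal U_{r,\lambda}=\mathrm{Hom}_{S_n}([\lambda],\mathcal H_E^{\otimes n})$ be the multiplicity space of $[\lambda]$ (a representation of $\mathrm U(r)$), with an orthonormal basis (for instance the Gelfand–Tsetlin basis), and let $|\lambda,i,\alpha\rangle$ be the resulting Schur basis of $\mathcal H_E^{\otimes n}=\bigoplus_\lambda[\lambda]\otimes\mathcal U_{r,\lambda}$, so that $U_\sigma|\lambda,i,\alpha\rangle=\sum_k R_\lambda(\sigma)_{k,i}|\lambda,k,\alpha\rangle$. Let $\widehat{S_n}$ be the Hilbert space with orthonormal basis $\{|\sigma\rangle\}_{\sigma\in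 S_n}$. Define: * the controlled permutation $\mathsf{C\pi}(|\sigma\rangle\otimes|\psi\rangle)=|\sigma\rangle\otimes U_\sigma|\psi\rangle$, and the encoder $\mathsf E|\psi\rangle=\mathsf{C\pi}\big[\tfrac1{\sqrt{n!}}\sum_{\sigma}|\sigma\rangle\otimes|\psi\rangle\big]$ for $|\psi\rangle\in\mathcal H_A^{\otimes n}$, with $\mathcal E(\cdot)=\mathsf E(\cdot)\mathsf E^\dagger$; * $\mathrm{QFT}|\sigma\rangle=\sum_{\lambda\vdash n}\sum_{i,j}\sqrt{\dim[\lambda]/n!}\,R_\lambda(\sigma)_{i,j}|\lambda,i,j\rangle$, and the decoder $\mathsf D=(\mathrm{QFT}\otimes 1_{B^n})\,\mathsf{C\pi}^\dagger$, with $\mathcal D(\cdot)=\mathsf D(\cdot)\mathsf D^\dagger$; * the linear map $\mathcal T$ with $\mathcal T(|\lambda,i,j\rangle\langle\lambda',k,l|)=0$ if $\lambda\ne\lambda'$, and for $\lambda=\lambda'$ equal to $\delta_{i,k}\,|\lambda,j\rangle\langle\lambda,l|\otimes 1_{\mathcal U_{r,\lambda}}/\dim\mathcal U_{r,\lambda}$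 if $l(\lambda)\le r$ and to $\delta_{i,k}\delta_{j,l}\,1_{E^n}/r^n$ if $l(\lambda)>r$; * $\mathcal U_{\mathrm{Schur}}(\cdot)=W(\cdot)W^\dagger$, where $W$ sends the label basis of $\bigoplus_\lambda[\lambda]\otimes\mathcal U_{r,\lambda}$ to the vectors $|\lambda,i,\alpha\rangle\in\mathcal H_E^{\otimes n}$ (the inverse Schur transform). Then $\mathsf E$ is an isometry, $\mathsf D$ and $W$ are unitary, and $\mathcal T$ is a quantum channel. For every quantum channel $\Phi:\mathcal L(\mathcal H_A)\to\mathcal L(\mathcal H_B)$ of Choi rank at most $r$, $$\mathcal C=(\mathcal U_{\mathrm{Schur}}\otimes \mathrm{Id}_{B^n})\circ(\mathcal T\otimes\mathrm{Id}_{B^n})\circ\mathcal D\circ(\mathrm{Id}_{\widehat{S_n}}\otimes\Phi^{\otimes n})\circ\mathcal E$$ is a quantum channel; there is a Stinespring isometry $V:\mathcal H_A\to\mathcal H_B\otimes\mathcal H_E$ of $\Phi$ (that is, $V^\dagger V=1$ and $\Phi(\cdot)=\mathrm{Tr}_E[V(\cdot)V^\dagger]$); and for every such $V$, $$\mathcal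 C(\cdot)=\Omega(\cdot):=\mathbb E_{U}\Big[\big((1_B\otimes U)V\big)^{\otimes n}(\cdot)\big(V^\dagger(1_B\otimes U^\dagger)\big)^{\otimes n}\Big],$$ where $U$ is Haar-random in $\mathrm U(r)$ and the output systems are ordered as $E^nB^n$. -/

import Mathlib

open Matrix MeasureTheory
open scoped ComplexOrder

noncomputable section

namespace RandomStinespring

/-! ## Quantum channels on matrix algebras

The Hilbert space with orthonormal basis indexed by `X` is `ℂ^X`, and `L(ℂ^X)` is
`Matrix X X ℂ`.  The `n`-fold tensor power of `ℂ^X` has the basis indexed by `Fin n → X`. -/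

/-- `Id_S ⊗ Φ`, acting blockwise. -/
def idTensor (S : Type*) {X Y : Type*} (Φ : Matrix X X ℂ →ₗ[ℂ] Matrix Y Y ℂ) :
    Matrix (S × X) (S × X) ℂ →ₗ[ℂ] Matrix (S × Y) (S × Y) ℂ where
  toFun M := Matrix.of fun p q => Φ (Matrix.of fun x x' => M (p.1, x) (q.1, x')) p.2 q.2
  map_add' M N := by
    ext p q
    have h : (Matrix.of fun x x' => (M + N) (p.1, x) (q.1, x'))
        = (Matrix.of fun x x' => M (p.1, x) (q.1, x'))
          + (Matrix.of fun x x' => N (p.1, x) (q.1, x')) := rfl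
    simp only [Matrix.of_apply, Matrix.add_apply] at h ⊢
    rw [h, map_add, Matrix.add_apply]
  map_smul' c M := by
    ext p q
    have h : (Matrix.of fun x x' => (c • M) (p.1, x) (q.1, x'))
        = c • (Matrix.of fun x x' => M (p.1, x) (q.1, x')) := rfl
    simp only [Matrix.of_apply, Matrix.smul_apply, RingHom.id_apply] at h ⊢
    rw [h, map_smul, Matrix.smul_apply]

/-- `Φ ⊗ Id_S`, acting blockwise. -/
def tensorId {X Y : Type*} (Φ : Matrix X X ℂ →ₗ[ℂ] Matrix Y Y ℂ) (S : Type*) :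
    Matrix (X × S) (X × S) ℂ →ₗ[ℂ] Matrix (Y × S) (Y × S) ℂ where
  toFun M := Matrix.of fun p q => Φ (Matrix.of fun x x' => M (x, p.2) (x', q.2)) p.1 q.1
  map_add' M N := by
    ext p q
    have h : (Matrix.of fun x x' => (M + N) (x, p.2) (x', q.2))
        = (Matrix.of fun x x' => M (x, p.2) (x', q.2))
          + (Matrix.of fun x x' => N (x, p.2) (x', q.2)) := rfl
    simp only [Matrix.of_apply, Matrix.add_apply] at h ⊢
    rw [h, map_add, Matrix.add_apply]
  map_smul' c M := by
    ext p q
    have h : (Matrix.of fun x x' => (c • M) (x, p.2) (x', q.2))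
        = c • (Matrix.of fun x x' => M (x, p.2) (x', q.2)) := rfl
    simp only [Matrix.of_apply, Matrix.smul_apply, RingHom.id_apply] at h ⊢
    rw [h, map_smul, Matrix.smul_apply]

/-- The map `M ↦ K M K†`. -/
def conj {X Y : Type*} [Fintype X] (K : Matrix Y X ℂ) :
    Matrix X X ℂ →ₗ[ℂ] Matrix Y Y ℂ where
  toFun M := K * M * Kᴴ
  map_add' M N := by rw [Matrix.mul_add, Matrix.add_mul]
  map_smul' c M := by rw [Matrix.mul_smul, Matrix.smul_mul, RingHom.id_apply]

/-- Completely positive and trace preserving maps. -/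
def IsQuantumChannel {X Y : Type*} [Fintype X] [Fintype Y]
    (Φ : Matrix X X ℂ →ₗ[ℂ] Matrix Y Y ℂ) : Prop :=
  (∀ (k : ℕ) (M : Matrix (Fin k × X) (Fin k × X) ℂ),
      M.PosSemidef → (idTensor (Fin k) Φ M).PosSemidef) ∧
  ∀ M : Matrix X X ℂ, (Φ M).trace = M.trace

/-- The (unnormalised) Choi matrix `∑ i j, |i⟩⟨j| ⊗ Φ(|i⟩⟨j|)`. -/
def choiMatrix {X Y : Type*} [DecidableEq X] (Φ : Matrix X X ℂ →ₗ[ℂ] Matrix Y Y ℂ) :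
    Matrix (X × Y) (X × Y) ℂ :=
  Matrix.of fun p q => Φ (Matrix.single p.1 q.1 1) p.2 q.2

/-- The rank of the Choi matrix (equivalently, of the Choi state). -/
def choiRank {X Y : Type*} [DecidableEq X] [Fintype X] [Fintype Y]
    (Φ : Matrix X X ℂ →ₗ[ℂ] Matrix Y Y ℂ) : ℕ :=
  (choiMatrix Φ).rank

/-- The parallel use `Φ^{⊗n}`: on a product of matrix units it is the product of the
images, and it is extended linearly. -/
def channelPow (n : ℕ) {X Y : Type*} [DecidableEq X] [Fintype X]
    (Φ : Matrix X X ℂ →ₗ[ℂ] Matrix Y Y ℂ) :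
    Matrix (Fin n → X) (Fin n → X) ℂ →ₗ[ℂ] Matrix (Fin n → Y) (Fin n → Y) ℂ where
  toFun M := Matrix.of fun y y' => ∑ x, ∑ x',
    M x x' * ∏ k, Φ (Matrix.single (x k) (x' k) 1) (y k) (y' k)
  map_add' M N := by
    ext y y'
    simp only [Matrix.of_apply, Matrix.add_apply, add_mul, Finset.sum_add_distrib]
  map_smul' c M := by
    ext y y'
    simp only [Matrix.of_apply, Matrix.smul_apply, smul_eq_mul, RingHom.id_apply,
      Finset.mul_sum, mul_assoc]

/-- `V : ℂ^A → ℂ^B ⊗ ℂ^E` is a Stinespring isometry of `Φ`: `V†V = 1` and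
`Φ(M) = Tr_E[V M V†]`. -/
def IsStinespringIsometry {A B E : Type*} [Fintype A] [DecidableEq A] [Fintype B] [Fintype E]
    (Φ : Matrix A A ℂ →ₗ[ℂ] Matrix B B ℂ) (V : Matrix (B × E) A ℂ) : Prop :=
  Vᴴ * V = 1 ∧ ∀ M : Matrix A A ℂ, ∀ y y' : B, Φ M y y' = ∑ e, (V * M * Vᴴ) (y, e) (y', e)

/-! ## Haar measure on the unitary group and the random Stinespring channel -/

theorem isCompact_unitaryGroup (r : ℕ) :
    IsCompact (Matrix.unitaryGroup (Fin r) ℂ : Set (Matrix (Fin r) (Fin r) ℂ)) := by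
  have hK : IsCompact (Set.univ.pi fun _ : Fin r =>
      Set.univ.pi fun _ : Fin r => Metric.closedBall (0 : ℂ) 1) :=
    isCompact_univ_pi fun _ => isCompact_univ_pi fun _ => isCompact_closedBall _ _
  refine IsCompact.of_isClosed_subset (s := (show Set (Matrix (Fin r) (Fin r) ℂ) from
    Set.univ.pi fun _ : Fin r => Set.univ.pi fun _ : Fin r => Metric.closedBall (0 : ℂ) 1))
    hK ?_ ?_
  · have h : (Matrix.unitaryGroup (Fin r) ℂ : Set (Matrix (Fin r) (Fin r) ℂ))
        = {U | U * star U = 1} := by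
      ext U
      exact Matrix.mem_unitaryGroup_iff
    rw [h]
    exact isClosed_eq (continuous_id.mul continuous_star) continuous_const
  · intro U hU i _ j _
    rw [mem_closedBall_zero_iff]
    exact entry_norm_bound_of_unitary hU i j

instance compactSpace_unitaryGroup (r : ℕ) :
    CompactSpace (Matrix.unitaryGroup (Fin r) ℂ) :=
  isCompact_iff_compactSpace.mp (isCompact_unitaryGroup r)

instance measurableSpace_unitaryGroup (r : ℕ) :
    MeasurableSpace (Matrix.unitaryGroup (Fin r) ℂ) := borel _

instance borelSpace_unitaryGroup (r : ℕ) :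
    BorelSpace (Matrix.unitaryGroup (Fin r) ℂ) := ⟨rfl⟩

/-- The Haar probability measure of `U(r)`. -/
def haarUnitary (r : ℕ) : Measure (Matrix.unitaryGroup (Fin r) ℂ) :=
  Measure.haarMeasure ⊤

/-- `((1_B ⊗ U) V)^{⊗n} : (ℂ^A)^{⊗n} → (ℂ^r)^{⊗n} ⊗ (ℂ^B)^{⊗n}`, where the `n` environments
are collected on the left and the `n` outputs on the right. -/
def isometryPow (n : ℕ) {A B : Type*} [Fintype B] [DecidableEq B] {r : ℕ}
    (V : Matrix (B × Fin r) A ℂ) (U : Matrix (Fin r) (Fin r) ℂ) :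
    Matrix ((Fin n → Fin r) × (Fin n → B)) (Fin n → A) ℂ :=
  Matrix.of fun p x => ∏ k,
    (Matrix.kronecker (1 : Matrix B B ℂ) U * V) (p.2 k, p.1 k) (x k)

/-- The channel `Ω` of the random Stinespring isometry:
`E_U [ ((1 ⊗ U) V)^{⊗n} M (V† (1 ⊗ U†))^{⊗n} ]`, the expectation being taken entrywise. -/
def randomStinespring (n : ℕ) {A B : Type*} [Fintype A] [Fintype B] [DecidableEq B] {r : ℕ}
    (V : Matrix (B × Fin r) A ℂ) (M : Matrix (Fin n → A) (Fin n → A) ℂ) :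
    Matrix ((Fin n → Fin r) × (Fin n → B)) ((Fin n → Fin r) × (Fin n → B)) ℂ :=
  Matrix.of fun p q =>
    ∫ U : Matrix.unitaryGroup (Fin r) ℂ,
      (isometryPow n V U.1 * M * (isometryPow n V U.1)ᴴ) p q ∂(haarUnitary r)

/-! ## Irreducible representations of the symmetric group -/

/-- The Young diagram of a partition. -/
def diagram {n : ℕ} (μ : n.Partition) : YoungDiagram :=
  YoungDiagram.ofRowLens (μ.parts.sort (· ≥ ·)) (Multiset.pairwise_sort _ _).sortedGE

/-- The number `l(μ)` of parts (rows). -/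
def len {n : ℕ} (μ : n.Partition) : ℕ := μ.parts.card

/-- A (bijective) tableau of shape `μ`; `t k` is the box that holds the entry `k`. -/
abbrev Tableau {n : ℕ} (μ : n.Partition) : Type :=
  Fin n ≃ {c : ℕ × ℕ // c ∈ (diagram μ).cells}

/-- Two tableaux are row equivalent if every entry lies in the same row in both. -/
def rowSetoid {n : ℕ} (μ : n.Partition) : Setoid (Tableau μ) where
  r t t' := ∀ k, (t k).1.1 = (t' k).1.1
  iseqv := ⟨fun _ _ => rfl, fun h k => (h k).symm, fun h h' k => (h k).trans (h' k)⟩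

/-- Tabloids: row equivalence classes of tableaux. -/
abbrev Tabloid {n : ℕ} (μ : n.Partition) : Type := Quotient (rowSetoid μ)

instance {n : ℕ} (μ : n.Partition) : Fintype (Tabloid μ) := Fintype.ofFinite _

/-- The tableau `σ t`, in which every entry `k` of `t` is replaced by `σ k`. -/
def permTableau {n : ℕ} {μ : n.Partition} (σ : Equiv.Perm (Fin n)) (t : Tableau μ) :
    Tableau μ := σ.symm.trans t

/-- The action of `S_n` on tabloids. -/
def permTabloid {n : ℕ} {μ : n.Partition} (σ : Equiv.Perm (Fin n)) : Tabloid μ → Tabloid μ :=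
  Quotient.map' (permTableau σ) fun _ _ h k => h (σ.symm k)

/-- The real permutation module on tabloids, in which the tabloids are orthonormal. -/
abbrev PermModule {n : ℕ} (μ : n.Partition) : Type := EuclideanSpace ℝ (Tabloid μ)

/-- The action of `S_n` on the permutation module, `σ |T⟩ = |σ T⟩`. -/
def permModuleAct {n : ℕ} {μ : n.Partition} (σ : Equiv.Perm (Fin n)) (v : PermModule μ) :
    PermModule μ :=
  WithLp.toLp 2 fun T => v (permTabloid σ⁻¹ T)

/-- The polytabloid `e_t = ∑ π, sgn(π) |π {t}⟩`, the sum being over the `π` that preserve the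
columns of `t`. -/
def polytabloid {n : ℕ} {μ : n.Partition} (t : Tableau μ) : PermModule μ := by
  classical
  exact ∑ π : Equiv.Perm (Fin n),
    if ∀ k, (t (π k)).1.2 = (t k).1.2 then
      ((Equiv.Perm.sign π : ℤ) : ℝ) •
        EuclideanSpace.single (Quotient.mk (rowSetoid μ) (permTableau π t)) (1 : ℝ)
    else 0

/-- The Specht module: the irreducible representation `[μ]` of `S_n` over the reals, with the
invariant inner product inherited from the permutation module. -/
def specht {n : ℕ} (μ : n.Partition) : Submodule ℝ (PermModule μ) :=
  Submodule.span ℝ (Set.range (polytabloid (μ := μ)))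

/-- `dim [μ]`. -/
def dimS {n : ℕ} (μ : n.Partition) : ℕ := Module.finrank ℝ (specht μ)

/-- A choice of a real orthonormal basis of each `[μ]` (for example, the Young–Yamanouchi
bases). -/
abbrev SpechtBases (n : ℕ) : Type :=
  ∀ μ : n.Partition, OrthonormalBasis (Fin (dimS μ)) ℝ (specht μ)

/-- The matrix elements `R_μ(σ)_{k,l} = ⟨k|σ|l⟩`, regarded as complex numbers. -/
def R {n : ℕ} (b : SpechtBases n) (μ : n.Partition) (σ : Equiv.Perm (Fin n)) :
    Matrix (Fin (dimS μ)) (Fin (dimS μ)) ℂ :=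
  Matrix.of fun k l =>
    ((inner ℝ (b μ k : PermModule μ) (permModuleAct σ (b μ l : PermModule μ)) : ℝ) : ℂ)

/-- The permutation unitary `U_σ |x_1,…,x_n⟩ = |x_{σ⁻¹(1)},…,x_{σ⁻¹(n)}⟩`. -/
def permOp {n : ℕ} (X : Type*) [DecidableEq X] (σ : Equiv.Perm (Fin n)) :
    Matrix (Fin n → X) (Fin n → X) ℂ :=
  Matrix.of fun x y => if x = y ∘ σ.symm then 1 else 0

/-! ## The representations of the unitary group and the Schur transform -/

/-- A vector of `(ℂ^r)^{⊗n} ⊗ ℂ^{dim[μ]}`, regarded as a linear map `[μ] → (ℂ^r)^{⊗n}`. -/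
def toMap {n r : ℕ} {μ : n.Partition}
    (φ : EuclideanSpace ℂ ((Fin n → Fin r) × Fin (dimS μ))) :
    Matrix (Fin n → Fin r) (Fin (dimS μ)) ℂ :=
  Matrix.of fun x i => φ (x, i)

/-- The representation space `U_{r,μ}` of `U(r)`: the multiplicity space
`Hom_{S_n}([μ], (ℂ^r)^{⊗n})` of `[μ]`, with the Hilbert–Schmidt inner product. -/
def weyl {n : ℕ} (r : ℕ) (b : SpechtBases n) (μ : n.Partition) :
    Submodule ℂ (EuclideanSpace ℂ ((Fin n → Fin r) × Fin (dimS μ))) where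
  carrier := {φ | ∀ σ : Equiv.Perm (Fin n),
    permOp (Fin r) σ * toMap φ = toMap φ * R b μ σ}
  zero_mem' := by
    intro σ
    have h : toMap (0 : EuclideanSpace ℂ ((Fin n → Fin r) × Fin (dimS μ))) = 0 := rfl
    rw [h, Matrix.mul_zero, Matrix.zero_mul]
  add_mem' := by
    intro φ ψ hφ hψ σ
    have h : toMap (φ + ψ) = toMap φ + toMap ψ := rfl
    rw [h, Matrix.mul_add, Matrix.add_mul, hφ σ, hψ σ]
  smul_mem' := by
    intro c φ hφ σ
    have h : toMap (c • φ) = c • toMap φ := rfl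
    rw [h, Matrix.mul_smul, Matrix.smul_mul, hφ σ]

/-- `dim U_{r,μ}`. -/
def dimU {n : ℕ} (r : ℕ) (b : SpechtBases n) (μ : n.Partition) : ℕ :=
  Module.finrank ℂ (weyl r b μ)

/-- A choice of an orthonormal basis of each `U_{r,μ}` (for example, the Gelfand–Tsetlin
bases). -/
abbrev WeylBases {n : ℕ} (r : ℕ) (b : SpechtBases n) : Type :=
  ∀ μ : n.Partition, OrthonormalBasis (Fin (dimU r b μ)) ℂ (weyl r b μ)

/-- The labels `(μ,i,α)` of the basis of `⨁_μ [μ] ⊗ U_{r,μ}`. -/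
abbrev SchurLabel {n : ℕ} (r : ℕ) (b : SpechtBases n) : Type :=
  Σ μ : n.Partition, Fin (dimS μ) × Fin (dimU r b μ)

/-- The Schur transform from `⨁_μ [μ] ⊗ U_{r,μ}` to `(ℂ^r)^{⊗n}`.  Its column `(μ,i,α)` is the
Schur basis vector `|μ,i,α⟩ = √(dim[μ]) φ_α(|i⟩)`, where `φ_α` is the `α`-th basis vector of
`U_{r,μ} = Hom_{S_n}([μ], (ℂ^r)^{⊗n})`. -/
def schur {n r : ℕ} (b : SpechtBases n) (u : WeylBases r b) :
    Matrix (Fin n → Fin r) (SchurLabel r b) ℂ :=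
  Matrix.of fun x a =>
    ((Real.sqrt (dimS a.1) : ℝ) : ℂ) * toMap (u a.1 a.2.2 : EuclideanSpace ℂ _) x a.2.1

/-! ## The components of the circuit -/

/-- The labels `(μ,i,j)` of the Fourier basis of the space with basis `S_n`. -/
abbrev FourierLabel (n : ℕ) : Type := Σ μ : n.Partition, Fin (dimS μ) × Fin (dimS μ)

/-- `QFT |σ⟩ = ∑_{μ,i,j} √(dim[μ]/n!) R_μ(σ)_{i,j} |μ,i,j⟩`. -/
def qft {n : ℕ} (b : SpechtBases n) : Matrix (FourierLabel n) (Equiv.Perm (Fin n)) ℂ :=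
  Matrix.of fun a σ =>
    ((Real.sqrt ((dimS a.1 : ℝ) / (n.factorial : ℝ)) : ℝ) : ℂ) * R b a.1 σ a.2.1 a.2.2

/-- The controlled permutation `|σ⟩ ⊗ |ψ⟩ ↦ |σ⟩ ⊗ U_σ |ψ⟩`. -/
def ctrlPerm (n : ℕ) (X : Type*) [DecidableEq X] :
    Matrix (Equiv.Perm (Fin n) × (Fin n → X)) (Equiv.Perm (Fin n) × (Fin n → X)) ℂ :=
  Matrix.of fun p q => if p.1 = q.1 then permOp X q.1 p.2 q.2 else 0

/-- `|ψ⟩ ↦ (1/√n!) ∑_σ |σ⟩ ⊗ |ψ⟩`. -/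
def uniformSuperposition (n : ℕ) (X : Type*) [DecidableEq X] :
    Matrix (Equiv.Perm (Fin n) × (Fin n → X)) (Fin n → X) ℂ :=
  Matrix.of fun p x => if p.2 = x then ((1 / Real.sqrt (n.factorial : ℝ) : ℝ) : ℂ) else 0

/-- The encoding isometry. -/
def encoder (n : ℕ) (X : Type*) [DecidableEq X] [Fintype X] :
    Matrix (Equiv.Perm (Fin n) × (Fin n → X)) (Fin n → X) ℂ :=
  ctrlPerm n X * uniformSuperposition n X

/-- The decoding unitary: the inverse controlled permutation followed by the QFT. -/
def decoder {n : ℕ} (b : SpechtBases n) (X : Type*) [DecidableEq X] [Fintype X] :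
    Matrix (FourierLabel n × (Fin n → X)) (Equiv.Perm (Fin n) × (Fin n → X)) ℂ :=
  Matrix.kronecker (qft b) (1 : Matrix (Fin n → X) (Fin n → X) ℂ) * (ctrlPerm n X)ᴴ

/-- The channel `T`.  It measures `μ`, so it annihilates `|μ,i,j⟩⟨μ',k,l|` if `μ ≠ μ'`.
If `l(μ) ≤ r`, it maps `|μ,i,j⟩⟨μ,k,l|` to `δ_{i,k} |μ,j⟩⟨μ,l| ⊗ 1/dim(U_{r,μ})`.
If `l(μ) > r`, it maps `|μ,i,j⟩⟨μ,k,l|` to `δ_{i,k} δ_{j,l} 1/r^n`, i.e. it returns the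
maximally mixed state of the `n` environments. -/
def replaceChannel {n : ℕ} (r : ℕ) (b : SpechtBases n) :
    Matrix (FourierLabel n) (FourierLabel n) ℂ →ₗ[ℂ]
      Matrix (SchurLabel r b) (SchurLabel r b) ℂ where
  toFun M := ∑ μ : n.Partition,
    if len μ ≤ r then
      ∑ i : Fin (dimS μ), ∑ j : Fin (dimS μ), ∑ l : Fin (dimS μ),
        M ⟨μ, (i, j)⟩ ⟨μ, (i, l)⟩ • ∑ α : Fin (dimU r b μ),
          Matrix.single (⟨μ, (j, α)⟩ : SchurLabel r b) (⟨μ, (l, α)⟩ : SchurLabel r b)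
            (1 / (dimU r b μ : ℂ))
    else
      ∑ i : Fin (dimS μ), ∑ j : Fin (dimS μ),
        M ⟨μ, (i, j)⟩ ⟨μ, (i, j)⟩ •
          ((1 / (r : ℂ) ^ n) • (1 : Matrix (SchurLabel r b) (SchurLabel r b) ℂ))
  map_add' M N := by
    rw [← Finset.sum_add_distrib]
    refine Finset.sum_congr rfl fun μ _ => ?_
    split_ifs <;> simp only [Matrix.add_apply, add_smul, Finset.sum_add_distrib]
  map_smul' c M := by
    rw [RingHom.id_apply, Finset.smul_sum]
    refine Finset.sum_congr rfl fun μ _ => ?_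
    split_ifs <;> simp only [Matrix.smul_apply, smul_eq_mul, mul_smul, Finset.smul_sum]

/-- The circuit
`(U_Schur ⊗ Id) ∘ (T ⊗ Id) ∘ D ∘ (Id ⊗ Φ^{⊗n}) ∘ E`. -/
def circuit {n r : ℕ} {A B : Type*} [Fintype A] [DecidableEq A] [Fintype B] [DecidableEq B]
    (b : SpechtBases n) (u : WeylBases r b) (Φ : Matrix A A ℂ →ₗ[ℂ] Matrix B B ℂ) :
    Matrix (Fin n → A) (Fin n → A) ℂ →ₗ[ℂ]
      Matrix ((Fin n → Fin r) × (Fin n → B)) ((Fin n → Fin r) × (Fin n → B)) ℂ :=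
  tensorId (conj (schur b u)) (Fin n → B) ∘ₗ
    tensorId (replaceChannel r b) (Fin n → B) ∘ₗ
    conj (decoder b B) ∘ₗ
    idTensor (Equiv.Perm (Fin n)) (channelPow n Φ) ∘ₗ
    conj (encoder n A)

end RandomStinespring

end

open Matrix MeasureTheory
open scoped ComplexOrder

noncomputable section

namespace RandomStinespring

/-! ## Young diagrams and the dominance order -/

/-! Fix a Stinespring isometry `V` and output indices `y`, `y'`, and let `N` be the corresponding
environment block of `V^{⊗n} M V^{†⊗n}` (`envBlock`). Since `U` acts only on the environment, the
block of `Ω(M)` is the twirl `E_U[U^{⊗n} N U^{†⊗n}]`. By Schur–Weyl duality (`twirl_eq_sum`) this is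
the sum over `μ`, `j`, `k` of `Tr(E_kj N) / dim U_{r,μ}` times `E_jk`, where `E_jk = ∑ α,
|μ,j,α⟩⟨μ,k,α|` is `isoUnit`.

The circuit measures and prepares exactly these terms. The encoder permutes the inputs coherently.
As `V^{⊗n}` commutes with simultaneous permutations of inputs, outputs and environments, and the
decoder undoes the permutation of the outputs, only the traced-out environment remembers `σ`: the
coefficient of `|σ⟩⟨τ|` is `Tr(U_{τ⁻¹σ} N) / n!`. After the Fourier transform, the partial trace
over the row index `i` leaves `Tr(E_lj N)` at `|μ,j⟩⟨μ,l|` (`sum_conj_decoder`). The channel `T`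
then appends the maximally mixed state of `U_{r,μ}`, and the inverse Schur transform gives the
twirl. Diagrams with more than `r` rows carry no weight, because their `isoUnit` vanishes; the
second branch of `T` only makes it trace preserving.

The representation theory is built from tabloids. A function of a tableau and a point that is
equivariant and alternates under column permutations vanishes wherever a transposition inside a
column fixes the point (`IsPolytabloidLike.eq_zero`). On tabloids this yields dominance and
uniqueness, hence Schur's lemma for the real Specht modules (`intertwiner_eq_zero`,
`intertwiner_eq_scalar`); on words in `r` letters it kills the multiplicity space when there are
more than `r` rows. Counting partitions shows that no irreducible is missing, so the regular
character decomposes (`sum_dimS_mul_character`); this makes both the Fourier and the Schur transform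
surjective.

Duality itself (`CommutesWithUnitaries.commute`) passes from unitaries to all matrices by polynomial
continuation, and from tensor powers to all permutation-invariant operators by polarization. Channel
properties follow from explicit Kraus forms, and `V` comes from factoring the Choi matrix. -/

theorem card_cellsOfRowLens (w : List ℕ) :
    (YoungDiagram.cellsOfRowLens w).card = w.sum := by
  induction w with
  | nil => rfl
  | cons a w ih =>
    rw [YoungDiagram.cellsOfRowLens, Finset.card_union_of_disjoint, Finset.card_map, ih]
    · simp
    · rw [Finset.disjoint_left]
      rintro ⟨i, j⟩ h h'
      simp at h h'
      omega

theorem card_cells_diagram {n : ℕ} (μ : n.Partition) : (diagram μ).cells.card = n := by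
  have h : (diagram μ).cells.card = (μ.parts.sort (· ≥ ·)).sum := card_cellsOfRowLens _
  rw [h, ← Multiset.sum_coe, Multiset.sort_eq, μ.parts_sum]

instance tableau_nonempty {n : ℕ} (μ : n.Partition) : Nonempty (Tableau μ) :=
  ⟨Fintype.equivOfCardEq (by simp [card_cells_diagram])⟩

theorem rowLens_diagram {n : ℕ} (μ : n.Partition) :
    (diagram μ).rowLens = μ.parts.sort (· ≥ ·) :=
  YoungDiagram.rowLens_ofRowLens_eq_self fun x hx => μ.parts_pos (by simpa using hx)

theorem diagram_injective {n : ℕ} : Function.Injective (diagram (n := n)) := by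
  intro μ ν h
  have h1 := rowLens_diagram μ
  rw [h, rowLens_diagram ν] at h1
  ext1
  rw [← Multiset.sort_eq ν.parts (· ≥ ·), h1, Multiset.sort_eq]

theorem colLen_zero_diagram {n : ℕ} (μ : n.Partition) : (diagram μ).colLen 0 = len μ := by
  rw [← YoungDiagram.length_rowLens, rowLens_diagram, Multiset.length_sort, len]

section Dominance

variable {n : ℕ} {D D' : YoungDiagram}

/-- The number of cells in the first `k` rows. -/
def cellsAbove (D : YoungDiagram) (k : ℕ) : ℕ := (D.cells.filter fun c => c.1 < k).card

theorem rowLen_eq_cellsAbove (D : YoungDiagram) (i : ℕ) :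
    D.rowLen i + cellsAbove D i = cellsAbove D (i + 1) := by
  rw [YoungDiagram.rowLen_eq_card, cellsAbove, cellsAbove, ← Finset.card_union_of_disjoint]
  · congr 1
    ext c
    simp only [Finset.mem_union, YoungDiagram.mem_row_iff, Finset.mem_filter,
      YoungDiagram.mem_cells]
    constructor
    · rintro (h | h) <;> exact ⟨h.1, by omega⟩
    · rintro ⟨h1, h2⟩
      by_cases h3 : c.1 = i
      · exact Or.inl ⟨h1, h3⟩
      · exact Or.inr ⟨h1, by omega⟩
  · rw [Finset.disjoint_left]
    intro c h h'
    simp only [YoungDiagram.mem_row_iff, Finset.mem_filter] at h h'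
    omega

theorem eq_of_cellsAbove_eq (h : ∀ k, cellsAbove D k = cellsAbove D' k) : D = D' := by
  ext ⟨i, j⟩
  have h1 : D.rowLen i = D'.rowLen i := by
    have := rowLen_eq_cellsAbove D i
    have := rowLen_eq_cellsAbove D' i
    have := h i
    have := h (i + 1)
    omega
  simp only [YoungDiagram.mem_cells, YoungDiagram.mem_iff_lt_rowLen, h1]

theorem cellsAbove_eq_card (t : Fin n ≃ {c : ℕ × ℕ // c ∈ D.cells}) (k : ℕ) :
    cellsAbove D k = (Finset.univ.filter fun a => (t a).1.1 < k).card := by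
  symm
  refine Finset.card_bij (fun a _ => (t a).1) ?_ ?_ ?_
  · intro a ha
    simp only [Finset.mem_filter, Finset.mem_univ, true_and] at ha
    exact Finset.mem_filter.2 ⟨(t a).2, ha⟩
  · intro a _ a' _ h
    exact t.injective (Subtype.ext h)
  · intro c hc
    rw [Finset.mem_filter] at hc
    exact ⟨t.symm ⟨c, hc.1⟩, by simp [hc.2], by simp⟩

theorem card_column (t : Fin n ≃ {c : ℕ × ℕ // c ∈ D.cells}) (j k : ℕ) :
    (Finset.univ.filter fun a => (t a).1.2 = j ∧ (t a).1.1 < k).card = min k (D.colLen j) := by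
  rw [← Finset.card_range (min k (D.colLen j))]
  refine Finset.card_bij (fun a _ => (t a).1.1) ?_ ?_ ?_
  · intro a ha
    simp only [Finset.mem_filter, Finset.mem_univ, true_and] at ha
    have h := YoungDiagram.mem_iff_lt_colLen.1 ((YoungDiagram.mem_cells _).1 (t a).2)
    rw [ha.1] at h
    exact Finset.mem_range.2 (lt_min ha.2 h)
  · intro a ha a' ha' h
    simp only [Finset.mem_filter, Finset.mem_univ, true_and] at ha ha'
    exact t.injective (Subtype.ext (Prod.ext h (ha.1.trans ha'.1.symm)))
  · intro i hi
    rw [Finset.mem_range] at hi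
    have h : (i, j) ∈ D.cells :=
      (YoungDiagram.mem_cells _).2 (YoungDiagram.mem_iff_lt_colLen.2 (by omega))
    exact ⟨t.symm ⟨(i, j), h⟩, by simp; omega, by simp⟩

/-- Entries of one column of `t` have distinct values of `row`, so at most `k` of them lie below
`k`; and the column has only `D.colLen j` entries altogether. -/
theorem card_column_le (t : Fin n ≃ {c : ℕ × ℕ // c ∈ D.cells}) (row : Fin n → ℕ)
    (h : ∀ a b, row a = row b → (t a).1.2 = (t b).1.2 → a = b) (j k : ℕ) :
    (Finset.univ.filter fun a => (t a).1.2 = j ∧ row a < k).card ≤ min k (D.colLen j) := by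
  refine le_min ?_ ?_
  · conv_rhs => rw [← Finset.card_range k]
    refine Finset.card_le_card_of_injOn row ?_ ?_
    · intro a ha
      simp at ha
      simpa using ha.2
    · intro a ha a' ha' e
      simp at ha ha'
      exact h a a' e (ha.1.trans ha'.1.symm)
  · have h1 := card_column t j (D.colLen j)
    rw [min_self] at h1
    rw [← h1]
    refine Finset.card_le_card fun a ha => ?_
    simp only [Finset.mem_filter, Finset.mem_univ, true_and] at ha ⊢
    have h := YoungDiagram.mem_iff_lt_colLen.1 ((YoungDiagram.mem_cells _).1 (t a).2)
    rw [ha.1] at h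
    exact ⟨ha.1, h⟩

theorem card_filter_eq_sum_column (t : Fin n ≃ {c : ℕ × ℕ // c ∈ D.cells}) (row : Fin n → ℕ)
    (k : ℕ) : (Finset.univ.filter fun a => row a < k).card
      = ∑ j ∈ Finset.univ.image fun a => (t a).1.2,
        (Finset.univ.filter fun a => (t a).1.2 = j ∧ row a < k).card := by
  rw [Finset.card_eq_sum_card_fiberwise (f := fun a => (t a).1.2)
    (t := Finset.univ.image fun a => (t a).1.2) (fun a _ => by simp)]
  simp only [Finset.filter_filter, and_comm]

/-- If entries in a row of `t'` lie in distinct columns of `t`, the shape of `t` dominates that of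
`t'`. -/
theorem cellsAbove_le (t : Fin n ≃ {c : ℕ × ℕ // c ∈ D.cells})
    (t' : Fin n ≃ {c : ℕ × ℕ // c ∈ D'.cells})
    (h : ∀ a b, (t' a).1.1 = (t' b).1.1 → (t a).1.2 = (t b).1.2 → a = b) (k : ℕ) :
    cellsAbove D' k ≤ cellsAbove D k := by
  rw [cellsAbove_eq_card t', cellsAbove_eq_card t, card_filter_eq_sum_column t (fun a => (t' a).1.1),
    card_filter_eq_sum_column t (fun a => (t a).1.1)]
  -- Compare column by column of `t`: the count for `t` itself attains the upper bound that holds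
  -- for `t'`.
  refine Finset.sum_le_sum fun j _ => ?_
  rw [card_column t]
  exact card_column_le t (fun a => (t' a).1.1) h j k

/-- With equal shapes the column bounds add up to the same total, so each is an equality. Hence the
rows under `t'` of the entries in a column of `t` fill that column without gaps. -/
theorem mem_cells_of_distinct_columns (t t' : Fin n ≃ {c : ℕ × ℕ // c ∈ D.cells})
    (h : ∀ a b, (t' a).1.1 = (t' b).1.1 → (t a).1.2 = (t b).1.2 → a = b) (a : Fin n) :
    ((t' a).1.1, (t a).1.2) ∈ D.cells := by
  have key : ∀ j ∈ Finset.univ.image fun a => (t a).1.2, ∀ k,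
      (Finset.univ.filter fun a => (t a).1.2 = j ∧ (t' a).1.1 < k).card
        = min k (D.colLen j) := by
    intro j hj k
    have h1 := cellsAbove_eq_card t' k
    rw [cellsAbove_eq_card t, card_filter_eq_sum_column t (fun a => (t' a).1.1),
      card_filter_eq_sum_column t (fun a => (t a).1.1)] at h1
    have h2 := (Finset.sum_eq_sum_iff_of_le fun j _ => by
      rw [card_column t]; exact card_column_le t (fun a => (t' a).1.1) h j k).1 h1.symm j hj
    rw [h2, card_column]
  have hj : (t a).1.2 ∈ Finset.univ.image fun a => (t a).1.2 :=
    Finset.mem_image_of_mem _ (Finset.mem_univ a)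
  rw [YoungDiagram.mem_cells, YoungDiagram.mem_iff_lt_colLen]
  -- If the row of `a` lay beyond the column, the counts below that row and below the next would
  -- both equal the column length, leaving no room for `a`.
  by_contra! hlt
  have h1 := key _ hj (t' a).1.1
  rw [min_eq_right hlt] at h1
  have h2 := key _ hj ((t' a).1.1 + 1)
  rw [min_eq_right (by omega)] at h2
  have h3 := Finset.eq_of_subset_of_card_le (s := Finset.univ.filter fun b =>
    (t b).1.2 = (t a).1.2 ∧ (t' b).1.1 < (t' a).1.1) (t := Finset.univ.filter fun b =>
    (t b).1.2 = (t a).1.2 ∧ (t' b).1.1 < (t' a).1.1 + 1) (by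
      intro b hb
      simp only [Finset.mem_filter, Finset.mem_univ, true_and] at hb ⊢
      exact ⟨hb.1, by omega⟩) (by omega)
  have h4 : a ∈ Finset.univ.filter fun b =>
    (t b).1.2 = (t a).1.2 ∧ (t' b).1.1 < (t' a).1.1 := by
    rw [h3]; simp
  simp at h4

end Dominance

/-! ## Polytabloids and intertwiners between Specht modules -/

section Specht

variable {n : ℕ} {μ ν : n.Partition}

theorem permTableau_apply (σ : Equiv.Perm (Fin n)) (t : Tableau μ) (k : Fin n) :
    permTableau σ t k = t (σ⁻¹ k) := rfl

theorem permTabloid_mk (σ : Equiv.Perm (Fin n)) (t : Tableau μ) :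
    permTabloid σ (Quotient.mk (rowSetoid μ) t) = Quotient.mk (rowSetoid μ) (permTableau σ t) :=
  rfl

theorem permTabloid_mul (σ τ : Equiv.Perm (Fin n)) (T : Tabloid μ) :
    permTabloid (σ * τ) T = permTabloid σ (permTabloid τ T) := by
  induction T using Quotient.inductionOn
  rfl

theorem permTabloid_one (T : Tabloid μ) : permTabloid 1 T = T := by
  induction T using Quotient.inductionOn
  rfl

theorem permTabloid_eq_iff (σ : Equiv.Perm (Fin n)) (S T : Tabloid μ) :
    permTabloid σ S = T ↔ S = permTabloid σ⁻¹ T := by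
  constructor
  · rintro rfl
    rw [← permTabloid_mul, inv_mul_cancel, permTabloid_one]
  · rintro rfl
    rw [← permTabloid_mul, mul_inv_cancel, permTabloid_one]

theorem exists_permTableau_eq (t t' : Tableau μ) :
    ∃ σ : Equiv.Perm (Fin n), permTableau σ t = t' :=
  ⟨(t'.trans t.symm).symm, by ext1 k; simp [permTableau]⟩

/-- The action of a permutation on tabloids as an equivalence. -/
def permTabloidEquiv (σ : Equiv.Perm (Fin n)) : Tabloid μ ≃ Tabloid μ where
  toFun := permTabloid σ
  invFun := permTabloid σ⁻¹
  left_inv T := by rw [← permTabloid_mul, inv_mul_cancel, permTabloid_one]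
  right_inv T := by rw [← permTabloid_mul, mul_inv_cancel, permTabloid_one]

theorem permModuleAct_apply (σ : Equiv.Perm (Fin n)) (v : PermModule μ) (T : Tabloid μ) :
    permModuleAct σ v T = v (permTabloid σ⁻¹ T) := rfl

theorem permModuleAct_mul (σ τ : Equiv.Perm (Fin n)) (v : PermModule μ) :
    permModuleAct (σ * τ) v = permModuleAct σ (permModuleAct τ v) := by
  ext T
  simp only [permModuleAct_apply, _root_.mul_inv_rev, permTabloid_mul]

theorem permModuleAct_one (v : PermModule μ) : permModuleAct 1 v = v := by
  ext T
  simp only [permModuleAct_apply, inv_one, permTabloid_one]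

/-- The action of a permutation on the permutation module as a linear map. -/
def permModuleActLin (σ : Equiv.Perm (Fin n)) : PermModule μ →ₗ[ℝ] PermModule μ where
  toFun := permModuleAct σ
  map_add' _ _ := rfl
  map_smul' _ _ := rfl

theorem inner_permModuleAct (σ : Equiv.Perm (Fin n)) (v w : PermModule μ) :
    inner ℝ (permModuleAct σ v) (permModuleAct σ w) = inner ℝ v w := by
  simp only [PiLp.inner_apply, permModuleAct_apply]
  exact Equiv.sum_comp (permTabloidEquiv σ⁻¹) fun T => inner ℝ (v T) (w T)

theorem inner_permModuleAct_left (σ : Equiv.Perm (Fin n)) (v w : PermModule μ) :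
    inner ℝ (permModuleAct σ v) w = inner ℝ v (permModuleAct σ⁻¹ w) := by
  rw [← inner_permModuleAct σ v, ← permModuleAct_mul, mul_inv_cancel, permModuleAct_one]

/-- Permutations of the entries of `t` within its columns. -/
def PreservesColumns (t : Tableau μ) (π : Equiv.Perm (Fin n)) : Prop :=
  ∀ k, (t (π k)).1.2 = (t k).1.2

theorem PreservesColumns.mul {t : Tableau μ} {π ρ : Equiv.Perm (Fin n)}
    (h : PreservesColumns t π) (h' : PreservesColumns t ρ) : PreservesColumns t (π * ρ) :=
  fun k => (h (ρ k)).trans (h' k)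

theorem PreservesColumns.inv {t : Tableau μ} {π : Equiv.Perm (Fin n)}
    (h : PreservesColumns t π) : PreservesColumns t π⁻¹ := fun k => by
  have := h (π⁻¹ k)
  rw [← Equiv.Perm.mul_apply, mul_inv_cancel, Equiv.Perm.one_apply] at this
  exact this.symm

theorem preservesColumns_swap {t : Tableau μ} {a b : Fin n} (h : (t a).1.2 = (t b).1.2) :
    PreservesColumns t (Equiv.swap a b) := fun k => by
  rw [Equiv.swap_apply_def]
  split_ifs with h1 h2
  · rw [h1, h]
  · rw [h2, h]
  · rfl

open Classical in
theorem polytabloid_apply (t : Tableau μ) (T : Tabloid μ) :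
    polytabloid t T = ∑ π : Equiv.Perm (Fin n),
      if PreservesColumns t π ∧ permTabloid π (Quotient.mk _ t) = T then
        ((Equiv.Perm.sign π : ℤ) : ℝ) else 0 := by
  have h : polytabloid t = ∑ π : Equiv.Perm (Fin n), if PreservesColumns t π then
      ((Equiv.Perm.sign π : ℤ) : ℝ) • (EuclideanSpace.single
        (permTabloid π (Quotient.mk (rowSetoid μ) t)) (1 : ℝ) : PermModule μ) else 0 := by
    unfold polytabloid PreservesColumns
    refine Finset.sum_congr rfl fun π _ => ?_
    congr
  rw [h, WithLp.ofLp_sum, Finset.sum_apply]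
  refine Finset.sum_congr rfl fun π _ => ?_
  by_cases h1 : PreservesColumns t π
  · by_cases h2 : permTabloid π (Quotient.mk _ t) = T
    · simp [h1, h2]
    · simp [h1, h2, Ne.symm h2]
  · simp [h1]

theorem preservesColumns_permTableau_conj (σ π : Equiv.Perm (Fin n)) (t : Tableau μ) :
    PreservesColumns (permTableau σ t) (σ * π * σ⁻¹) ↔ PreservesColumns t π := by
  constructor
  · intro h k
    simpa [permTableau_apply] using h (σ k)
  · intro h k
    simpa [permTableau_apply] using h (σ⁻¹ k)

/-- The column stabilizer of `σ t` is the conjugate by `σ` of that of `t`, and conjugation preserves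
signs. -/
theorem permModuleAct_polytabloid (σ : Equiv.Perm (Fin n)) (t : Tableau μ) :
    permModuleAct σ (polytabloid t) = polytabloid (permTableau σ t) := by
  classical
  ext T
  rw [permModuleAct_apply, polytabloid_apply, polytabloid_apply]
  conv_rhs => rw [← Equiv.sum_comp (MulAut.conj σ).toEquiv]
  refine Finset.sum_congr rfl fun π _ => ?_
  have h1 : (MulAut.conj σ).toEquiv π = σ * π * σ⁻¹ := rfl
  have h2 : permTabloid (σ * π * σ⁻¹) (Quotient.mk _ (permTableau σ t)) = T
      ↔ permTabloid π (Quotient.mk _ t) = permTabloid σ⁻¹ T := by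
    rw [← permTabloid_mk, ← permTabloid_mul, inv_mul_cancel_right, permTabloid_mul,
      permTabloid_eq_iff σ]
  rw [h1]
  refine if_congr (and_congr (preservesColumns_permTableau_conj σ π t).symm h2.symm) ?_ rfl
  rw [Equiv.Perm.sign_mul, Equiv.Perm.sign_mul, Equiv.Perm.sign_inv, mul_right_comm,
    Int.units_mul_self, one_mul]

/-- A column permutation is absorbed by the signed sum over the column stabilizer, at the cost of
its sign. -/
theorem polytabloid_permTableau {t : Tableau μ} {ρ : Equiv.Perm (Fin n)}
    (h : PreservesColumns t ρ) :
    polytabloid (permTableau ρ t) = ((Equiv.Perm.sign ρ : ℤ) : ℝ) • polytabloid t := by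
  classical
  rw [← permModuleAct_polytabloid]
  ext T
  rw [permModuleAct_apply, PiLp.smul_apply, polytabloid_apply, polytabloid_apply,
    ← Equiv.sum_comp (Equiv.mulLeft ρ⁻¹), smul_eq_mul, Finset.mul_sum]
  refine Finset.sum_congr rfl fun π _ => ?_
  have h1 : PreservesColumns t (ρ⁻¹ * π) ↔ PreservesColumns t π :=
    ⟨fun h' => by simpa using h.mul h', fun h' => h.inv.mul h'⟩
  have h2 : permTabloid (ρ⁻¹ * π) (Quotient.mk _ t) = permTabloid ρ⁻¹ T
      ↔ permTabloid π (Quotient.mk _ t) = T := by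
    rw [permTabloid_mul, permTabloid_eq_iff ρ⁻¹, ← permTabloid_mul ρ⁻¹⁻¹, inv_inv,
      mul_inv_cancel, permTabloid_one]
  rw [mul_ite, mul_zero]
  refine if_congr (and_congr h1 h2) ?_ rfl
  simp

/-- Only the identity preserves both rows and columns. This shows that Specht modules are nonzero,
and it normalizes the uniqueness argument below. -/
theorem polytabloid_apply_self (t : Tableau μ) : polytabloid t (Quotient.mk _ t) = 1 := by
  classical
  rw [polytabloid_apply, Finset.sum_eq_single 1]
  · rw [if_pos ⟨fun _ => rfl, permTabloid_one _⟩]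
    simp
  · intro π _ hπ
    rw [if_neg]
    rintro ⟨h1, h2⟩
    apply hπ
    rw [permTabloid_mk, Quotient.eq] at h2
    have h3 : π⁻¹ = 1 := by
      ext1 k
      exact t.injective (Subtype.ext (Prod.ext (h2 k) (h1.inv k)))
    exact inv_eq_one.1 h3
  · simp

theorem polytabloid_mem_specht (t : Tableau μ) : polytabloid t ∈ specht μ :=
  Submodule.subset_span ⟨t, rfl⟩

theorem permModuleAct_mem_specht (σ : Equiv.Perm (Fin n)) {v : PermModule μ}
    (hv : v ∈ specht μ) : permModuleAct σ v ∈ specht μ := by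
  have h : specht μ ≤ (specht μ).comap (permModuleActLin σ) := by
    rw [specht, Submodule.span_le]
    rintro _ ⟨t, rfl⟩
    change permModuleAct σ (polytabloid t) ∈ specht μ
    rw [permModuleAct_polytabloid]
    exact polytabloid_mem_specht _
  exact h hv

theorem dimS_pos (μ : n.Partition) : 0 < dimS μ := by
  obtain ⟨t⟩ := tableau_nonempty μ
  have : Nontrivial (specht μ) := by
    refine ⟨⟨polytabloid t, polytabloid_mem_specht t⟩, 0, fun h => ?_⟩
    have h1 : polytabloid t = 0 := congrArg Subtype.val h
    have h2 := polytabloid_apply_self t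
    rw [h1] at h2
    simp at h2
  exact Module.finrank_pos

/-! ### Matrix elements -/

variable (b : SpechtBases n)

theorem R_apply (μ : n.Partition) (σ : Equiv.Perm (Fin n)) (k l : Fin (dimS μ)) :
    R b μ σ k l
      = ((inner ℝ (b μ k : PermModule μ) (permModuleAct σ (b μ l : PermModule μ)) : ℝ) : ℂ) := rfl

theorem sum_inner_mul_basis {v : PermModule μ} (hv : v ∈ specht μ) :
    ∑ i, (inner ℝ (b μ i : PermModule μ) v : ℝ) • (b μ i : PermModule μ) = v := by
  have h := congrArg Subtype.val ((b μ).sum_repr' ⟨v, hv⟩)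
  simpa using h

theorem inner_eq_sum_inner_mul_inner (v : PermModule μ) {w : PermModule μ} (hw : w ∈ specht μ) :
    (inner ℝ v w : ℝ) = ∑ i, (inner ℝ v (b μ i : PermModule μ) : ℝ)
      * inner ℝ (b μ i : PermModule μ) w := by
  conv_lhs => rw [← sum_inner_mul_basis b hw]
  simp only [inner_sum, inner_smul_right, mul_comm]

theorem R_mul (μ : n.Partition) (σ τ : Equiv.Perm (Fin n)) :
    R b μ (σ * τ) = R b μ σ * R b μ τ := by
  ext k l
  simp only [Matrix.mul_apply, R_apply]
  rw [permModuleAct_mul, ← inv_inv σ, ← inner_permModuleAct_left,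
    inner_eq_sum_inner_mul_inner b _ (permModuleAct_mem_specht τ (b μ l).2)]
  simp only [inner_permModuleAct_left]
  push_cast
  rfl

theorem R_one (μ : n.Partition) : R b μ 1 = 1 := by
  ext k l
  rw [R_apply, permModuleAct_one, ← Submodule.coe_inner,
    orthonormal_iff_ite.1 (b μ).orthonormal k l, Matrix.one_apply]
  split_ifs <;> simp

theorem R_transpose (μ : n.Partition) (σ : Equiv.Perm (Fin n)) : (R b μ σ)ᵀ = R b μ σ⁻¹ := by
  ext k l
  rw [Matrix.transpose_apply, R_apply, R_apply, real_inner_comm, inner_permModuleAct_left]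

theorem R_inv_apply (μ : n.Partition) (σ : Equiv.Perm (Fin n)) (k l : Fin (dimS μ)) :
    R b μ σ⁻¹ k l = R b μ σ l k := by
  rw [← R_transpose, Matrix.transpose_apply]

theorem star_R_apply (μ : n.Partition) (σ : Equiv.Perm (Fin n)) (k l : Fin (dimS μ)) :
    star (R b μ σ k l) = R b μ σ k l := Complex.conj_ofReal _

theorem R_conjTranspose (μ : n.Partition) (σ : Equiv.Perm (Fin n)) :
    (R b μ σ)ᴴ = R b μ σ⁻¹ := by
  ext k l
  rw [Matrix.conjTranspose_apply, star_R_apply, R_inv_apply]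

/-- The coordinates of the polytabloids. -/
def polyCoord (t : Tableau μ) (i : Fin (dimS μ)) : ℂ :=
  ((inner ℝ (b μ i : PermModule μ) (polytabloid t) : ℝ) : ℂ)

theorem R_mulVec_polyCoord (σ : Equiv.Perm (Fin n)) (t : Tableau μ) :
    R b μ σ *ᵥ polyCoord b t = polyCoord b (permTableau σ t) := by
  ext k
  rw [polyCoord, ← permModuleAct_polytabloid, ← inv_inv σ, ← inner_permModuleAct_left,
    inner_eq_sum_inner_mul_inner b _ (polytabloid_mem_specht t)]
  simp only [inner_permModuleAct_left, inv_inv, Matrix.mulVec, dotProduct, R_apply, polyCoord]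
  push_cast
  rfl

theorem polyCoord_permTableau {t : Tableau μ} {ρ : Equiv.Perm (Fin n)}
    (h : PreservesColumns t ρ) :
    polyCoord b (permTableau ρ t) = ((Equiv.Perm.sign ρ : ℤ) : ℂ) • polyCoord b t := by
  ext k
  simp [polyCoord, polytabloid_permTableau h, inner_smul_right]

theorem sum_polyCoord_mul_basis (t : Tableau μ) (T : Tabloid μ) :
    ∑ i, polyCoord b t i * (((b μ i : PermModule μ) T : ℝ) : ℂ)
      = ((polytabloid t T : ℝ) : ℂ) := by
  have h := congrArg (fun v : PermModule μ => v T)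
    (sum_inner_mul_basis b (polytabloid_mem_specht t))
  simp only [WithLp.ofLp_sum, Finset.sum_apply, PiLp.smul_apply, smul_eq_mul] at h
  rw [← h]
  push_cast
  rfl

/-- The vector with coordinates `x` lies in the Specht module and is orthogonal to a spanning set of
it. -/
theorem eq_zero_of_sum_mul_polyCoord {x : Fin (dimS μ) → ℝ}
    (h : ∀ t : Tableau μ, ∑ i, x i * (inner ℝ (b μ i : PermModule μ) (polytabloid t) : ℝ) = 0) :
    x = 0 := by
  set w : specht μ := ∑ i, x i • b μ i with hw
  have h1 : ∀ v ∈ specht μ, (inner ℝ (w : PermModule μ) v : ℝ) = 0 := by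
    intro v hv
    induction hv using Submodule.span_induction with
    | mem v hv =>
      obtain ⟨t, rfl⟩ := hv
      rw [← h t, hw]
      simp [sum_inner, inner_smul_left]
    | zero => exact inner_zero_right _
    | add v v' _ _ h1 h2 => rw [inner_add_right, h1, h2, add_zero]
    | smul c v _ h1 => rw [inner_smul_right, h1, mul_zero]
  have h2 : w = 0 := Subtype.ext (inner_self_eq_zero.1 (h1 w w.2))
  ext i
  have h3 : (inner ℝ (b μ i) w : ℝ) = x i := by
    rw [hw]
    exact (b μ).orthonormal.inner_right_fintype x i
  rw [← h3, h2, inner_zero_right, Pi.zero_apply]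

/-- The polytabloids span the complexified Specht module. -/
theorem matrix_ext_polyCoord {Y : Type*} {X X' : Matrix Y (Fin (dimS μ)) ℂ}
    (h : ∀ t : Tableau μ, X *ᵥ polyCoord b t = X' *ᵥ polyCoord b t) : X = X' := by
  ext y i
  have key : ∀ t : Tableau μ, ∑ i, (X y i - X' y i) * polyCoord b t i = 0 := by
    intro t
    have := congrFun (h t) y
    simp only [Matrix.mulVec, dotProduct] at this
    simp only [sub_mul, Finset.sum_sub_distrib, this, sub_self]
  -- The polytabloids have real coordinates, so real and imaginary parts can be treated separately.
  have hre := congrFun (eq_zero_of_sum_mul_polyCoord b (x := fun i => (X y i - X' y i).re)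
    fun t => by simpa [polyCoord] using congrArg Complex.re (key t)) i
  have him := congrFun (eq_zero_of_sum_mul_polyCoord b (x := fun i => (X y i - X' y i).im)
    fun t => by simpa [polyCoord] using congrArg Complex.im (key t)) i
  exact sub_eq_zero.1 (Complex.ext hre him)

end Specht

/-! ### Schur's lemma for Specht modules -/

section Intertwiners

variable {n : ℕ} {μ ν : n.Partition}

/-- Families of functions, indexed by tableaux, that transform like the polytabloids. -/
structure IsPolytabloidLike {Ω : Type*} (act : Equiv.Perm (Fin n) → Ω → Ω)
    (f : Tableau μ → Ω → ℂ) : Prop where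
  equivariant : ∀ σ t ω, f (permTableau σ t) (act σ ω) = f t ω
  alternating : ∀ t π, PreservesColumns t π → ∀ ω,
    f (permTableau π t) ω = ((Equiv.Perm.sign π : ℤ) : ℂ) * f t ω

/-- The transposition of `a` and `b` fixes `ω` and is odd in the column stabilizer, so the value
equals its own negative. -/
theorem IsPolytabloidLike.eq_zero {Ω : Type*} {act : Equiv.Perm (Fin n) → Ω → Ω}
    {f : Tableau μ → Ω → ℂ} (hf : IsPolytabloidLike act f) {t : Tableau μ} {ω : Ω} {a b : Fin n}
    (hab : a ≠ b) (hcol : (t a).1.2 = (t b).1.2) (hfix : act (Equiv.swap a b) ω = ω) :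
    f t ω = 0 := by
  have h1 := hf.equivariant (Equiv.swap a b) t ω
  rw [hfix, hf.alternating t _ (preservesColumns_swap hcol), Equiv.Perm.sign_swap hab] at h1
  simp only [Units.val_neg, Units.val_one, Int.cast_neg, Int.cast_one, neg_one_mul] at h1
  linear_combination -(1 / 2 : ℂ) * h1

theorem permTabloid_swap {t : Tableau μ} {a b : Fin n} (h : (t a).1.1 = (t b).1.1) :
    permTabloid (Equiv.swap a b) (Quotient.mk _ t) = Quotient.mk _ t := by
  rw [permTabloid_mk]
  refine Quotient.sound fun k => ?_
  rw [permTableau_apply, Equiv.swap_inv, Equiv.swap_apply_def]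
  split_ifs with h1 h2
  · rw [h1, h]
  · rw [h2, h]
  · rfl

theorem IsPolytabloidLike.eq_of_ne_zero {f : Tableau μ → Tabloid ν → ℂ}
    (hf : IsPolytabloidLike permTabloid f) {t : Tableau μ} {t' : Tableau ν}
    (h : f t (Quotient.mk _ t') ≠ 0) (a b : Fin n) (hrow : (t' a).1.1 = (t' b).1.1)
    (hcol : (t a).1.2 = (t b).1.2) : a = b := by
  by_contra hab
  exact h (hf.eq_zero hab hcol (permTabloid_swap hrow))

theorem IsPolytabloidLike.apply_self {f : Tableau μ → Tabloid μ → ℂ}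
    (hf : IsPolytabloidLike permTabloid f) (t t' : Tableau μ) :
    f t (Quotient.mk _ t) = f t' (Quotient.mk _ t') := by
  obtain ⟨σ, rfl⟩ := exists_permTableau_eq t t'
  rw [← permTabloid_mk, hf.equivariant]

/-- Put each entry in its row from `t'` and its column from `t`. The count above shows that this is
a tableau of the same shape; it is column equivalent to `t` and row equivalent to `t'`. -/
theorem exists_preservesColumns {t t' : Tableau μ}
    (h : ∀ a b, (t' a).1.1 = (t' b).1.1 → (t a).1.2 = (t b).1.2 → a = b) :
    ∃ π, PreservesColumns t π ∧
      permTabloid π (Quotient.mk _ t) = Quotient.mk (rowSetoid μ) t' := by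
  let g : Fin n → {c : ℕ × ℕ // c ∈ (diagram μ).cells} :=
    fun a => ⟨((t' a).1.1, (t a).1.2), mem_cells_of_distinct_columns t t' h a⟩
  have hg : Function.Bijective g := by
    rw [Fintype.bijective_iff_injective_and_card]
    refine ⟨fun a b hab => ?_, Fintype.card_congr t⟩
    have h1 : ((t' a).1.1, (t a).1.2) = ((t' b).1.1, (t b).1.2) := congrArg Subtype.val hab
    exact h a b (Prod.ext_iff.1 h1).1 (Prod.ext_iff.1 h1).2
  obtain ⟨σ, hσ⟩ := exists_permTableau_eq t (Equiv.ofBijective g hg)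
  have hσ' : ∀ k, t (σ⁻¹ k) = g k := fun k => by
    rw [← permTableau_apply, hσ]
    rfl
  refine ⟨σ, ?_, ?_⟩
  · intro k
    have := congrArg (fun c => c.1.2) (hσ' (σ k))
    simpa using this.symm
  · rw [permTabloid_mk, hσ]
    exact Quotient.sound fun k => rfl

theorem isPolytabloidLike_polytabloid :
    IsPolytabloidLike permTabloid
      (fun (t : Tableau μ) (T : Tabloid μ) => ((polytabloid t T : ℝ) : ℂ)) where
  equivariant σ t T := by
    rw [← permModuleAct_polytabloid, permModuleAct_apply, ← permTabloid_mul, inv_mul_cancel,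
      permTabloid_one]
  alternating t π h T := by
    rw [polytabloid_permTableau h]
    simp

/-- Either the tabloid is a column permutation of `{t}`, and its value is a sign times the common
diagonal value, or two entries share a row of `t'` and a column of `t`, and the value is zero. -/
theorem IsPolytabloidLike.unique {f g : Tableau μ → Tabloid μ → ℂ}
    (hf : IsPolytabloidLike permTabloid f) (hg : IsPolytabloidLike permTabloid g)
    {t₀ : Tableau μ} (h₀ : f t₀ (Quotient.mk _ t₀) = g t₀ (Quotient.mk _ t₀))
    (t : Tableau μ) (T : Tabloid μ) : f t T = g t T := by
  induction T using Quotient.inductionOn with | _ t' => ?_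
  by_cases h : ∀ a b, (t' a).1.1 = (t' b).1.1 → (t a).1.2 = (t b).1.2 → a = b
  · obtain ⟨π, hπ, hT⟩ := exists_preservesColumns h
    have key : ∀ {f : Tableau μ → Tabloid μ → ℂ}, IsPolytabloidLike permTabloid f →
        f t (Quotient.mk _ t') = ((Equiv.Perm.sign π⁻¹ : ℤ) : ℂ) * f t₀ (Quotient.mk _ t₀) := by
      intro f hf
      rw [← hT, hf.apply_self t₀ t, ← hf.equivariant π⁻¹ t, ← permTabloid_mul, inv_mul_cancel,
        permTabloid_one, hf.alternating _ _ hπ.inv]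
    rw [key hf, key hg, h₀]
  · push Not at h
    obtain ⟨a, b, h1, h2, h3⟩ := h
    have h4 := permTabloid_swap (t := t') h1
    exact (hf.eq_zero h3 h2 h4).trans (hg.eq_zero h3 h2 h4).symm

variable (b : SpechtBases n)

theorem sum_R_mul_basis (σ : Equiv.Perm (Fin n)) (j : Fin (dimS μ)) (T : Tabloid μ) :
    ∑ i, R b μ σ i j * (((b μ i : PermModule μ) (permTabloid σ T) : ℝ) : ℂ)
      = (((b μ j : PermModule μ) T : ℝ) : ℂ) := by
  have h := congrArg (fun v : PermModule μ => v (permTabloid σ T))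
    (sum_inner_mul_basis b (permModuleAct_mem_specht σ (b μ j).2))
  simp only [WithLp.ofLp_sum, Finset.sum_apply, PiLp.smul_apply, smul_eq_mul,
    permModuleAct_apply, ← permTabloid_mul, inv_mul_cancel, permTabloid_one] at h
  rw [← h]
  simp only [R_apply]
  push_cast
  rfl

theorem sum_basis_mul_basis (i k : Fin (dimS μ)) :
    ∑ T, (((b μ i : PermModule μ) T : ℝ) : ℂ) * (((b μ k : PermModule μ) T : ℝ) : ℂ)
      = if i = k then 1 else 0 := by
  have h := orthonormal_iff_ite.1 (b μ).orthonormal k i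
  rw [Submodule.coe_inner, PiLp.inner_apply] at h
  simp only [eq_comm (a := i)]
  have h2 := congrArg (fun x : ℝ => (x : ℂ)) h
  simp only [RCLike.inner_apply, conj_trivial] at h2
  push_cast at h2
  rw [h2]
  split_ifs <;> simp

variable {b}

/-- Serves two targets: `Ω` is the set of tabloids for intertwiners of Specht modules, and the set
of words for maps into the tensor power. -/
theorem isPolytabloidLike_mulVec {Ω : Type*} {act : Equiv.Perm (Fin n) → Ω → Ω}
    {X : Matrix Ω (Fin (dimS μ)) ℂ}
    (hX : ∀ σ ω i, (X * R b μ σ) (act σ ω) i = X ω i) :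
    IsPolytabloidLike act fun (t : Tableau μ) ω => (X *ᵥ polyCoord b t) ω where
  equivariant σ t ω := by
    rw [← R_mulVec_polyCoord, Matrix.mulVec_mulVec]
    simp only [Matrix.mulVec, dotProduct, hX]
  alternating t π h ω := by
    rw [polyCoord_permTableau b h, Matrix.mulVec_smul, Pi.smul_apply, smul_eq_mul]

/-- The coordinates of the basis vectors on tabloids. -/
def basisMatrix (b : SpechtBases n) (μ : n.Partition) : Matrix (Tabloid μ) (Fin (dimS μ)) ℂ :=
  Matrix.of fun T i => (((b μ i : PermModule μ) T : ℝ) : ℂ)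

theorem basisMatrix_mul_R (σ : Equiv.Perm (Fin n)) (T : Tabloid μ) (j : Fin (dimS μ)) :
    (basisMatrix b μ * R b μ σ) (permTabloid σ T) j = basisMatrix b μ T j := by
  simp only [Matrix.mul_apply, basisMatrix, Matrix.of_apply]
  rw [← sum_R_mul_basis b σ]
  simp only [mul_comm]

theorem basisMatrix_transpose_mul_self :
    (basisMatrix b μ)ᵀ * basisMatrix b μ = 1 := by
  ext i k
  simp only [Matrix.mul_apply, basisMatrix, Matrix.of_apply, Matrix.transpose_apply,
    sum_basis_mul_basis, Matrix.one_apply]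

theorem isPolytabloidLike_intertwiner {X : Matrix (Fin (dimS ν)) (Fin (dimS μ)) ℂ}
    (hX : ∀ σ, R b ν σ * X = X * R b μ σ) :
    IsPolytabloidLike permTabloid
      fun (t : Tableau μ) T => ((basisMatrix b ν * X) *ᵥ polyCoord b t) T := by
  refine isPolytabloidLike_mulVec fun σ T i => ?_
  rw [Matrix.mul_assoc, ← hX, ← Matrix.mul_assoc, Matrix.mul_apply, Matrix.mul_apply]
  simp only [basisMatrix_mul_R]

/-- A nonzero intertwiner has a nonzero coefficient on some tabloid `{t'}` in the image of some
polytabloid `e_t`. There the entries of each row of `t'` lie in distinct columns of `t`, which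
forces dominance. -/
theorem cellsAbove_le_of_intertwiner {X : Matrix (Fin (dimS ν)) (Fin (dimS μ)) ℂ}
    (hX : ∀ σ, R b ν σ * X = X * R b μ σ) (h0 : X ≠ 0) (k : ℕ) :
    cellsAbove (diagram ν) k ≤ cellsAbove (diagram μ) k := by
  by_contra hlt
  refine h0 ?_
  have hf := isPolytabloidLike_intertwiner hX
  have h1 : basisMatrix b ν * X = 0 := by
    refine matrix_ext_polyCoord b fun t => ?_
    rw [Matrix.zero_mulVec]
    ext T
    induction T using Quotient.inductionOn with | _ t' => ?_
    by_contra hne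
    exact hlt (cellsAbove_le t t' (hf.eq_of_ne_zero hne) k)
  rw [← Matrix.one_mul X, ← basisMatrix_transpose_mul_self (b := b), Matrix.mul_assoc, h1,
    Matrix.mul_zero]

/-- Specht modules of different shapes are not isomorphic. -/
theorem intertwiner_eq_zero {X : Matrix (Fin (dimS ν)) (Fin (dimS μ)) ℂ}
    (hX : ∀ σ, R b ν σ * X = X * R b μ σ) (hne : ν ≠ μ) : X = 0 := by
  by_contra h0
  -- Dominance holds both ways: the matrices `R` are real orthogonal, so the transpose of `X` is an
  -- intertwiner in the opposite direction.
  refine hne (diagram_injective (eq_of_cellsAbove_eq fun k => le_antisymm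
    (cellsAbove_le_of_intertwiner hX h0 k)
    (cellsAbove_le_of_intertwiner (b := b) (X := Xᵀ) (fun σ => ?_)
      (fun h => h0 (by simpa using congrArg Matrix.transpose h)) k)))
  have h := congrArg Matrix.transpose (hX σ⁻¹)
  rw [Matrix.transpose_mul, Matrix.transpose_mul, R_transpose, R_transpose, inv_inv] at h
  exact h.symm

/-- Specht modules are absolutely irreducible. -/
theorem intertwiner_eq_scalar {X : Matrix (Fin (dimS μ)) (Fin (dimS μ)) ℂ}
    (hX : ∀ σ, R b μ σ * X = X * R b μ σ) : ∃ c : ℂ, X = c • (1 : Matrix _ _ ℂ) := by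
  obtain ⟨t₀⟩ := tableau_nonempty μ
  have hf := isPolytabloidLike_intertwiner hX
  -- The scalar is the coefficient of `{t₀}` in the image of `e_{t₀}`, where `e_{t₀}` itself has
  -- coefficient one.
  set c := ((basisMatrix b μ * X) *ᵥ polyCoord b t₀) (Quotient.mk _ t₀) with hc
  have hg : IsPolytabloidLike permTabloid
      fun (t : Tableau μ) (T : Tabloid μ) => c * ((polytabloid t T : ℝ) : ℂ) := by
    have h := isPolytabloidLike_polytabloid (μ := μ)
    refine ⟨fun σ t ω => by rw [h.equivariant], fun t π hπ ω => ?_⟩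
    rw [h.alternating t π hπ ω]
    ring
  have hfg := hf.unique hg (t₀ := t₀) (by rw [polytabloid_apply_self]; simp [hc])
  refine ⟨c, ?_⟩
  have h1 : basisMatrix b μ * X = c • basisMatrix b μ := by
    refine matrix_ext_polyCoord b fun t => ?_
    ext T
    rw [hfg t T, ← sum_polyCoord_mul_basis b t T, Matrix.smul_mulVec, Pi.smul_apply, smul_eq_mul]
    simp [Matrix.mulVec, dotProduct, basisMatrix, mul_comm]
  rw [← Matrix.one_mul X, ← basisMatrix_transpose_mul_self (b := b), Matrix.mul_assoc, h1,
    Matrix.mul_smul, basisMatrix_transpose_mul_self]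

end Intertwiners

/-! ## Schur orthogonality and the quantum Fourier transform -/

section Orthogonality

variable {n : ℕ} {μ ν : n.Partition} {b : SpechtBases n}

/-- The average of a matrix over the symmetric group. -/
def groupSum (b : SpechtBases n) (X : Matrix (Fin (dimS ν)) (Fin (dimS μ)) ℂ) :
    Matrix (Fin (dimS ν)) (Fin (dimS μ)) ℂ :=
  ∑ σ : Equiv.Perm (Fin n), R b ν σ * X * R b μ σ⁻¹

theorem R_mul_groupSum (X : Matrix (Fin (dimS ν)) (Fin (dimS μ)) ℂ) (τ : Equiv.Perm (Fin n)) :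
    R b ν τ * groupSum b X = groupSum b X * R b μ τ := by
  rw [groupSum, Matrix.mul_sum, Matrix.sum_mul, ← Equiv.sum_comp (Equiv.mulLeft τ⁻¹)]
  refine Finset.sum_congr rfl fun σ _ => ?_
  rw [Equiv.coe_mulLeft, ← Matrix.mul_assoc, ← Matrix.mul_assoc, ← R_mul, mul_inv_cancel_left,
    _root_.mul_inv_rev, inv_inv, R_mul]
  simp only [Matrix.mul_assoc]

theorem groupSum_single_apply (i j : Fin (dimS ν)) (k l : Fin (dimS μ)) :
    groupSum b (Matrix.single i k (1 : ℂ)) j l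
      = ∑ σ : Equiv.Perm (Fin n), R b ν σ j i * R b μ σ l k := by
  rw [groupSum, Matrix.sum_apply]
  refine Finset.sum_congr rfl fun σ _ => ?_
  rw [Matrix.mul_apply, Finset.sum_eq_single k]
  · rw [Matrix.mul_single_apply_same, mul_one, R_inv_apply]
  · intro x _ hx
    rw [Matrix.mul_single_apply_of_ne _ _ _ _ _ hx, zero_mul]
  · simp

theorem sum_R_mul_R_of_ne (h : ν ≠ μ) (i j : Fin (dimS ν)) (k l : Fin (dimS μ)) :
    ∑ σ : Equiv.Perm (Fin n), R b ν σ j i * R b μ σ l k = 0 := by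
  rw [← groupSum_single_apply, intertwiner_eq_zero (fun σ => R_mul_groupSum _ σ) h]
  rfl

theorem dimS_ne_zero (μ : n.Partition) : (dimS μ : ℂ) ≠ 0 :=
  Nat.cast_ne_zero.2 (dimS_pos μ).ne'

/-- The group sum of a matrix unit is an intertwiner, hence a scalar, and its trace determines the
scalar. No conjugate appears because `R` is real. -/
theorem sum_R_mul_R (i j k l : Fin (dimS μ)) :
    ∑ σ : Equiv.Perm (Fin n), R b μ σ j i * R b μ σ l k
      = if j = l ∧ i = k then (n.factorial : ℂ) / dimS μ else 0 := by
  obtain ⟨c, hc⟩ := intertwiner_eq_scalar (b := b) (X := groupSum b (Matrix.single i k (1 : ℂ)))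
    fun σ => R_mul_groupSum _ σ
  have htr : c * dimS μ = n.factorial * if i = k then 1 else 0 := by
    have h := congrArg Matrix.trace hc
    rw [Matrix.trace_smul, Matrix.trace_one, Fintype.card_fin, smul_eq_mul, groupSum,
      Matrix.trace_sum] at h
    rw [← h]
    have h1 : ∀ σ : Equiv.Perm (Fin n),
        (R b μ σ * Matrix.single i k (1 : ℂ) * R b μ σ⁻¹).trace = if i = k then 1 else 0 := by
      intro σ
      rw [Matrix.trace_mul_comm, ← Matrix.mul_assoc, ← R_mul, inv_mul_cancel, R_one,
        Matrix.one_mul]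
      split_ifs with hik
      · rw [hik, Matrix.trace_single_eq_same]
      · exact Matrix.trace_single_eq_of_ne _ _ _ hik
    simp only [h1]
    rw [Finset.sum_const, Finset.card_univ, Fintype.card_perm, Fintype.card_fin, nsmul_eq_mul]
  have hc' : c = (n.factorial * if i = k then 1 else 0) / dimS μ :=
    eq_div_of_mul_eq (dimS_ne_zero μ) htr
  rw [← groupSum_single_apply, hc, Matrix.smul_apply, Matrix.one_apply, smul_eq_mul, hc']
  by_cases h1 : j = l <;> by_cases h2 : i = k <;> simp [h1, h2]

/-! ### Characters and completeness of the Specht modules -/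

/-- The irreducible characters. -/
def character (b : SpechtBases n) (μ : n.Partition) (σ : Equiv.Perm (Fin n)) : ℂ :=
  (R b μ σ).trace

theorem character_conj (σ τ : Equiv.Perm (Fin n)) :
    character b μ (τ * σ * τ⁻¹) = character b μ σ := by
  rw [character, R_mul, Matrix.trace_mul_comm, ← R_mul, inv_mul_cancel_left, character]

theorem character_one (μ : n.Partition) : character b μ 1 = dimS μ := by
  rw [character, R_one, Matrix.trace_one, Fintype.card_fin]

theorem sum_character_mul_character (ν μ : n.Partition) :
    ∑ σ : Equiv.Perm (Fin n), character b ν σ * character b μ σ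
      = if ν = μ then (n.factorial : ℂ) else 0 := by
  simp only [character, Matrix.trace, Matrix.diag, Finset.sum_mul_sum]
  rw [Finset.sum_comm]
  have h1 : ∀ i, ∑ σ : Equiv.Perm (Fin n), ∑ j, R b ν σ i i * R b μ σ j j
      = ∑ j, ∑ σ : Equiv.Perm (Fin n), R b ν σ i i * R b μ σ j j := fun i => Finset.sum_comm
  simp only [h1]
  split_ifs with h
  · subst h
    simp only [sum_R_mul_R, and_self, Finset.sum_ite_eq, Finset.mem_univ, if_true,
      Finset.sum_const, Finset.card_univ, Fintype.card_fin, nsmul_eq_mul]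
    exact mul_div_cancel₀ _ (dimS_ne_zero ν)
  · simp only [sum_R_mul_R_of_ne h, Finset.sum_const_zero]

theorem linearIndependent_character : LinearIndependent ℂ (character b) := by
  rw [Fintype.linearIndependent_iff]
  intro g hg μ
  have h := congrArg (fun f : Equiv.Perm (Fin n) → ℂ => ∑ σ, f σ * character b μ σ) hg
  simp only [Finset.sum_apply, Pi.smul_apply, smul_eq_mul, Finset.sum_mul, Pi.zero_apply,
    zero_mul, Finset.sum_const_zero, mul_assoc] at h
  rw [Finset.sum_comm] at h
  simp only [← Finset.mul_sum, sum_character_mul_character] at h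
  simpa [Nat.factorial_ne_zero] using h

/-- Functions of the cycle type, as functions on the symmetric group. -/
def cycleTypeFun (n : ℕ) :
    ((Fintype.card (Fin n)).Partition → ℂ) →ₗ[ℂ] (Equiv.Perm (Fin n) → ℂ) :=
  LinearMap.funLeft ℂ ℂ fun σ => σ.partition

theorem mem_range_cycleTypeFun {f : Equiv.Perm (Fin n) → ℂ}
    (h : ∀ σ τ, IsConj σ τ → f σ = f τ) : f ∈ LinearMap.range (cycleTypeFun n) := by
  classical
  refine ⟨fun p => if hp : ∃ σ : Equiv.Perm (Fin n), σ.partition = p then f hp.choose else 0, ?_⟩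
  ext σ
  have hp : ∃ τ : Equiv.Perm (Fin n), τ.partition = σ.partition := ⟨σ, rfl⟩
  have h1 : cycleTypeFun n (fun p => if hp : ∃ σ : Equiv.Perm (Fin n), σ.partition = p then
      f hp.choose else 0) σ = f hp.choose := dif_pos hp
  rw [h1]
  exact h _ _ (Equiv.Perm.partition_eq_of_isConj.2 hp.choose_spec)

/-- The characters are independent and indexed by the partitions of `n`, while functions of the
cycle type span a space of at most that dimension. -/
theorem span_character :
    Submodule.span ℂ (Set.range (character b)) = LinearMap.range (cycleTypeFun n) := by
  refine Submodule.eq_of_le_of_finrank_le ?_ ?_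
  · rw [Submodule.span_le]
    rintro _ ⟨μ, rfl⟩
    refine mem_range_cycleTypeFun fun σ τ h => ?_
    obtain ⟨c, rfl⟩ := isConj_iff.1 h
    exact (character_conj σ c).symm
  · rw [finrank_span_eq_card linearIndependent_character]
    refine (LinearMap.finrank_range_le _).trans ?_
    rw [Module.finrank_fintype_fun_eq_card]
    -- Cycle types are partitions of `Fintype.card (Fin n)`, which is only propositionally `n`.
    have h : ∀ m, m = n → Fintype.card m.Partition = Fintype.card n.Partition := by
      rintro m rfl
      rfl
    exact (h _ (Fintype.card_fin n)).le

/-- The indicator of the identity is a class function, hence a combination of characters; pairing it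
with `χ_ν` gives the coefficient `χ_ν(1) = dim [ν]`. This is the completeness statement behind both
transforms. -/
theorem sum_dimS_mul_character (σ : Equiv.Perm (Fin n)) :
    ∑ μ : n.Partition, (dimS μ : ℂ) * character b μ σ = if σ = 1 then (n.factorial : ℂ) else 0 := by
  have h1 : (fun σ : Equiv.Perm (Fin n) => if σ = 1 then (n.factorial : ℂ) else 0)
      ∈ Submodule.span ℂ (Set.range (character b)) := by
    rw [span_character]
    refine mem_range_cycleTypeFun fun σ τ h => ?_
    obtain ⟨c, rfl⟩ := isConj_iff.1 h
    simp only [conj_eq_one_iff]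
  obtain ⟨c, hc⟩ := (Submodule.mem_span_range_iff_exists_fun ℂ).1 h1
  have h2 : ∀ ν : n.Partition, c ν = dimS ν := by
    intro ν
    have h := congrArg (fun f : Equiv.Perm (Fin n) → ℂ => ∑ σ, f σ * character b ν σ) hc
    simp only [Finset.sum_apply, Pi.smul_apply, smul_eq_mul, Finset.sum_mul, mul_assoc] at h
    rw [Finset.sum_comm] at h
    simp only [← Finset.mul_sum, sum_character_mul_character, ite_mul, zero_mul, mul_ite, mul_zero,
      Finset.sum_ite_eq', Finset.mem_univ, if_true, character_one] at h
    rw [mul_comm] at h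
    exact mul_left_cancel₀ (Nat.cast_ne_zero.2 n.factorial_ne_zero) h
  have h3 := congrFun hc σ
  simp only [Finset.sum_apply, Pi.smul_apply, smul_eq_mul, h2] at h3
  exact h3

/-! ### Unitarity of the Fourier transform -/

theorem sqrt_mul_sqrt_complex {x : ℝ} (hx : 0 ≤ x) :
    ((Real.sqrt x : ℝ) : ℂ) * ((Real.sqrt x : ℝ) : ℂ) = (x : ℂ) := by
  rw [← Complex.ofReal_mul, Real.mul_self_sqrt hx]

theorem qft_mul_conjTranspose : qft b * (qft b)ᴴ = 1 := by
  ext ⟨ν, j, i⟩ ⟨μ, l, k⟩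
  have h1 : (qft b * (qft b)ᴴ) ⟨ν, j, i⟩ ⟨μ, l, k⟩
      = ((Real.sqrt ((dimS ν : ℝ) / (n.factorial : ℝ)) : ℝ) : ℂ)
        * ((Real.sqrt ((dimS μ : ℝ) / (n.factorial : ℝ)) : ℝ) : ℂ)
        * ∑ σ : Equiv.Perm (Fin n), R b ν σ j i * R b μ σ l k := by
    rw [Matrix.mul_apply, Finset.mul_sum]
    refine Finset.sum_congr rfl fun σ _ => ?_
    rw [Matrix.conjTranspose_apply, qft, Matrix.of_apply, Matrix.of_apply, star_mul', star_R_apply,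
      Complex.star_def, Complex.conj_ofReal]
    ring
  rw [h1]
  by_cases h : ν = μ
  · subst h
    rw [sum_R_mul_R, sqrt_mul_sqrt_complex (by positivity), Matrix.one_apply]
    have hd := dimS_ne_zero ν
    have hf : (n.factorial : ℂ) ≠ 0 := Nat.cast_ne_zero.2 n.factorial_ne_zero
    by_cases h2 : j = l ∧ i = k
    · rw [if_pos h2, if_pos (by rw [h2.1, h2.2])]
      push_cast
      field_simp
    · rw [if_neg h2, if_neg, mul_zero]
      intro h3
      simp only [Sigma.mk.injEq, heq_eq_eq, true_and, Prod.mk.injEq] at h3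
      exact h2 h3
  · rw [sum_R_mul_R_of_ne h, mul_zero, Matrix.one_apply_ne]
    intro h2
    exact h (congrArg Sigma.fst h2)

/-- The entry at `σ`, `τ` is the regular character at `σ⁻¹ τ`, divided by `n!`. -/
theorem qft_conjTranspose_mul : (qft b)ᴴ * qft b = 1 := by
  ext σ τ
  rw [Matrix.mul_apply, Fintype.sum_sigma]
  have h1 : ∀ μ : n.Partition, ∑ x : Fin (dimS μ) × Fin (dimS μ),
      (qft b)ᴴ σ ⟨μ, x⟩ * qft b ⟨μ, x⟩ τ
        = (dimS μ : ℂ) * character b μ (σ⁻¹ * τ) / n.factorial := by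
    intro μ
    rw [Fintype.sum_prod_type, Finset.sum_comm, character, Matrix.trace, Finset.mul_sum,
      Finset.sum_div]
    refine Finset.sum_congr rfl fun k _ => ?_
    rw [Matrix.diag_apply, R_mul, Matrix.mul_apply, Finset.mul_sum, Finset.sum_div]
    refine Finset.sum_congr rfl fun i _ => ?_
    rw [Matrix.conjTranspose_apply, qft, Matrix.of_apply, Matrix.of_apply, star_mul', star_R_apply,
      Complex.star_def, Complex.conj_ofReal, R_inv_apply]
    have h := sqrt_mul_sqrt_complex (x := (dimS μ : ℝ) / (n.factorial : ℝ)) (by positivity)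
    push_cast at h
    linear_combination (R b μ σ i k * R b μ τ i k) * h
  simp only [h1]
  rw [← Finset.sum_div, sum_dimS_mul_character, Matrix.one_apply]
  have hf : (n.factorial : ℂ) ≠ 0 := Nat.cast_ne_zero.2 n.factorial_ne_zero
  by_cases h : σ = τ
  · rw [if_pos h, if_pos (by rw [h, inv_mul_cancel]), div_self hf]
  · rw [if_neg h, if_neg (by rwa [inv_mul_eq_one]), zero_div]

end Orthogonality

/-! ## The Schur transform -/

section PermOp

theorem eq_comp_symm_iff {n : ℕ} {X : Type*} (σ : Equiv.Perm (Fin n)) (x y : Fin n → X) :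
    x = y ∘ σ.symm ↔ y = x ∘ σ := by
  rw [Equiv.eq_comp_symm, eq_comm]

variable {n : ℕ} {X : Type*} [DecidableEq X]

theorem permOp_one : permOp X (1 : Equiv.Perm (Fin n)) = 1 := by
  ext x y
  rw [permOp, Matrix.of_apply, Matrix.one_apply]
  rfl

theorem permOp_conjTranspose (σ : Equiv.Perm (Fin n)) :
    (permOp X σ)ᴴ = permOp X σ⁻¹ := by
  ext x y
  have h : (y = x ∘ σ.symm) ↔ (x = y ∘ (σ⁻¹).symm) := eq_comp_symm_iff σ y x
  simp only [Matrix.conjTranspose_apply, permOp, Matrix.of_apply, h]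
  split_ifs <;> simp

variable [Fintype X]

theorem permOp_mul_apply {Y : Type*} (σ : Equiv.Perm (Fin n)) (N : Matrix (Fin n → X) Y ℂ)
    (x : Fin n → X) (y : Y) : (permOp X σ * N) x y = N (x ∘ σ) y := by
  simp only [Matrix.mul_apply, permOp, Matrix.of_apply, eq_comp_symm_iff]
  simp

theorem mul_permOp_apply {Y : Type*} (σ : Equiv.Perm (Fin n)) (N : Matrix Y (Fin n → X) ℂ)
    (x : Fin n → X) (y : Y) : (N * permOp X σ) y x = N y (x ∘ σ.symm) := by
  simp [Matrix.mul_apply, permOp, Matrix.of_apply]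

theorem permOp_mul (σ τ : Equiv.Perm (Fin n)) :
    permOp X (σ * τ) = permOp X σ * permOp X τ := by
  ext x y
  rw [mul_permOp_apply]
  rfl

end PermOp

section Schur

variable {n r : ℕ} {μ ν : n.Partition} {b : SpechtBases n}

theorem mem_weyl_iff {φ : EuclideanSpace ℂ ((Fin n → Fin r) × Fin (dimS μ))} :
    φ ∈ weyl r b μ ↔ ∀ σ : Equiv.Perm (Fin n),
      permOp (Fin r) σ * toMap φ = toMap φ * R b μ σ := Iff.rfl

/-- The product of one intertwiner into the tensor power with the adjoint of another is a map
between Specht modules, to which Schur's lemma applies. -/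
theorem toMap_conjTranspose_mul_intertwines
    {φ : EuclideanSpace ℂ ((Fin n → Fin r) × Fin (dimS μ))} (hφ : φ ∈ weyl r b μ)
    {ψ : EuclideanSpace ℂ ((Fin n → Fin r) × Fin (dimS ν))} (hψ : ψ ∈ weyl r b ν)
    (σ : Equiv.Perm (Fin n)) :
    R b μ σ * ((toMap φ)ᴴ * toMap ψ) = ((toMap φ)ᴴ * toMap ψ) * R b ν σ := by
  have h := congrArg Matrix.conjTranspose (mem_weyl_iff.1 hφ σ⁻¹)
  rw [Matrix.conjTranspose_mul, Matrix.conjTranspose_mul, permOp_conjTranspose, R_conjTranspose,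
    inv_inv] at h
  rw [← Matrix.mul_assoc, ← h, Matrix.mul_assoc, mem_weyl_iff.1 hψ σ, Matrix.mul_assoc]

theorem trace_toMap_conjTranspose_mul
    (φ ψ : EuclideanSpace ℂ ((Fin n → Fin r) × Fin (dimS μ))) :
    ((toMap φ)ᴴ * toMap ψ).trace = inner ℂ φ ψ := by
  rw [PiLp.inner_apply, Fintype.sum_prod_type, Finset.sum_comm]
  simp [Matrix.trace, Matrix.mul_apply, toMap, mul_comm]

/-- The basis vectors of the multiplicity spaces, as intertwiners. -/
def weylMap (u : WeylBases r b) (μ : n.Partition) (α : Fin (dimU r b μ)) :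
    Matrix (Fin n → Fin r) (Fin (dimS μ)) ℂ :=
  toMap (u μ α : EuclideanSpace ℂ ((Fin n → Fin r) × Fin (dimS μ)))

theorem schur_apply (u : WeylBases r b) (x : Fin n → Fin r) (μ : n.Partition) (i : Fin (dimS μ))
    (α : Fin (dimU r b μ)) :
    schur b u x ⟨μ, i, α⟩ = ((Real.sqrt (dimS μ) : ℝ) : ℂ) * weylMap u μ α x i := rfl

theorem schur_conjTranspose_mul_apply (u : WeylBases r b) (μ ν : n.Partition)
    (i : Fin (dimS μ)) (α : Fin (dimU r b μ)) (j : Fin (dimS ν)) (β : Fin (dimU r b ν)) :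
    ((schur b u)ᴴ * schur b u) ⟨μ, i, α⟩ ⟨ν, j, β⟩
      = ((Real.sqrt (dimS μ) : ℝ) : ℂ) * ((Real.sqrt (dimS ν) : ℝ) : ℂ)
        * ((weylMap u μ α)ᴴ * weylMap u ν β) i j := by
  simp only [Matrix.mul_apply, Matrix.conjTranspose_apply, schur_apply, star_mul',
    Complex.star_def, Complex.conj_ofReal, Finset.mul_sum]
  exact Finset.sum_congr rfl fun x _ => by ring

/-- By Schur's lemma each product of basis intertwiners is zero or a scalar `c`, and `c * dim [μ]`
is their Hilbert–Schmidt inner product. The factors `√(dim [μ])` in `schur` compensate for this. -/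
theorem schur_conjTranspose_mul (u : WeylBases r b) : (schur b u)ᴴ * schur b u = 1 := by
  ext ⟨μ, i, α⟩ ⟨ν, j, β⟩
  rw [schur_conjTranspose_mul_apply]
  have hint : ∀ σ, R b μ σ * ((weylMap u μ α)ᴴ * weylMap u ν β)
      = ((weylMap u μ α)ᴴ * weylMap u ν β) * R b ν σ :=
    toMap_conjTranspose_mul_intertwines (u μ α).2 (u ν β).2
  by_cases h : μ = ν
  · subst h
    obtain ⟨c, hc⟩ := intertwiner_eq_scalar hint
    have htr : ((weylMap u μ α)ᴴ * weylMap u μ β).trace = _ := trace_toMap_conjTranspose_mul _ _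
    rw [hc, Matrix.trace_smul, Matrix.trace_one, Fintype.card_fin, smul_eq_mul,
      ← Submodule.coe_inner, orthonormal_iff_ite.1 (u μ).orthonormal α β] at htr
    have hs := sqrt_mul_sqrt_complex (x := (dimS μ : ℝ)) (by positivity)
    push_cast at hs
    rw [hc, hs, Matrix.smul_apply, smul_eq_mul, ← mul_assoc, mul_comm _ c, htr,
      Matrix.one_apply, Matrix.one_apply]
    by_cases h1 : α = β <;> by_cases h2 : i = j <;> simp [h1, h2]
  · rw [intertwiner_eq_zero hint h, Matrix.zero_apply, mul_zero, Matrix.one_apply_ne]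
    intro h2
    exact h (congrArg Sigma.fst h2)

/-- The group algebra element `∑ σ, R_μ(σ)_{ij} U_σ`. -/
def permOpSum (b : SpechtBases n) (r : ℕ) (μ : n.Partition) (i j : Fin (dimS μ)) :
    Matrix (Fin n → Fin r) (Fin n → Fin r) ℂ :=
  ∑ σ : Equiv.Perm (Fin n), R b μ σ i j • permOp (Fin r) σ

theorem permOp_mul_permOpSum (τ : Equiv.Perm (Fin n)) (i j : Fin (dimS μ)) :
    permOp (Fin r) τ * permOpSum b r μ i j = ∑ k, R b μ τ k i • permOpSum b r μ k j := by
  simp only [permOpSum, Finset.smul_sum, smul_smul]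
  rw [Finset.sum_comm, Matrix.mul_sum, ← Equiv.sum_comp (Equiv.mulLeft τ⁻¹)]
  refine Finset.sum_congr rfl fun σ _ => ?_
  rw [Equiv.coe_mulLeft, Matrix.mul_smul, ← permOp_mul, mul_inv_cancel_left, R_mul,
    Matrix.mul_apply, Finset.sum_smul]
  simp only [R_inv_apply]

/-- For fixed `j` and `y`, the columns `y` of `permOpSum b r μ i j` transform under permutations, as
`i` varies, like the basis of `[μ]`. They therefore form a vector of `weyl r b μ`, which expands in
`u`. -/
theorem exists_eq_schur_mul (u : WeylBases r b) (i j : Fin (dimS μ)) :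
    ∃ Z : Matrix (SchurLabel r b) (Fin n → Fin r) ℂ, permOpSum b r μ i j = schur b u * Z := by
  have key : ∀ y, ∃ c : Fin (dimU r b μ) → ℂ, ∀ x, permOpSum b r μ i j x y
      = ∑ α, c α * weylMap u μ α x i := by
    intro y
    let φ : EuclideanSpace ℂ ((Fin n → Fin r) × Fin (dimS μ)) :=
      WithLp.toLp 2 fun p => permOpSum b r μ p.2 j p.1 y
    have hφ : φ ∈ weyl r b μ := by
      intro τ
      ext x k
      have h := congrFun (congrFun (permOp_mul_permOpSum (b := b) (r := r) τ k j) x) y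
      rw [permOp_mul_apply] at h ⊢
      rw [Matrix.mul_apply]
      simp only [Matrix.sum_apply, Matrix.smul_apply, smul_eq_mul] at h
      change permOpSum b r μ k j (x ∘ τ) y = _
      rw [h]
      exact Finset.sum_congr rfl fun l _ => mul_comm _ _
    have h := congrArg Subtype.val ((u μ).sum_repr ⟨φ, hφ⟩)
    refine ⟨fun α => (u μ).repr ⟨φ, hφ⟩ α, fun x => ?_⟩
    have h1 := congrArg (fun v : EuclideanSpace ℂ ((Fin n → Fin r) × Fin (dimS μ)) => v (x, i)) h
    simp only [Submodule.coe_sum, Submodule.coe_smul, WithLp.ofLp_sum, Finset.sum_apply,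
      PiLp.smul_apply, smul_eq_mul] at h1
    exact h1.symm
  choose c hc using key
  have hd : ((Real.sqrt (dimS μ) : ℝ) : ℂ) ≠ 0 := by
    have := dimS_pos μ
    exact_mod_cast (Real.sqrt_pos.2 (by exact_mod_cast this)).ne'
  -- Only the rows labelled `(μ,i,α)` are nonzero; the division cancels the normalization of
  -- `schur`.
  let Z : Matrix (SchurLabel r b) (Fin n → Fin r) ℂ := Matrix.of fun a y => if h : a.1 = μ then
    if h ▸ a.2.1 = i then c y (h ▸ a.2.2) / ((Real.sqrt (dimS μ) : ℝ) : ℂ) else 0 else 0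
  refine ⟨Z, ?_⟩
  ext x y
  rw [hc, Matrix.mul_apply, Fintype.sum_sigma, Finset.sum_eq_single μ]
  · rw [Fintype.sum_prod_type, Finset.sum_eq_single i]
    · refine Finset.sum_congr rfl fun α _ => ?_
      simp only [schur_apply, Z, Matrix.of_apply, dite_true, if_true]
      field_simp
    · intro k _ hk
      simp [Z, hk]
    · simp
  · intro ν _ hν
    simp [Z, hν]
  · simp

theorem sum_dimS_smul_permOpSum :
    ∑ μ : n.Partition, (dimS μ : ℂ) • ∑ i, permOpSum b r μ i i
      = (n.factorial : ℂ) • (1 : Matrix (Fin n → Fin r) (Fin n → Fin r) ℂ) := by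
  have h : ∀ μ : n.Partition, (dimS μ : ℂ) • ∑ i, permOpSum b r μ i i
      = ∑ σ : Equiv.Perm (Fin n), ((dimS μ : ℂ) * character b μ σ) • permOp (Fin r) σ := by
    intro μ
    simp only [permOpSum]
    rw [Finset.sum_comm, Finset.smul_sum]
    refine Finset.sum_congr rfl fun σ _ => ?_
    rw [← Finset.sum_smul, smul_smul]
    rfl
  simp only [h]
  rw [Finset.sum_comm]
  simp only [← Finset.sum_smul, sum_dimS_mul_character, ite_smul, zero_smul]
  simp [permOp_one]

/-- `W W†` fixes the range of `W`, which contains the columns of every `permOpSum b r μ i i`; by the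
regular character these combine to `n!` times the identity. -/
theorem schur_mul_conjTranspose (u : WeylBases r b) : schur b u * (schur b u)ᴴ = 1 := by
  have h : ∀ (μ : n.Partition) (i : Fin (dimS μ)),
      schur b u * (schur b u)ᴴ * permOpSum b r μ i i = permOpSum b r μ i i := by
    intro μ i
    obtain ⟨Z, hZ⟩ := exists_eq_schur_mul u i i
    rw [hZ, Matrix.mul_assoc, ← Matrix.mul_assoc (schur b u)ᴴ, schur_conjTranspose_mul,
      Matrix.one_mul]
  have h1 := congrArg (fun X => schur b u * (schur b u)ᴴ * X)
    (sum_dimS_smul_permOpSum (b := b) (r := r))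
  simp only [Matrix.mul_sum, Matrix.mul_smul, h, Matrix.mul_one] at h1
  rw [sum_dimS_smul_permOpSum] at h1
  exact (smul_right_injective _ (Nat.cast_ne_zero.2 n.factorial_ne_zero) h1).symm

theorem card_schurLabel (u : WeylBases r b) : Fintype.card (SchurLabel r b) = r ^ n := by
  have h := congrArg Matrix.trace (schur_mul_conjTranspose u)
  rw [Matrix.trace_mul_comm, schur_conjTranspose_mul, Matrix.trace_one, Matrix.trace_one] at h
  have h2 := Nat.cast_injective h
  rw [h2, Fintype.card_fun, Fintype.card_fin, Fintype.card_fin]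

theorem permOp_mul_schur (u : WeylBases r b) (σ : Equiv.Perm (Fin n)) (x : Fin n → Fin r)
    (i : Fin (dimS μ)) (α : Fin (dimU r b μ)) :
    (permOp (Fin r) σ * schur b u) x ⟨μ, i, α⟩
      = ∑ k, R b μ σ k i * schur b u x ⟨μ, k, α⟩ := by
  have h1 : permOp (Fin r) σ * weylMap u μ α = weylMap u μ α * R b μ σ :=
    mem_weyl_iff.1 (u μ α).2 σ
  have h := congrFun (congrFun h1 x) i
  rw [permOp_mul_apply, Matrix.mul_apply] at h
  rw [permOp_mul_apply, schur_apply, h, Finset.mul_sum]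
  exact Finset.sum_congr rfl fun k _ => by rw [schur_apply]; ring

/-! ### Matrix units of the permutation algebra -/

/-- The matrix units `∑ α, |μ,k,α⟩⟨μ,i,α|` of the algebra generated by the permutations. -/
def isoUnit (u : WeylBases r b) (μ : n.Partition) (k i : Fin (dimS μ)) :
    Matrix (Fin n → Fin r) (Fin n → Fin r) ℂ :=
  Matrix.of fun x y => ∑ α, schur b u x ⟨μ, k, α⟩ * star (schur b u y ⟨μ, i, α⟩)

theorem permOp_eq_sum_isoUnit (u : WeylBases r b) (σ : Equiv.Perm (Fin n)) :
    permOp (Fin r) σ = ∑ μ, ∑ k, ∑ i, R b μ σ k i • isoUnit u μ k i := by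
  conv_lhs => rw [← Matrix.mul_one (permOp (Fin r) σ), ← schur_mul_conjTranspose u,
    ← Matrix.mul_assoc]
  ext x y
  rw [Matrix.mul_apply, Fintype.sum_sigma, Matrix.sum_apply]
  refine Finset.sum_congr rfl fun μ _ => ?_
  rw [Fintype.sum_prod_type]
  simp only [Matrix.sum_apply, Matrix.smul_apply, smul_eq_mul, isoUnit, Matrix.of_apply,
    permOp_mul_schur, Matrix.conjTranspose_apply, Finset.sum_mul, Finset.mul_sum]
  conv_rhs => rw [Finset.sum_comm]
  refine Finset.sum_congr rfl fun i _ => ?_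
  rw [Finset.sum_comm]
  simp only [mul_assoc]

/-- Fourier inversion by Schur orthogonality. It exhibits the matrix units as combinations of
permutations. -/
theorem isoUnit_eq (u : WeylBases r b) (l j : Fin (dimS μ)) :
    ((n.factorial : ℂ) / dimS μ) • isoUnit u μ l j = permOpSum b r μ l j := by
  simp only [permOpSum, permOp_eq_sum_isoUnit u, Finset.smul_sum, smul_smul]
  rw [Finset.sum_comm, Finset.sum_eq_single μ]
  · rw [Finset.sum_comm]
    have h : ∀ k, ∑ σ, ∑ i, (R b μ σ l j * R b μ σ k i) • isoUnit u μ k i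
        = ∑ i, (if l = k ∧ j = i then (n.factorial : ℂ) / dimS μ else 0) • isoUnit u μ k i := by
      intro k
      rw [Finset.sum_comm]
      simp only [← Finset.sum_smul, sum_R_mul_R]
    simp only [h]
    rw [Finset.sum_eq_single l, Finset.sum_eq_single j]
    · simp
    · intro i _ hi
      simp [Ne.symm hi]
    · simp
    · intro k _ hk
      simp [Ne.symm hk]
    · simp
  · intro ν _ hν
    rw [Finset.sum_comm]
    refine Finset.sum_eq_zero fun k _ => ?_
    rw [Finset.sum_comm]
    simp only [← Finset.sum_smul, sum_R_mul_R_of_ne hν.symm, zero_smul, Finset.sum_const_zero]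
  · simp

/-! ### Which Weyl modules vanish -/

/-- The first column has more than `r` entries, so a word in `r` letters repeats a letter there; the
transposition of these two places fixes the word. -/
theorem weyl_eq_zero (h : r < len μ) {φ : EuclideanSpace ℂ ((Fin n → Fin r) × Fin (dimS μ))}
    (hφ : φ ∈ weyl r b μ) : φ = 0 := by
  have hlike : IsPolytabloidLike (fun (σ : Equiv.Perm (Fin n)) (x : Fin n → Fin r) => x ∘ σ.symm)
      fun (t : Tableau μ) x => (toMap φ *ᵥ polyCoord b t) x := by
    refine isPolytabloidLike_mulVec fun σ x i => ?_
    rw [← mem_weyl_iff.1 hφ σ, permOp_mul_apply]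
    congr 1
    ext k
    simp
  have hX : toMap φ = 0 := by
    refine matrix_ext_polyCoord b fun t => ?_
    rw [Matrix.zero_mulVec]
    ext x
    have hcell : ∀ i : Fin (len μ), ((i : ℕ), 0) ∈ (diagram μ).cells := fun i => by
      rw [YoungDiagram.mem_cells, YoungDiagram.mem_iff_lt_colLen, colLen_zero_diagram]
      exact i.2
    obtain ⟨i, i', hne, heq⟩ := Fintype.exists_ne_map_eq_of_card_lt
      (fun i : Fin (len μ) => x (t.symm ⟨_, hcell i⟩)) (by simpa using h)
    refine hlike.eq_zero (a := t.symm ⟨_, hcell i⟩) (b := t.symm ⟨_, hcell i'⟩) ?_ (by simp) ?_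
    · intro h1
      have h2 := congrArg (fun c => c.1.1) (t.symm.injective h1)
      exact hne (Fin.ext h2)
    · ext1 k
      rw [Function.comp_apply, Equiv.symm_swap, Equiv.swap_apply_def]
      split_ifs with h1 h2
      · rw [h1]; exact heq.symm
      · rw [h2]; exact heq
      · rfl
  ext ⟨x, i⟩
  exact congrFun (congrFun hX x) i

theorem isoUnit_eq_zero (u : WeylBases r b) (h : r < len μ) (k i : Fin (dimS μ)) :
    isoUnit u μ k i = 0 := by
  have h1 : ∀ α x k, schur b u x ⟨μ, k, α⟩ = 0 := by
    intro α x k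
    rw [schur, Matrix.of_apply]
    simp only [weyl_eq_zero h (u μ α).2]
    exact mul_zero _
  ext x y
  simp [isoUnit, h1]

/-- The row of each entry of a tabloid. -/
def rowFun (h : len μ ≤ r) : Tabloid μ → Fin n → Fin r :=
  Quotient.lift (fun t k => ⟨(t k).1.1, by
    have h1 := (diagram μ).up_left_mem le_rfl (Nat.zero_le (t k).1.2)
      ((YoungDiagram.mem_cells _).1 (t k).2)
    rw [YoungDiagram.mem_iff_lt_colLen, colLen_zero_diagram] at h1
    exact h1.trans_le h⟩) fun t t' htt' => by
    ext k
    exact htt' k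

theorem rowFun_injective (h : len μ ≤ r) : Function.Injective (rowFun h) := by
  intro S T hST
  induction S using Quotient.inductionOn with | _ t => ?_
  induction T using Quotient.inductionOn with | _ t' => ?_
  exact Quotient.sound fun k => congrArg Fin.val (congrFun hST k)

theorem rowFun_permTabloid (h : len μ ≤ r) (σ : Equiv.Perm (Fin n)) (T : Tabloid μ) :
    rowFun h (permTabloid σ T) = rowFun h T ∘ σ.symm := by
  induction T using Quotient.inductionOn with | _ t => ?_
  rfl

theorem dimU_pos (h : len μ ≤ r) : 0 < dimU r b μ := by
  -- With at most `r` rows, a tabloid is a word recording the row of each entry. This embeds the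
  -- permutation module into the tensor power, and `φ` is the restriction to the Specht module.
  let φ : EuclideanSpace ℂ ((Fin n → Fin r) × Fin (dimS μ)) :=
    WithLp.toLp 2 fun p => ∑ T, if p.1 = rowFun h T then basisMatrix b μ T p.2 else 0
  have hφ : φ ∈ weyl r b μ := by
    intro σ
    ext x i
    rw [permOp_mul_apply, Matrix.mul_apply]
    change (∑ T, if x ∘ σ = rowFun h T then basisMatrix b μ T i else 0)
      = ∑ j, (∑ T, if x = rowFun h T then basisMatrix b μ T j else 0) * R b μ σ j i
    simp only [Finset.sum_mul]
    rw [Finset.sum_comm]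
    have h0 : ∀ T, (∑ j, (if x = rowFun h T then basisMatrix b μ T j else 0) * R b μ σ j i)
        = if x = rowFun h T then (basisMatrix b μ * R b μ σ) T i else 0 := by
      intro T
      rw [Matrix.mul_apply]
      split_ifs <;> simp
    simp only [h0]
    rw [← Equiv.sum_comp (permTabloidEquiv σ) fun T =>
      if x = rowFun h T then (basisMatrix b μ * R b μ σ) T i else 0]
    refine Finset.sum_congr rfl fun T _ => ?_
    have h1 : x = rowFun h (permTabloidEquiv σ T) ↔ x ∘ σ = rowFun h T := by
      have h2 := rowFun_permTabloid h σ T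
      rw [show permTabloidEquiv σ T = permTabloid σ T from rfl, h2, eq_comp_symm_iff, eq_comm]
    exact if_congr h1.symm (basisMatrix_mul_R σ T i).symm rfl
  have hφ0 : φ ≠ 0 := by
    intro h0
    have h1 : basisMatrix b μ = 0 := by
      ext T i
      have h2 := congrArg (fun v : EuclideanSpace ℂ ((Fin n → Fin r) × Fin (dimS μ)) =>
        v (rowFun h T, i)) h0
      change (∑ S, if rowFun h T = rowFun h S then basisMatrix b μ S i else 0) = 0 at h2
      rw [Finset.sum_eq_single T (fun S _ hS =>
        if_neg fun h3 => hS (rowFun_injective h h3).symm) (by simp), if_pos rfl] at h2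
      exact h2
    have h3 := basisMatrix_transpose_mul_self (b := b) (μ := μ)
    rw [h1, Matrix.mul_zero] at h3
    have h4 := congrFun (congrFun h3 ⟨0, dimS_pos μ⟩) ⟨0, dimS_pos μ⟩
    simp at h4
  have : Nontrivial (weyl r b μ) :=
    ⟨⟨φ, hφ⟩, 0, fun h0 => hφ0 (congrArg Subtype.val h0)⟩
  exact Module.finrank_pos

end Schur

/-! ## Schur–Weyl duality -/

section SchurWeyl

/-- The tensor power of a matrix. -/
def tensorPow (n : ℕ) {X Y : Type*} (A : Matrix X Y ℂ) : Matrix (Fin n → X) (Fin n → Y) ℂ :=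
  Matrix.of fun x y => ∏ k, A (x k) (y k)

variable {n r : ℕ}

theorem tensorPow_apply {X Y : Type*} (A : Matrix X Y ℂ) (x : Fin n → X) (y : Fin n → Y) :
    tensorPow n A x y = ∏ k, A (x k) (y k) := rfl

theorem tensorPow_mul {X Y Z : Type*} [Fintype Y] (A : Matrix X Y ℂ) (B : Matrix Y Z ℂ) :
    tensorPow n (A * B) = tensorPow n A * tensorPow n B := by
  classical
  ext x z
  simp only [tensorPow_apply, Matrix.mul_apply, Finset.prod_univ_sum, Fintype.piFinset_univ,
    Finset.prod_mul_distrib]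

theorem tensorPow_conjTranspose {X Y : Type*} (A : Matrix X Y ℂ) :
    (tensorPow n A)ᴴ = tensorPow n Aᴴ := by
  ext x y
  simp only [Matrix.conjTranspose_apply, tensorPow_apply, star_prod]

theorem tensorPow_one {X : Type*} [DecidableEq X] :
    tensorPow n (1 : Matrix X X ℂ) = 1 := by
  ext x y
  rw [tensorPow_apply, Matrix.one_apply]
  split_ifs with h
  · subst h
    exact Finset.prod_eq_one fun k _ => Matrix.one_apply_eq _
  · obtain ⟨k, hk⟩ := Function.ne_iff.1 h
    exact Finset.prod_eq_zero (Finset.mem_univ k) (Matrix.one_apply_ne hk)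

theorem permOp_mul_tensorPow {X : Type*} [Fintype X] [DecidableEq X] (σ : Equiv.Perm (Fin n))
    (A : Matrix X X ℂ) : permOp X σ * tensorPow n A = tensorPow n A * permOp X σ := by
  ext x y
  rw [permOp_mul_apply, mul_permOp_apply, tensorPow_apply, tensorPow_apply,
    ← Equiv.prod_comp σ fun k => A (x k) ((y ∘ σ.symm) k)]
  simp

theorem prod_eq_prod_pow_card {X : Type*} [Fintype X] [DecidableEq X] (d : X → ℂ)
    (x : Fin n → X) :
    ∏ k, d (x k) = ∏ i, d i ^ (Finset.univ.filter fun k => x k = i).card := by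
  rw [← Finset.prod_fiberwise (s := Finset.univ) (g := x)]
  refine Finset.prod_congr rfl fun i _ => ?_
  rw [← Finset.prod_const]
  refine Finset.prod_congr rfl fun k hk => ?_
  rw [(Finset.mem_filter.1 hk).2]

theorem tensorPow_diagonal {X : Type*} [DecidableEq X] (d : X → ℂ) :
    tensorPow n (Matrix.diagonal d) = Matrix.diagonal fun x => ∏ k, d (x k) := by
  ext x y
  rw [tensorPow_apply]
  by_cases h : x = y
  · subst h
    simp
  · rw [Matrix.diagonal_apply_ne _ h]
    obtain ⟨k, hk⟩ := Function.ne_iff.1 h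
    exact Finset.prod_eq_zero (Finset.mem_univ k) (Matrix.diagonal_apply_ne _ hk)

/-- The commutant of the tensor powers of the unitaries. -/
def CommutesWithUnitaries (X : Matrix (Fin n → Fin r) (Fin n → Fin r) ℂ) : Prop :=
  ∀ U ∈ Matrix.unitaryGroup (Fin r) ℂ, X * tensorPow n U = tensorPow n U * X

variable {X : Matrix (Fin n → Fin r) (Fin n → Fin r) ℂ}

/-- A nonzero entry of `X` joins only words in which every letter occurs equally often, and on such
words the diagonal products agree. -/
theorem CommutesWithUnitaries.diagonal (hX : CommutesWithUnitaries X) (d : Fin r → ℂ) :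
    X * tensorPow n (Matrix.diagonal d) = tensorPow n (Matrix.diagonal d) * X := by
  ext x y
  rw [tensorPow_diagonal, Matrix.mul_diagonal, Matrix.diagonal_mul, mul_comm]
  by_cases h0 : X x y = 0
  · simp [h0]
  congr 1
  rw [prod_eq_prod_pow_card, prod_eq_prod_pow_card]
  refine Finset.prod_congr rfl fun i _ => ?_
  congr 1
  -- Letter counts lie between `0` and `n`, so a primitive root of order `n + 1` separates them.
  set ω := Complex.exp (2 * Real.pi * Complex.I / ((n + 1 : ℕ) : ℂ)) with hω_def
  have hω : IsPrimitiveRoot ω (n + 1) := Complex.isPrimitiveRoot_exp (n + 1) n.succ_ne_zero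
  have hnorm : ‖ω‖ = 1 := hω.norm'_eq_one n.succ_ne_zero
  let e : Fin r → ℂ := Pi.mulSingle i ω
  have he : Matrix.diagonal e ∈ Matrix.unitaryGroup (Fin r) ℂ := by
    rw [Matrix.mem_unitaryGroup_iff, Matrix.star_eq_conjTranspose, Matrix.diagonal_conjTranspose,
      Matrix.diagonal_mul_diagonal, ← Matrix.diagonal_one]
    congr 1
    ext j
    by_cases hj : j = i
    · subst hj
      simp only [e, Pi.mulSingle_eq_same, Pi.star_apply]
      rw [Complex.star_def, Complex.mul_conj, Complex.normSq_eq_norm_sq, hnorm]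
      simp
    · simp [e, Pi.mulSingle_eq_of_ne hj]
  have h1 := congrFun (congrFun (hX _ he) x) y
  rw [tensorPow_diagonal, Matrix.mul_diagonal, Matrix.diagonal_mul, mul_comm] at h1
  have h2 := mul_right_cancel₀ h0 h1
  have h3 : ∀ x : Fin n → Fin r,
      ∏ k, e (x k) = ω ^ (Finset.univ.filter fun k => x k = i).card := by
    intro x
    rw [prod_eq_prod_pow_card, Finset.prod_eq_single i]
    · simp [e]
    · intro j _ hj
      simp [e, Pi.mulSingle_eq_of_ne hj]
    · simp
  rw [h3, h3] at h2
  refine hω.pow_inj ?_ ?_ h2 <;>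
  · refine Nat.lt_succ_of_le ((Finset.card_le_univ _).trans ?_)
    simp

theorem CommutesWithUnitaries.isHermitian (hX : CommutesWithUnitaries X)
    {H : Matrix (Fin r) (Fin r) ℂ} (hH : H.IsHermitian) :
    X * tensorPow n H = tensorPow n H * X := by
  have h := hH.spectral_theorem
  rw [Unitary.conjStarAlgAut_apply] at h
  have h1 := hX _ hH.eigenvectorUnitary.2
  have h2 := hX _ (star hH.eigenvectorUnitary).2
  have h3 := hX.diagonal (RCLike.ofReal ∘ hH.eigenvalues)
  rw [h, tensorPow_mul, tensorPow_mul]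
  calc _ = X * tensorPow n hH.eigenvectorUnitary.1
        * tensorPow n (Matrix.diagonal (RCLike.ofReal ∘ hH.eigenvalues))
        * tensorPow n (star hH.eigenvectorUnitary).1 := by
        simp only [Matrix.mul_assoc]
        rfl
    _ = tensorPow n hH.eigenvectorUnitary.1 *
        (X * tensorPow n (Matrix.diagonal (RCLike.ofReal ∘ hH.eigenvalues)))
        * tensorPow n (star hH.eigenvectorUnitary).1 := by
        rw [h1]
        simp only [Matrix.mul_assoc]
    _ = tensorPow n hH.eigenvectorUnitary.1 *
        tensorPow n (Matrix.diagonal (RCLike.ofReal ∘ hH.eigenvalues))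
        * (X * tensorPow n (star hH.eigenvectorUnitary).1) := by
        rw [h3]
        simp only [Matrix.mul_assoc]
    _ = _ := by
        rw [h2]
        simp only [Matrix.mul_assoc]
        rfl

/-- For real `t` the matrix `H + t K` is Hermitian, so each entry of the commutator is a polynomial
in `t` vanishing on the reals. It then vanishes at `t = I`, where `H + I K = 2 A`. -/
theorem CommutesWithUnitaries.tensorPow (hX : CommutesWithUnitaries X)
    (A : Matrix (Fin r) (Fin r) ℂ) :
    X * tensorPow n A = RandomStinespring.tensorPow n A * X := by
  set H : Matrix (Fin r) (Fin r) ℂ := A + Aᴴ with hH_def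
  set K : Matrix (Fin r) (Fin r) ℂ := Complex.I • (Aᴴ - A) with hK_def
  have hH : H.IsHermitian := by
    rw [Matrix.IsHermitian, hH_def, Matrix.conjTranspose_add, Matrix.conjTranspose_conjTranspose,
      add_comm]
  have hK : K.IsHermitian := by
    rw [Matrix.IsHermitian, hK_def, Matrix.conjTranspose_smul, Matrix.conjTranspose_sub,
      Matrix.conjTranspose_conjTranspose, Complex.star_def, Complex.conj_I, neg_smul, ← smul_neg,
      neg_sub]
  have key : ∀ z : ℂ, X * RandomStinespring.tensorPow n (H + z • K)
      = RandomStinespring.tensorPow n (H + z • K) * X := by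
    intro z
    ext x y
    let p : Polynomial ℂ :=
      ∑ w, Polynomial.C (X x w) * ∏ k, (Polynomial.C (H (w k) (y k))
        + Polynomial.X * Polynomial.C (K (w k) (y k)))
      - ∑ w, (∏ k, (Polynomial.C (H (x k) (w k))
        + Polynomial.X * Polynomial.C (K (x k) (w k)))) * Polynomial.C (X w y)
    have hp : ∀ z : ℂ, p.eval z = (X * RandomStinespring.tensorPow n (H + z • K)) x y
        - (RandomStinespring.tensorPow n (H + z • K) * X) x y := by
      intro z
      simp [p, Matrix.mul_apply, tensorPow_apply, Polynomial.eval_finsetSum,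
        Polynomial.eval_prod, mul_comm z]
    have hp0 : p = 0 := by
      refine Polynomial.eq_zero_of_infinite_isRoot p
        ((Set.infinite_range_of_injective Complex.ofReal_injective).mono ?_)
      rintro _ ⟨t, rfl⟩
      have hHt : (H + (t : ℂ) • K).IsHermitian := by
        refine hH.add ?_
        rw [Matrix.IsHermitian, Matrix.conjTranspose_smul, hK.eq, Complex.star_def,
          Complex.conj_ofReal]
      change p.eval (t : ℂ) = 0
      rw [hp, hX.isHermitian hHt, sub_self]
    have h := hp z
    rw [hp0, Polynomial.eval_zero] at h
    exact (sub_eq_zero.1 h.symm)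
  have hA : H + Complex.I • K = (2 : ℂ) • A := by
    rw [hK_def, smul_smul, Complex.I_mul_I, hH_def]
    module
  have hpow : RandomStinespring.tensorPow n ((2 : ℂ) • A)
      = (2 : ℂ) ^ n • RandomStinespring.tensorPow n A := by
    ext x y
    simp [tensorPow_apply, Finset.prod_mul_distrib]
  have h := key Complex.I
  rw [hA, hpow, Matrix.mul_smul, Matrix.smul_mul] at h
  exact smul_right_injective _ (pow_ne_zero n two_ne_zero) h

/-- If `f` misses `i`, flipping the sign `ε i` negates every summand. -/
theorem sum_prod_units_eq_zero {f : Fin n → Fin n} (hf : ¬ Function.Bijective f) :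
    ∑ ε : Fin n → ℤˣ, (((∏ i, ε i) * ∏ k, ε (f k) : ℤˣ) : ℤ) = 0 := by
  have hs : ¬ Function.Surjective f := fun h => hf ⟨Finite.injective_iff_surjective.2 h, h⟩
  rw [Function.Surjective] at hs
  push Not at hs
  obtain ⟨i, hi⟩ := hs
  have h : ∑ ε : Fin n → ℤˣ, (((∏ i, ε i) * ∏ k, ε (f k) : ℤˣ) : ℤ)
      = -∑ ε : Fin n → ℤˣ, (((∏ i, ε i) * ∏ k, ε (f k) : ℤˣ) : ℤ) := by
    conv_lhs => rw [← Equiv.sum_comp (Equiv.mulRight (Pi.mulSingle i (-1 : ℤˣ)))]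
    rw [← Finset.sum_neg_distrib]
    refine Finset.sum_congr rfl fun ε _ => ?_
    have h1 : ∀ k, (Pi.mulSingle i (-1 : ℤˣ) : Fin n → ℤˣ) (f k) = 1 := fun k =>
      Pi.mulSingle_eq_of_ne (hi k) _
    simp [Finset.prod_mul_distrib, h1]
  linarith

/-- The polarization identity. -/
theorem sum_units_mul_prod (a : Fin n → Fin n → ℂ) :
    ∑ ε : Fin n → ℤˣ, (((∏ i, ε i : ℤˣ) : ℤ) : ℂ) * ∏ k, ∑ i, ((ε i : ℤ) : ℂ) * a i k
      = (2 : ℂ) ^ n * ∑ σ : Equiv.Perm (Fin n), ∏ k, a (σ k) k := by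
  have h1 : ∀ ε : Fin n → ℤˣ,
      (((∏ i, ε i : ℤˣ) : ℤ) : ℂ) * ∏ k, ∑ i, ((ε i : ℤ) : ℂ) * a i k
      = ∑ f : Fin n → Fin n, ((((∏ i, ε i) * ∏ k, ε (f k) : ℤˣ) : ℤ) : ℂ) * ∏ k, a (f k) k := by
    intro ε
    rw [Finset.prod_univ_sum, Fintype.piFinset_univ, Finset.mul_sum]
    refine Finset.sum_congr rfl fun f _ => ?_
    rw [Finset.prod_mul_distrib]
    push_cast
    ring
  simp only [h1]
  rw [Finset.sum_comm, Finset.mul_sum]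
  symm
  refine Finset.sum_of_injOn (fun σ : Equiv.Perm (Fin n) => (σ : Fin n → Fin n))
    (fun σ _ τ _ h => DFunLike.coe_injective h) (fun _ _ => Finset.mem_coe.2 (Finset.mem_univ _))
    ?_ ?_
  · intro f _ hf
    rw [← Finset.sum_mul, ← Int.cast_sum, sum_prod_units_eq_zero, Int.cast_zero, zero_mul]
    intro hb
    exact hf ⟨Equiv.ofBijective f hb, by simp, rfl⟩
  · intro σ _
    have h2 : ∀ ε : Fin n → ℤˣ, (∏ i, ε i) * ∏ k, ε (σ k) = 1 := by
      intro ε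
      rw [Equiv.prod_comp σ ε, Int.units_mul_self]
    simp [h2]

theorem CommutesWithUnitaries.sum_perm (hX : CommutesWithUnitaries X)
    (A : Fin n → Matrix (Fin r) (Fin r) ℂ) :
    X * (Matrix.of fun x y => ∑ σ : Equiv.Perm (Fin n), ∏ k, A (σ k) (x k) (y k))
      = (Matrix.of fun x y => ∑ σ : Equiv.Perm (Fin n), ∏ k, A (σ k) (x k) (y k)) * X := by
  have h : (2 : ℂ) ^ n •
      (Matrix.of fun x y => ∑ σ : Equiv.Perm (Fin n), ∏ k, A (σ k) (x k) (y k))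
      = ∑ ε : Fin n → ℤˣ, (((∏ i, ε i : ℤˣ) : ℤ) : ℂ) •
        RandomStinespring.tensorPow n (∑ i, ((ε i : ℤ) : ℂ) • A i) := by
    ext x y
    rw [Matrix.smul_apply, Matrix.of_apply, smul_eq_mul,
      ← sum_units_mul_prod fun i k => A i (x k) (y k)]
    simp [Matrix.sum_apply, tensorPow_apply]
  refine smul_right_injective (Matrix (Fin n → Fin r) (Fin n → Fin r) ℂ)
    (pow_ne_zero n (two_ne_zero (α := ℂ))) ?_
  simp only
  rw [← Matrix.mul_smul, ← Matrix.smul_mul, h, Matrix.mul_sum, Matrix.sum_mul]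
  refine Finset.sum_congr rfl fun ε _ => ?_
  rw [Matrix.mul_smul, Matrix.smul_mul, hX.tensorPow]

/-- The commutants of the unitaries and of the permutations commute. -/
theorem CommutesWithUnitaries.commute (hX : CommutesWithUnitaries X)
    {F : Matrix (Fin n → Fin r) (Fin n → Fin r) ℂ}
    (hF : ∀ σ : Equiv.Perm (Fin n), permOp (Fin r) σ * F = F * permOp (Fin r) σ) :
    X * F = F * X := by
  have hF' : ∀ (σ : Equiv.Perm (Fin n)) x y, F (x ∘ σ) (y ∘ σ) = F x y := by
    intro σ x y
    have h := congrFun (congrFun (hF σ) x) (y ∘ σ)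
    rw [permOp_mul_apply, mul_permOp_apply] at h
    rw [h]
    congr 1
    ext k
    simp
  -- Expand `F` in matrix units and average over permutations: the symmetrized matrix units are
  -- covered by `sum_perm`.
  have h : (n.factorial : ℂ) • F = ∑ p, ∑ q, F p q • (Matrix.of fun x y =>
      ∑ σ : Equiv.Perm (Fin n), ∏ k, (Matrix.single (p (σ k)) (q (σ k)) (1 : ℂ)) (x k) (y k)) := by
    ext x y
    have h1 : ∀ (p q : Fin n → Fin r) (σ : Equiv.Perm (Fin n)),
        ∏ k, (Matrix.single (p (σ k)) (q (σ k)) (1 : ℂ)) (x k) (y k)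
          = if q = y ∘ σ.symm then if p = x ∘ σ.symm then 1 else 0 else 0 := by
      intro p q σ
      simp only [Matrix.single_apply, Equiv.eq_comp_symm]
      split_ifs with h2 h3
      · exact Finset.prod_eq_one fun k _ =>
          if_pos ⟨congrFun h3 k, congrFun h2 k⟩
      · obtain ⟨k, hk⟩ := Function.ne_iff.1 h3
        exact Finset.prod_eq_zero (Finset.mem_univ k) (if_neg fun h => hk h.1)
      · obtain ⟨k, hk⟩ := Function.ne_iff.1 h2
        exact Finset.prod_eq_zero (Finset.mem_univ k) (if_neg fun h => hk h.2)
    simp only [Matrix.smul_apply, Matrix.sum_apply, Matrix.of_apply, h1, smul_eq_mul,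
      Finset.mul_sum]
    have h2 : ∀ p, ∑ q, ∑ σ : Equiv.Perm (Fin n),
        F p q * (if q = y ∘ σ.symm then if p = x ∘ σ.symm then 1 else 0 else 0)
        = ∑ σ : Equiv.Perm (Fin n), F p (y ∘ σ.symm) * if p = x ∘ σ.symm then 1 else 0 := by
      intro p
      rw [Finset.sum_comm]
      refine Finset.sum_congr rfl fun σ _ => ?_
      simp
    simp only [h2]
    rw [Finset.sum_comm]
    simp only [mul_ite, mul_one, mul_zero, Finset.sum_ite_eq', Finset.mem_univ, if_true, hF']
    rw [Finset.sum_const, Finset.card_univ, Fintype.card_perm, Fintype.card_fin, nsmul_eq_mul]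
  refine smul_right_injective (Matrix (Fin n → Fin r) (Fin n → Fin r) ℂ)
    (Nat.cast_ne_zero.2 n.factorial_ne_zero : (n.factorial : ℂ) ≠ 0) ?_
  simp only
  rw [← Matrix.mul_smul, ← Matrix.smul_mul, h]
  simp only [Matrix.mul_sum, Matrix.sum_mul, Matrix.mul_smul, Matrix.smul_mul]
  refine Finset.sum_congr rfl fun p _ => Finset.sum_congr rfl fun q _ => ?_
  rw [hX.sum_perm fun i => Matrix.single (p i) (q i) 1]

end SchurWeyl

/-! ## The twirl over the unitary group -/

section Twirl

variable {n r : ℕ} {b : SpechtBases n}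

theorem permOp_mul_weylUnit (u : WeylBases r b) (μ : n.Partition) (α β : Fin (dimU r b μ))
    (σ : Equiv.Perm (Fin n)) :
    permOp (Fin r) σ * (weylMap u μ α * (weylMap u μ β)ᴴ)
      = (weylMap u μ α * (weylMap u μ β)ᴴ) * permOp (Fin r) σ := by
  have h1 : permOp (Fin r) σ * weylMap u μ α = weylMap u μ α * R b μ σ :=
    mem_weyl_iff.1 (u μ α).2 σ
  have h2 : permOp (Fin r) σ⁻¹ * weylMap u μ β = weylMap u μ β * R b μ σ⁻¹ :=
    mem_weyl_iff.1 (u μ β).2 σ⁻¹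
  have h3 := congrArg Matrix.conjTranspose h2
  rw [Matrix.conjTranspose_mul, Matrix.conjTranspose_mul, permOp_conjTranspose, R_conjTranspose,
    inv_inv] at h3
  rw [← Matrix.mul_assoc, h1, Matrix.mul_assoc, Matrix.mul_assoc, h3]

/-- The operator that changes `|μ,i,β⟩` to `|μ,i,α⟩` commutes with the commutant. -/
theorem CommutesWithUnitaries.mul_weylUnit {X : Matrix (Fin n → Fin r) (Fin n → Fin r) ℂ}
    (hX : CommutesWithUnitaries X) (u : WeylBases r b) (μ : n.Partition)
    (α β : Fin (dimU r b μ)) :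
    ((schur b u)ᴴ * X * schur b u) *
      (∑ i, Matrix.single (⟨μ, i, α⟩ : SchurLabel r b) ⟨μ, i, β⟩ (1 : ℂ))
      = (∑ i, Matrix.single (⟨μ, i, α⟩ : SchurLabel r b) ⟨μ, i, β⟩ (1 : ℂ))
        * ((schur b u)ᴴ * X * schur b u) := by
  set G : Matrix (SchurLabel r b) (SchurLabel r b) ℂ :=
    ∑ i, Matrix.single (⟨μ, i, α⟩ : SchurLabel r b) ⟨μ, i, β⟩ (1 : ℂ) with hG
  have h1 : schur b u * G * (schur b u)ᴴ
      = (dimS μ : ℂ) • (weylMap u μ α * (weylMap u μ β)ᴴ) := by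
    ext x y
    rw [hG, Matrix.mul_sum, Matrix.sum_mul, Matrix.sum_apply, Matrix.smul_apply, Matrix.mul_apply,
      smul_eq_mul, Finset.mul_sum]
    refine Finset.sum_congr rfl fun i _ => ?_
    rw [Matrix.mul_apply, Finset.sum_eq_single (⟨μ, i, β⟩ : SchurLabel r b)]
    · have hs := sqrt_mul_sqrt_complex (x := (dimS μ : ℝ)) (by positivity)
      push_cast at hs
      rw [Matrix.mul_single_apply_same, mul_one, Matrix.conjTranspose_apply,
        Matrix.conjTranspose_apply, schur_apply, schur_apply, star_mul', Complex.star_def,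
        Complex.conj_ofReal]
      linear_combination (weylMap u μ α x i * starRingEnd ℂ (weylMap u μ β y i)) * hs
    · intro a _ ha
      rw [Matrix.mul_single_apply_of_ne _ _ _ _ _ ha, zero_mul]
    · simp
  have h2 : X * (schur b u * G * (schur b u)ᴴ) = (schur b u * G * (schur b u)ᴴ) * X := by
    rw [h1, Matrix.mul_smul, Matrix.smul_mul, hX.commute (permOp_mul_weylUnit u μ α β)]
  calc _ = (schur b u)ᴴ * (X * (schur b u * G * (schur b u)ᴴ)) * schur b u := by
        simp only [Matrix.mul_assoc, schur_conjTranspose_mul, Matrix.mul_one]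
    _ = (schur b u)ᴴ * schur b u * G * ((schur b u)ᴴ * X * schur b u) := by
        rw [h2]
        simp only [Matrix.mul_assoc]
    _ = _ := by rw [schur_conjTranspose_mul, Matrix.one_mul]

/-- Commuting with all changes of multiplicity label makes `X` diagonal in `μ` and `α`, with the
same block for every `α`; hence `β` is arbitrary. -/
theorem CommutesWithUnitaries.schur_apply {X : Matrix (Fin n → Fin r) (Fin n → Fin r) ℂ}
    (hX : CommutesWithUnitaries X) (u : WeylBases r b) (a : SchurLabel r b) (μ : n.Partition)
    (α β : Fin (dimU r b μ)) (k : Fin (dimS μ)) :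
    ((schur b u)ᴴ * X * schur b u) a ⟨μ, k, α⟩
      = ∑ j, if a = ⟨μ, j, α⟩ then
          ((schur b u)ᴴ * X * schur b u) ⟨μ, j, β⟩ ⟨μ, k, β⟩ else 0 := by
  have h := congrFun (congrFun (hX.mul_weylUnit u μ α β) a) ⟨μ, k, β⟩
  rw [Matrix.mul_sum, Matrix.sum_mul, Matrix.sum_apply, Matrix.sum_apply,
    Finset.sum_eq_single k] at h
  · rw [Matrix.mul_single_apply_same, mul_one] at h
    rw [h]
    refine Finset.sum_congr rfl fun j _ => ?_
    split_ifs with h1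
    · rw [h1, Matrix.single_mul_apply_same, one_mul]
    · rw [Matrix.single_mul_apply_of_ne _ _ _ _ _ h1]
  · intro j _ hj
    refine Matrix.mul_single_apply_of_ne _ _ _ _ _ ?_ _
    intro h1
    simp only [Sigma.mk.injEq, heq_eq_eq, true_and, Prod.mk.injEq] at h1
    exact hj h1.1.symm
  · simp

theorem trace_isoUnit_mul (u : WeylBases r b) (X : Matrix (Fin n → Fin r) (Fin n → Fin r) ℂ)
    (μ : n.Partition) (k j : Fin (dimS μ)) :
    (isoUnit u μ k j * X).trace
      = ∑ β, ((schur b u)ᴴ * X * schur b u) ⟨μ, j, β⟩ ⟨μ, k, β⟩ := by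
  simp only [Matrix.trace, Matrix.diag, Matrix.mul_apply, isoUnit, Matrix.of_apply,
    Matrix.conjTranspose_apply, Finset.sum_mul]
  conv_rhs => rw [Finset.sum_comm]
  refine Finset.sum_congr rfl fun x _ => ?_
  rw [Finset.sum_comm]
  refine Finset.sum_congr rfl fun β _ => Finset.sum_congr rfl fun y _ => ?_
  ring

/-- The commutant of the unitaries is spanned by the matrix units `isoUnit`. -/
theorem CommutesWithUnitaries.eq_sum {X : Matrix (Fin n → Fin r) (Fin n → Fin r) ℂ}
    (hX : CommutesWithUnitaries X) (u : WeylBases r b) :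
    X = ∑ μ, ∑ j, ∑ k,
      ((isoUnit u μ k j * X).trace / (dimU r b μ : ℂ)) • isoUnit u μ j k := by
  have h1 : X = schur b u * ((schur b u)ᴴ * X * schur b u) * (schur b u)ᴴ := by
    rw [Matrix.mul_assoc, Matrix.mul_assoc, Matrix.mul_assoc, ← Matrix.mul_assoc (schur b u),
      schur_mul_conjTranspose, Matrix.mul_one, Matrix.one_mul]
  have h2 : ∀ (a : SchurLabel r b) (μ : n.Partition) (k : Fin (dimS μ)) (α : Fin (dimU r b μ)),
      ((schur b u)ᴴ * X * schur b u) a ⟨μ, k, α⟩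
        = ∑ j, if a = ⟨μ, j, α⟩ then (isoUnit u μ k j * X).trace / (dimU r b μ : ℂ) else 0 := by
    intro a μ k α
    have hd : (dimU r b μ : ℂ) ≠ 0 := Nat.cast_ne_zero.2 (Fin.pos α).ne'
    -- Summing over the free label `β` turns the block entry into a trace against a matrix unit.
    have h3 : (dimU r b μ : ℂ) * ((schur b u)ᴴ * X * schur b u) a ⟨μ, k, α⟩
        = ∑ β : Fin (dimU r b μ), ∑ j, if a = ⟨μ, j, α⟩ then
          ((schur b u)ᴴ * X * schur b u) ⟨μ, j, β⟩ ⟨μ, k, β⟩ else 0 := by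
      rw [Finset.sum_congr rfl fun β _ => (hX.schur_apply u a μ α β k).symm]
      simp
    rw [Finset.sum_comm] at h3
    rw [eq_div_of_mul_eq hd ((mul_comm _ _).trans h3), Finset.sum_div]
    refine Finset.sum_congr rfl fun j _ => ?_
    rw [trace_isoUnit_mul]
    split_ifs
    · rfl
    · simp
  conv_lhs => rw [h1]
  ext x y
  rw [Matrix.mul_apply, Fintype.sum_sigma, Matrix.sum_apply]
  refine Finset.sum_congr rfl fun μ _ => ?_
  rw [Fintype.sum_prod_type, Matrix.sum_apply]
  simp only [Matrix.sum_apply, Matrix.smul_apply, smul_eq_mul]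
  rw [Finset.sum_comm]
  conv_rhs => rw [Finset.sum_comm]
  rw [Finset.sum_comm]
  refine Finset.sum_congr rfl fun k _ => ?_
  have h4 : ∀ α, (schur b u * ((schur b u)ᴴ * X * schur b u)) x ⟨μ, k, α⟩
      = ∑ j, (isoUnit u μ k j * X).trace / (dimU r b μ : ℂ) * schur b u x ⟨μ, j, α⟩ := by
    intro α
    rw [Matrix.mul_apply]
    simp only [h2, Finset.mul_sum]
    rw [Finset.sum_comm]
    refine Finset.sum_congr rfl fun j _ => ?_
    simp only [mul_ite, mul_zero, Finset.sum_ite_eq', Finset.mem_univ, if_true]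
    ring
  simp only [h4, isoUnit, Matrix.of_apply, Finset.mul_sum, Finset.sum_mul,
    Matrix.conjTranspose_apply]
  rw [Finset.sum_comm]
  simp only [mul_assoc]

/-- The matrix unit is a combination of permutations, which commute with tensor powers. -/
theorem isoUnit_mul_tensorPow (u : WeylBases r b) (μ : n.Partition) (k j : Fin (dimS μ))
    (A : Matrix (Fin r) (Fin r) ℂ) :
    isoUnit u μ k j * tensorPow n A = tensorPow n A * isoUnit u μ k j := by
  have hd : (n.factorial : ℂ) / dimS μ ≠ 0 :=
    div_ne_zero (Nat.cast_ne_zero.2 n.factorial_ne_zero) (dimS_ne_zero μ)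
  refine smul_right_injective (Matrix (Fin n → Fin r) (Fin n → Fin r) ℂ) hd ?_
  change _ • (isoUnit u μ k j * tensorPow n A) = _ • (tensorPow n A * isoUnit u μ k j)
  rw [← Matrix.smul_mul _ (isoUnit u μ k j), ← Matrix.mul_smul (tensorPow n A), isoUnit_eq,
    permOpSum, Matrix.mul_sum, Matrix.sum_mul]
  simp only [Matrix.mul_smul, Matrix.smul_mul, permOp_mul_tensorPow]

/-! ### The Haar average -/

instance isProbabilityMeasure_haarUnitary (r : ℕ) : IsProbabilityMeasure (haarUnitary r) :=
  ⟨Measure.haarMeasure_self⟩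

instance isMulLeftInvariant_haarUnitary (r : ℕ) : (haarUnitary r).IsMulLeftInvariant :=
  inferInstanceAs (Measure.haarMeasure _).IsMulLeftInvariant

/-- The integrand of the twirl. -/
def conjPow (X : Matrix (Fin n → Fin r) (Fin n → Fin r) ℂ)
    (U : Matrix.unitaryGroup (Fin r) ℂ) : Matrix (Fin n → Fin r) (Fin n → Fin r) ℂ :=
  tensorPow n U.1 * X * (tensorPow n U.1)ᴴ

/-- The average of `U^{⊗n} X U^{†⊗n}` over the unitary group. -/
def twirl (X : Matrix (Fin n → Fin r) (Fin n → Fin r) ℂ) :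
    Matrix (Fin n → Fin r) (Fin n → Fin r) ℂ :=
  Matrix.of fun x y => ∫ U, conjPow X U x y ∂(haarUnitary r)

theorem continuous_conjPow (X : Matrix (Fin n → Fin r) (Fin n → Fin r) ℂ)
    (x y : Fin n → Fin r) : Continuous fun U => conjPow X U x y := by
  have h : ∀ i j, Continuous fun U : Matrix.unitaryGroup (Fin r) ℂ => U.1 i j := fun i j =>
    (continuous_apply_apply i j).comp continuous_subtype_val
  simp only [conjPow, Matrix.mul_apply, Matrix.conjTranspose_apply, tensorPow_apply]
  refine continuous_finsetSum _ fun z _ => Continuous.mul (continuous_finsetSum _ fun w _ =>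
    Continuous.mul (continuous_finsetProd _ fun k _ => h _ _) continuous_const)
    (continuous_star.comp (continuous_finsetProd _ fun k _ => h _ _))

theorem integrable_conjPow (X : Matrix (Fin n → Fin r) (Fin n → Fin r) ℂ)
    (x y : Fin n → Fin r) : Integrable (fun U => conjPow X U x y) (haarUnitary r) :=
  (continuous_conjPow X x y).integrable_of_hasCompactSupport
    (HasCompactSupport.of_compactSpace _)

theorem map_twirl (X : Matrix (Fin n → Fin r) (Fin n → Fin r) ℂ)
    (L : Matrix (Fin n → Fin r) (Fin n → Fin r) ℂ →ₗ[ℂ] ℂ) :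
    L (twirl X) = ∫ U, L (conjPow X U) ∂(haarUnitary r) := by
  have h : ∀ M : Matrix (Fin n → Fin r) (Fin n → Fin r) ℂ,
      L M = ∑ x, ∑ y, M x y * L (Matrix.single x y 1) := by
    intro M
    conv_lhs => rw [Matrix.matrix_eq_sum_single M]
    simp only [map_sum]
    refine Finset.sum_congr rfl fun x _ => Finset.sum_congr rfl fun y _ => ?_
    rw [← smul_eq_mul, ← map_smul, Matrix.smul_single, smul_eq_mul, mul_one]
  rw [h]
  simp only [h (conjPow X _)]
  rw [integral_finsetSum _ fun x _ => integrable_finsetSum _ fun y _ =>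
    (integrable_conjPow X x y).mul_const _]
  refine Finset.sum_congr rfl fun x _ => ?_
  rw [integral_finsetSum _ fun y _ => (integrable_conjPow X x y).mul_const _]
  exact Finset.sum_congr rfl fun y _ => (integral_mul_const _ _).symm

theorem tensorPow_mul_conjTranspose {U : Matrix (Fin r) (Fin r) ℂ}
    (hU : U ∈ Matrix.unitaryGroup (Fin r) ℂ) : tensorPow n U * (tensorPow n U)ᴴ = 1 := by
  rw [tensorPow_conjTranspose, ← tensorPow_mul, ← Matrix.star_eq_conjTranspose,
    Matrix.mem_unitaryGroup_iff.1 hU, tensorPow_one]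

theorem tensorPow_conjTranspose_mul {U : Matrix (Fin r) (Fin r) ℂ}
    (hU : U ∈ Matrix.unitaryGroup (Fin r) ℂ) : (tensorPow n U)ᴴ * tensorPow n U = 1 :=
  mul_eq_one_comm.1 (tensorPow_mul_conjTranspose hU)

theorem commutesWithUnitaries_twirl (X : Matrix (Fin n → Fin r) (Fin n → Fin r) ℂ) :
    CommutesWithUnitaries (twirl X) := by
  intro V hV
  have h : tensorPow n V * twirl X * (tensorPow n V)ᴴ = twirl X := by
    ext x y
    let L : Matrix (Fin n → Fin r) (Fin n → Fin r) ℂ →ₗ[ℂ] ℂ :=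
      { toFun := fun M => (tensorPow n V * M * (tensorPow n V)ᴴ) x y
        map_add' := fun M N => by rw [Matrix.mul_add, Matrix.add_mul, Matrix.add_apply]
        map_smul' := fun c M => by
          rw [Matrix.mul_smul, Matrix.smul_mul, Matrix.smul_apply, RingHom.id_apply] }
    have h1 := map_twirl X L
    have h2 : ∀ U, L (conjPow X U) = conjPow X ((⟨V, hV⟩ : Matrix.unitaryGroup (Fin r) ℂ) * U)
        x y := by
      intro U
      change (tensorPow n V * conjPow X U * (tensorPow n V)ᴴ) x y = _
      rw [conjPow, conjPow, Submonoid.coe_mul, tensorPow_mul, Matrix.conjTranspose_mul]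
      simp only [Matrix.mul_assoc]
    simp only [h2] at h1
    rw [integral_mul_left_eq_self (fun U => conjPow X U x y)] at h1
    exact h1
  calc twirl X * tensorPow n V
      = tensorPow n V * twirl X * (tensorPow n V)ᴴ * tensorPow n V := by rw [h]
    _ = tensorPow n V * twirl X := by
        rw [Matrix.mul_assoc, tensorPow_conjTranspose_mul hV, Matrix.mul_one]

/-- The matrix unit commutes with `U^{⊗n}`, so by cyclicity the integrand is constant. Thus the
coefficients of the twirl can be read off before averaging. -/
theorem trace_isoUnit_mul_twirl (u : WeylBases r b) (μ : n.Partition) (k j : Fin (dimS μ))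
    (X : Matrix (Fin n → Fin r) (Fin n → Fin r) ℂ) :
    (isoUnit u μ k j * twirl X).trace = (isoUnit u μ k j * X).trace := by
  let L : Matrix (Fin n → Fin r) (Fin n → Fin r) ℂ →ₗ[ℂ] ℂ :=
    { toFun := fun M => (isoUnit u μ k j * M).trace
      map_add' := fun M N => by rw [Matrix.mul_add, Matrix.trace_add]
      map_smul' := fun c M => by rw [Matrix.mul_smul, Matrix.trace_smul, RingHom.id_apply] }
  have h1 := map_twirl X L
  have h2 : ∀ U, L (conjPow X U) = (isoUnit u μ k j * X).trace := by
    intro U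
    change (isoUnit u μ k j * conjPow X U).trace = _
    rw [conjPow, ← Matrix.mul_assoc, ← Matrix.mul_assoc, isoUnit_mul_tensorPow,
      Matrix.trace_mul_comm, ← Matrix.mul_assoc, ← Matrix.mul_assoc,
      tensorPow_conjTranspose_mul U.2, Matrix.one_mul]
  simp only [h2, integral_const, probReal_univ, one_smul] at h1
  exact h1

theorem twirl_eq_sum (u : WeylBases r b) (X : Matrix (Fin n → Fin r) (Fin n → Fin r) ℂ) :
    twirl X = ∑ μ, ∑ j, ∑ k,
      ((isoUnit u μ k j * X).trace / (dimU r b μ : ℂ)) • isoUnit u μ j k := by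
  conv_lhs => rw [(commutesWithUnitaries_twirl X).eq_sum u]
  simp only [trace_isoUnit_mul_twirl]

end Twirl

/-! ## Kraus forms of channels -/

section Kraus

variable {X Y Z S : Type*} [Fintype X] [Fintype S]

/-- The map is a finite sum of maps `M ↦ K M K†`. -/
def HasKrausForm (Φ : Matrix X X ℂ →ₗ[ℂ] Matrix Y Y ℂ) : Prop :=
  ∃ (m : ℕ) (K : Fin m → Matrix Y X ℂ), Φ = ∑ a, conj (K a)

/-- The map preserves the trace. -/
def IsTracePreserving [Fintype Y] (Φ : Matrix X X ℂ →ₗ[ℂ] Matrix Y Y ℂ) : Prop :=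
  ∀ M : Matrix X X ℂ, (Φ M).trace = M.trace

theorem conj_apply {X Y : Type*} [Fintype X] (K : Matrix Y X ℂ) (M : Matrix X X ℂ) :
    conj K M = K * M * Kᴴ := rfl

theorem hasKrausForm_sum_conj {m : Type*} [Fintype m] (K : m → Matrix Y X ℂ) :
    HasKrausForm (∑ a, conj (K a)) :=
  ⟨Fintype.card m, fun i => K ((Fintype.equivFin m).symm i),
    (Equiv.sum_comp (Fintype.equivFin m).symm fun a => conj (K a)).symm⟩

theorem hasKrausForm_conj (K : Matrix Y X ℂ) : HasKrausForm (conj K) := by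
  simpa using hasKrausForm_sum_conj fun _ : Unit => K

theorem hasKrausForm_sum {m : Type*} [Fintype m] {Φ : m → Matrix X X ℂ →ₗ[ℂ] Matrix Y Y ℂ}
    (h : ∀ a, HasKrausForm (Φ a)) : HasKrausForm (∑ a, Φ a) := by
  choose k K hK using h
  simp only [hK]
  rw [← Fintype.sum_sigma' fun a i => conj (K a i)]
  exact hasKrausForm_sum_conj fun p : Σ a, Fin (k a) => K p.1 p.2

theorem HasKrausForm.comp [Fintype Y] {Φ : Matrix X X ℂ →ₗ[ℂ] Matrix Y Y ℂ}
    {Ψ : Matrix Y Y ℂ →ₗ[ℂ] Matrix Z Z ℂ} (hΨ : HasKrausForm Ψ) (hΦ : HasKrausForm Φ) :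
    HasKrausForm (Ψ ∘ₗ Φ) := by
  obtain ⟨k, K, rfl⟩ := hΦ
  obtain ⟨l, L, rfl⟩ := hΨ
  have h : (∑ b, conj (L b)) ∘ₗ (∑ a, conj (K a)) = ∑ b, ∑ a, conj (L b * K a) := by
    refine LinearMap.ext fun M => ?_
    simp only [LinearMap.comp_apply, LinearMap.sum_apply, map_sum, conj_apply,
      Matrix.conjTranspose_mul, Matrix.mul_assoc]
    rw [Finset.sum_comm]
  rw [h]
  exact hasKrausForm_sum fun b => hasKrausForm_sum_conj fun a => L b * K a

theorem idTensor_conj [DecidableEq S] (K : Matrix Y X ℂ) :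
    idTensor S (conj K) = conj (Matrix.kronecker (1 : Matrix S S ℂ) K) := by
  refine LinearMap.ext fun M => ?_
  ext ⟨s, y⟩ ⟨s', y'⟩
  change (K * (Matrix.of fun x x' => M (s, x) (s', x')) * Kᴴ) y y' = _
  simp only [conj_apply, Matrix.mul_apply, Fintype.sum_prod_type, Matrix.conjTranspose_apply,
    Matrix.kronecker, Matrix.kroneckerMap_apply, Matrix.one_apply, Matrix.of_apply, ite_mul,
    one_mul, zero_mul]
  rw [Finset.sum_eq_single s']
  · refine Finset.sum_congr rfl fun x' _ => ?_
    rw [Finset.sum_eq_single s]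
    · simp
    · intro t _ ht
      simp [ht.symm]
    · simp
  · intro t _ ht
    simp [ht.symm]
  · simp

theorem tensorId_conj [DecidableEq S] (K : Matrix Y X ℂ) :
    tensorId (conj K) S = conj (Matrix.kronecker K (1 : Matrix S S ℂ)) := by
  refine LinearMap.ext fun M => ?_
  ext ⟨y, s⟩ ⟨y', s'⟩
  change (K * (Matrix.of fun x x' => M (x, s) (x', s')) * Kᴴ) y y' = _
  simp only [conj_apply, Matrix.mul_apply, Fintype.sum_prod_type, Matrix.conjTranspose_apply,
    Matrix.kronecker, Matrix.kroneckerMap_apply, Matrix.one_apply, Matrix.of_apply, mul_ite,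
    mul_one, mul_zero]
  refine Finset.sum_congr rfl fun x' _ => ?_
  rw [Finset.sum_eq_single s']
  · congr 1
    · refine Finset.sum_congr rfl fun x _ => ?_
      rw [Finset.sum_eq_single s]
      · simp
      · intro t _ ht
        simp [ht.symm]
      · simp
    · simp
  · intro t _ ht
    simp [ht.symm]
  · simp

theorem HasKrausForm.idTensor {Φ : Matrix X X ℂ →ₗ[ℂ] Matrix Y Y ℂ} (hΦ : HasKrausForm Φ) :
    HasKrausForm (idTensor S Φ) := by
  classical
  obtain ⟨k, K, rfl⟩ := hΦ
  have h : RandomStinespring.idTensor S (∑ a, conj (K a))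
      = ∑ a, conj (Matrix.kronecker (1 : Matrix S S ℂ) (K a)) := by
    simp only [← idTensor_conj]
    refine LinearMap.ext fun M => ?_
    ext p q
    simp only [LinearMap.sum_apply, Matrix.sum_apply]
    change (∑ a, conj (K a)) _ p.2 q.2 = _
    rw [LinearMap.sum_apply, Matrix.sum_apply]
    rfl
  rw [h]
  exact hasKrausForm_sum_conj _

theorem HasKrausForm.tensorId {Φ : Matrix X X ℂ →ₗ[ℂ] Matrix Y Y ℂ} (hΦ : HasKrausForm Φ) :
    HasKrausForm (tensorId Φ S) := by
  classical
  obtain ⟨k, K, rfl⟩ := hΦ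
  have h : RandomStinespring.tensorId (∑ a, conj (K a)) S
      = ∑ a, conj (Matrix.kronecker (K a) (1 : Matrix S S ℂ)) := by
    simp only [← tensorId_conj]
    refine LinearMap.ext fun M => ?_
    ext p q
    simp only [LinearMap.sum_apply, Matrix.sum_apply]
    change (∑ a, conj (K a)) _ p.1 q.1 = _
    rw [LinearMap.sum_apply, Matrix.sum_apply]
    rfl
  rw [h]
  exact hasKrausForm_sum_conj _

theorem IsTracePreserving.idTensor [Fintype Y] {Φ : Matrix X X ℂ →ₗ[ℂ] Matrix Y Y ℂ}
    (hΦ : IsTracePreserving Φ) : IsTracePreserving (idTensor S Φ) := by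
  intro M
  simp only [Matrix.trace, Matrix.diag, Fintype.sum_prod_type]
  exact Finset.sum_congr rfl fun s _ => hΦ (Matrix.of fun x x' => M (s, x) (s, x'))

theorem IsTracePreserving.tensorId [Fintype Y] {Φ : Matrix X X ℂ →ₗ[ℂ] Matrix Y Y ℂ}
    (hΦ : IsTracePreserving Φ) : IsTracePreserving (tensorId Φ S) := by
  intro M
  simp only [Matrix.trace, Matrix.diag, Fintype.sum_prod_type_right]
  exact Finset.sum_congr rfl fun s _ => hΦ (Matrix.of fun x x' => M (x, s) (x', s))

theorem IsTracePreserving.comp [Fintype Y] [Fintype Z] {Φ : Matrix X X ℂ →ₗ[ℂ] Matrix Y Y ℂ}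
    {Ψ : Matrix Y Y ℂ →ₗ[ℂ] Matrix Z Z ℂ} (hΨ : IsTracePreserving Ψ)
    (hΦ : IsTracePreserving Φ) : IsTracePreserving (Ψ ∘ₗ Φ) :=
  fun M => (hΨ _).trans (hΦ M)

theorem isTracePreserving_conj [Fintype Y] [DecidableEq X] {K : Matrix Y X ℂ} (h : Kᴴ * K = 1) :
    IsTracePreserving (conj K) := fun M => by
  rw [conj_apply, Matrix.trace_mul_comm, ← Matrix.mul_assoc, h, Matrix.one_mul]

theorem HasKrausForm.isQuantumChannel [Fintype Y] {Φ : Matrix X X ℂ →ₗ[ℂ] Matrix Y Y ℂ}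
    (hΦ : HasKrausForm Φ) (htr : IsTracePreserving Φ) : IsQuantumChannel Φ := by
  refine ⟨fun k M hM => ?_, htr⟩
  obtain ⟨m, K, hK⟩ := hΦ.idTensor (S := Fin k)
  rw [hK, LinearMap.sum_apply]
  exact Matrix.posSemidef_sum _ fun a _ => hM.mul_mul_conjTranspose_same (K a)

/-- Reading off the images of matrix units. -/
theorem conj_single_apply [DecidableEq X] (K : Matrix Y X ℂ) (x x' : X) (y y' : Y) :
    conj K (Matrix.single x x' 1) y y' = K y x * star (K y' x') := by
  rw [conj_apply, Matrix.mul_apply, Finset.sum_eq_single x']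
  · rw [Matrix.mul_single_apply_same, mul_one, Matrix.conjTranspose_apply]
  · intro z _ hz
    rw [Matrix.mul_single_apply_of_ne _ _ _ _ _ hz, zero_mul]
  · simp

theorem channelPow_apply (n : ℕ) [DecidableEq X] (Φ : Matrix X X ℂ →ₗ[ℂ] Matrix Y Y ℂ)
    (M : Matrix (Fin n → X) (Fin n → X) ℂ) (y y' : Fin n → Y) :
    channelPow n Φ M y y' = ∑ x, ∑ x',
      M x x' * ∏ k, Φ (Matrix.single (x k) (x' k) 1) (y k) (y' k) := rfl

/-- The Kraus operators of the power are the products of `n` Kraus operators, one choice per factor.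
-/
theorem channelPow_sum_conj (n : ℕ) [DecidableEq X] {m : Type*} [Fintype m]
    (K : m → Matrix Y X ℂ) :
    channelPow n (∑ a, conj (K a)) = ∑ e : Fin n → m,
      conj (Matrix.of fun (y : Fin n → Y) (x : Fin n → X) => ∏ k, K (e k) (y k) (x k)) := by
  classical
  refine LinearMap.ext fun M => ?_
  ext y y'
  have h0 : ∀ (x x' : X) (y y' : Y), (∑ a, conj (K a)) (Matrix.single x x' 1) y y'
      = ∑ a, K a y x * star (K a y' x') := by
    intro x x' y y'
    rw [LinearMap.sum_apply, Matrix.sum_apply]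
    simp only [conj_single_apply]
  rw [channelPow_apply, LinearMap.sum_apply, Matrix.sum_apply]
  simp only [h0, Finset.prod_univ_sum,
    Fintype.piFinset_univ, Finset.mul_sum, conj_apply, Matrix.mul_apply,
    Matrix.conjTranspose_apply, Matrix.of_apply, Finset.sum_mul, star_prod,
    Finset.prod_mul_distrib]
  have h1 : ∀ (f : (Fin n → X) → (Fin n → X) → (Fin n → m) → ℂ),
      ∑ x, ∑ x', ∑ e, f x x' e = ∑ e, ∑ x', ∑ x, f x x' e := by
    intro f
    rw [Finset.sum_comm]
    simp only [Finset.sum_comm (s := (Finset.univ : Finset (Fin n → X)))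
      (t := (Finset.univ : Finset (Fin n → m)))]
  rw [h1]
  refine Finset.sum_congr rfl fun e _ => Finset.sum_congr rfl fun x' _ =>
    Finset.sum_congr rfl fun x _ => ?_
  ring

theorem HasKrausForm.channelPow (n : ℕ) [DecidableEq X] {Φ : Matrix X X ℂ →ₗ[ℂ] Matrix Y Y ℂ}
    (hΦ : HasKrausForm Φ) : HasKrausForm (channelPow n Φ) := by
  obtain ⟨k, K, rfl⟩ := hΦ
  rw [channelPow_sum_conj]
  exact hasKrausForm_sum_conj _

theorem IsTracePreserving.channelPow (n : ℕ) [Fintype Y] [DecidableEq X]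
    {Φ : Matrix X X ℂ →ₗ[ℂ] Matrix Y Y ℂ} (hΦ : IsTracePreserving Φ) :
    IsTracePreserving (channelPow n Φ) := by
  classical
  intro M
  have h1 : ∀ x x' : Fin n → X, ∑ y : Fin n → Y, ∏ k, Φ (Matrix.single (x k) (x' k) 1) (y k) (y k)
      = if x = x' then 1 else 0 := by
    intro x x'
    rw [← Fintype.piFinset_univ, ← Finset.prod_univ_sum (fun _ => Finset.univ)
      fun k y => Φ (Matrix.single (x k) (x' k) 1) y y]
    have h2 : ∀ k, ∑ y, Φ (Matrix.single (x k) (x' k) 1) y y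
        = if x k = x' k then 1 else 0 := by
      intro k
      refine (hΦ (Matrix.single (x k) (x' k) 1)).trans ?_
      split_ifs with h
      · rw [h, Matrix.trace_single_eq_same]
      · exact Matrix.trace_single_eq_of_ne _ _ _ h
    simp only [h2]
    split_ifs with h
    · simp [h]
    · obtain ⟨k, hk⟩ := Function.ne_iff.1 h
      exact Finset.prod_eq_zero (Finset.mem_univ k) (if_neg hk)
  simp only [Matrix.trace, Matrix.diag, channelPow_apply]
  rw [Finset.sum_comm]
  refine Finset.sum_congr rfl fun x _ => ?_
  rw [Finset.sum_comm]
  simp only [← Finset.mul_sum, h1]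
  simp

/-! ### Stinespring isometries -/

/-- Scale the eigenvectors of nonzero eigenvalues by square roots and inject them into the `r`
columns of `W`; unused columns are zero. -/
theorem exists_eq_mul_conjTranspose [DecidableEq X] {M : Matrix X X ℂ} (hM : M.PosSemidef) {r : ℕ}
    (hr : M.rank ≤ r) : ∃ W : Matrix X (Fin r) ℂ, M = W * Wᴴ := by
  have hH := hM.isHermitian
  rw [hH.rank_eq_card_non_zero_eigs, ← Fintype.card_fin r] at hr
  obtain ⟨f⟩ := Function.Embedding.nonempty_of_card_le hr
  set U : Matrix X X ℂ := hH.eigenvectorUnitary.1 with hU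
  have hspec : M = U * Matrix.diagonal (RCLike.ofReal ∘ hH.eigenvalues) * Uᴴ := by
    conv_lhs => rw [hH.spectral_theorem, Unitary.conjStarAlgAut_apply]
    rfl
  let W : Matrix X (Fin r) ℂ := Matrix.of fun x e => ∑ i : {i // hH.eigenvalues i ≠ 0},
    if f i = e then U x i.1 * ((Real.sqrt (hH.eigenvalues i.1) : ℝ) : ℂ) else 0
  refine ⟨W, ?_⟩
  ext x y
  have h1 : (W * Wᴴ) x y = ∑ i : {i // hH.eigenvalues i ≠ 0},
      U x i.1 * (hH.eigenvalues i.1 : ℂ) * star (U y i.1) := by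
    simp only [Matrix.mul_apply, Matrix.conjTranspose_apply, W, Matrix.of_apply, Finset.sum_mul]
    rw [Finset.sum_comm]
    refine Finset.sum_congr rfl fun i _ => ?_
    rw [Finset.sum_eq_single (f i)]
    · rw [if_pos rfl, Finset.sum_eq_single i]
      · rw [if_pos rfl, star_mul', Complex.star_def, Complex.conj_ofReal,
          ← sqrt_mul_sqrt_complex (hM.eigenvalues_nonneg i.1)]
        ring
      · intro j _ hj
        exact if_neg fun h => hj (f.injective h)
      · simp
    · intro e _ he
      rw [if_neg he.symm, zero_mul]
    · simp
  rw [h1]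
  conv_lhs => rw [hspec]
  rw [Matrix.mul_apply]
  simp only [Matrix.mul_diagonal, Matrix.conjTranspose_apply, Function.comp_apply]
  symm
  refine Finset.sum_of_injOn Subtype.val Subtype.val_injective.injOn (fun _ _ => by simp) ?_ ?_
  · intro i _ hi
    have h2 : hH.eigenvalues i = 0 := by
      by_contra h
      exact hi ⟨⟨i, h⟩, by simp, rfl⟩
    simp [h2]
  · intro i _
    rfl

theorem apply_eq_sum_single [DecidableEq X] (Φ : Matrix X X ℂ →ₗ[ℂ] Matrix Y Y ℂ)
    (M : Matrix X X ℂ) (y y' : Y) :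
    Φ M y y' = ∑ x, ∑ x', M x x' * Φ (Matrix.single x x' 1) y y' := by
  conv_lhs => rw [Matrix.matrix_eq_sum_single M]
  simp only [map_sum, Matrix.sum_apply]
  refine Finset.sum_congr rfl fun x _ => Finset.sum_congr rfl fun x' _ => ?_
  rw [← smul_eq_mul, ← Matrix.smul_apply, ← map_smul, Matrix.smul_single, smul_eq_mul, mul_one]

theorem choiMatrix_posSemidef [Fintype Y] {k : ℕ} {Φ : Matrix (Fin k) (Fin k) ℂ →ₗ[ℂ] Matrix Y Y ℂ}
    (hΦ : IsQuantumChannel Φ) : (choiMatrix Φ).PosSemidef := by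
  -- The unnormalized maximally entangled vector: the Choi matrix is the image of its projector
  -- under `Id ⊗ Φ`.
  let v : Fin k × Fin k → ℂ := fun p => if p.1 = p.2 then 1 else 0
  have h1 := hΦ.1 k _ (Matrix.posSemidef_vecMulVec_self_star v)
  convert h1 using 1
  ext ⟨i, y⟩ ⟨j, y'⟩
  change Φ (Matrix.single i j 1) y y' = Φ (Matrix.of fun x x' =>
    Matrix.vecMulVec v (star v) (i, x) (j, x')) y y'
  suffices h4 : Matrix.single i j (1 : ℂ) = Matrix.of fun x x' =>
      Matrix.vecMulVec v (star v) (i, x) (j, x') by rw [h4]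
  ext x x'
  simp only [Matrix.single_apply, Matrix.of_apply, Matrix.vecMulVec_apply, v, Pi.star_apply]
  by_cases h2 : i = x <;> by_cases h3 : j = x' <;> simp [h2, h3]

/-- `V` is a factor of the Choi matrix with its indices regrouped; `V† V = 1` is trace preservation
on matrix units. -/
theorem exists_isStinespringIsometry [Fintype Y] {k r : ℕ} [DecidableEq Y]
    {Φ : Matrix (Fin k) (Fin k) ℂ →ₗ[ℂ] Matrix Y Y ℂ} (hΦ : IsQuantumChannel Φ)
    (hr : choiRank Φ ≤ r) : ∃ V : Matrix (Y × Fin r) (Fin k) ℂ, IsStinespringIsometry Φ V := by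
  obtain ⟨W, hW⟩ := exists_eq_mul_conjTranspose (choiMatrix_posSemidef hΦ) hr
  have hW' : ∀ x x' y y', Φ (Matrix.single x x' 1) y y'
      = ∑ e, W (x, y) e * star (W (x', y') e) := fun x x' y y' => by
    have h := congrFun (congrFun hW (x, y)) (x', y')
    rw [Matrix.mul_apply] at h
    exact h
  refine ⟨Matrix.of fun p x => W (x, p.1) p.2, ?_, ?_⟩
  · ext x x'
    have h1 := hΦ.2 (Matrix.single x' x 1)
    simp only [Matrix.trace, Matrix.diag, hW'] at h1
    rw [Matrix.mul_apply, Fintype.sum_prod_type]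
    simp only [Matrix.conjTranspose_apply, Matrix.of_apply, mul_comm (star _)]
    rw [h1, Matrix.one_apply]
    split_ifs with h
    · subst h
      exact Matrix.trace_single_eq_same _ _
    · exact Matrix.trace_single_eq_of_ne _ _ _ (Ne.symm h)
  · intro M y y'
    rw [apply_eq_sum_single]
    simp only [hW', Matrix.mul_apply, Matrix.conjTranspose_apply, Matrix.of_apply, Finset.sum_mul,
      Finset.mul_sum]
    rw [Finset.sum_comm]
    conv_rhs => rw [Finset.sum_comm]
    refine Finset.sum_congr rfl fun x' _ => ?_
    rw [Finset.sum_comm]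
    refine Finset.sum_congr rfl fun e _ => Finset.sum_congr rfl fun x _ => ?_
    ring

theorem IsStinespringIsometry.eq_sum_conj [Fintype Y] {E : Type*} [Fintype E] [DecidableEq X]
    {Φ : Matrix X X ℂ →ₗ[ℂ] Matrix Y Y ℂ} {V : Matrix (Y × E) X ℂ}
    (hV : IsStinespringIsometry Φ V) :
    Φ = ∑ e, conj (Matrix.of fun y x => V (y, e) x) := by
  refine LinearMap.ext fun M => ?_
  ext y y'
  rw [hV.2, LinearMap.sum_apply, Matrix.sum_apply]
  rfl

end Kraus

/-! ## The circuit -/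

section Circuit

variable {n r : ℕ} {b : SpechtBases n}

/-! ### The components -/

theorem ctrlPerm_conjTranspose_mul (n : ℕ) (X : Type*) [DecidableEq X] [Fintype X] :
    (ctrlPerm n X)ᴴ * ctrlPerm n X = 1 := by
  ext ⟨σ, x⟩ ⟨τ, y⟩
  rw [Matrix.mul_apply, Fintype.sum_prod_type, Finset.sum_eq_single τ]
  · simp only [Matrix.conjTranspose_apply, ctrlPerm, Matrix.of_apply, if_true]
    by_cases h : τ = σ
    · subst h
      have h1 := congrFun (congrFun (permOp_mul (X := X) τ⁻¹ τ) x) y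
      rw [inv_mul_cancel, permOp_one, ← permOp_conjTranspose, Matrix.mul_apply] at h1
      simp only [Matrix.conjTranspose_apply] at h1
      simp only [if_true, ← h1, Matrix.one_apply, Prod.mk.injEq, true_and]
    · simp [h, Ne.symm h]
  · intro ρ _ hρ
    simp [ctrlPerm, hρ]
  · simp

theorem ctrlPerm_mul_conjTranspose (n : ℕ) (X : Type*) [DecidableEq X] [Fintype X] :
    ctrlPerm n X * (ctrlPerm n X)ᴴ = 1 :=
  mul_eq_one_comm.1 (ctrlPerm_conjTranspose_mul n X)

theorem inv_sqrt_factorial_mul_self (n : ℕ) :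
    ((1 / Real.sqrt (n.factorial : ℝ) : ℝ) : ℂ) * ((1 / Real.sqrt (n.factorial : ℝ) : ℝ) : ℂ)
      = 1 / (n.factorial : ℂ) := by
  rw [← Complex.ofReal_mul, div_mul_div_comm, Real.mul_self_sqrt (by positivity)]
  push_cast
  ring

theorem uniformSuperposition_conjTranspose_mul (n : ℕ) (X : Type*) [DecidableEq X] [Fintype X] :
    (uniformSuperposition n X)ᴴ * uniformSuperposition n X = 1 := by
  ext x y
  have h : ∀ σ : Equiv.Perm (Fin n), ∑ z : Fin n → X,
      (uniformSuperposition n X)ᴴ x (σ, z) * uniformSuperposition n X (σ, z) y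
        = if x = y then 1 / (n.factorial : ℂ) else 0 := by
    intro σ
    rw [Finset.sum_eq_single y]
    · rw [Matrix.conjTranspose_apply, uniformSuperposition, Matrix.of_apply, Matrix.of_apply,
        if_pos rfl]
      by_cases h : x = y
      · rw [if_pos h, if_pos h.symm, Complex.star_def, Complex.conj_ofReal,
          inv_sqrt_factorial_mul_self]
      · rw [if_neg h, if_neg (Ne.symm h), star_zero, zero_mul]
    · intro z _ hz
      rw [uniformSuperposition, Matrix.of_apply, if_neg hz, mul_zero]
    · simp
  rw [Matrix.mul_apply, Fintype.sum_prod_type]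
  simp only [h, Matrix.one_apply]
  rw [Finset.sum_const, Finset.card_univ, Fintype.card_perm, Fintype.card_fin, nsmul_eq_mul]
  have hf : (n.factorial : ℂ) ≠ 0 := Nat.cast_ne_zero.2 n.factorial_ne_zero
  split_ifs
  · field_simp
  · simp

theorem encoder_conjTranspose_mul (n : ℕ) (X : Type*) [DecidableEq X] [Fintype X] :
    (encoder n X)ᴴ * encoder n X = 1 := by
  rw [encoder, Matrix.conjTranspose_mul, Matrix.mul_assoc, ← Matrix.mul_assoc (ctrlPerm n X)ᴴ,
    ctrlPerm_conjTranspose_mul, Matrix.one_mul, uniformSuperposition_conjTranspose_mul]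

theorem qft_kronecker_conjTranspose_mul (X : Type*) [DecidableEq X] [Fintype X] :
    (Matrix.kronecker (qft b) (1 : Matrix X X ℂ))ᴴ
      * Matrix.kronecker (qft b) (1 : Matrix X X ℂ) = 1 := by
  rw [Matrix.kronecker, Matrix.conjTranspose_kronecker, Matrix.conjTranspose_one,
    ← Matrix.mul_kronecker_mul, qft_conjTranspose_mul, Matrix.one_mul, Matrix.one_kronecker_one]

theorem qft_kronecker_mul_conjTranspose (X : Type*) [DecidableEq X] [Fintype X] :
    Matrix.kronecker (qft b) (1 : Matrix X X ℂ)
      * (Matrix.kronecker (qft b) (1 : Matrix X X ℂ))ᴴ = 1 := by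
  rw [Matrix.kronecker, Matrix.conjTranspose_kronecker, Matrix.conjTranspose_one,
    ← Matrix.mul_kronecker_mul, qft_mul_conjTranspose, Matrix.one_mul, Matrix.one_kronecker_one]

theorem decoder_conjTranspose_mul (X : Type*) [DecidableEq X] [Fintype X] :
    (decoder b X)ᴴ * decoder b X = 1 := by
  rw [decoder, Matrix.conjTranspose_mul, Matrix.conjTranspose_conjTranspose, Matrix.mul_assoc,
    ← Matrix.mul_assoc (Matrix.kronecker (qft b) (1 : Matrix (Fin n → X) (Fin n → X) ℂ))ᴴ,
    qft_kronecker_conjTranspose_mul, Matrix.one_mul, ctrlPerm_mul_conjTranspose]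

theorem decoder_mul_conjTranspose (X : Type*) [DecidableEq X] [Fintype X] :
    decoder b X * (decoder b X)ᴴ = 1 := by
  rw [decoder, Matrix.conjTranspose_mul, Matrix.conjTranspose_conjTranspose, Matrix.mul_assoc,
    ← Matrix.mul_assoc (ctrlPerm n X)ᴴ, ctrlPerm_conjTranspose_mul, Matrix.one_mul,
    qft_kronecker_mul_conjTranspose]

theorem replaceChannel_apply (M : Matrix (FourierLabel n) (FourierLabel n) ℂ) :
    replaceChannel r b M = ∑ μ : n.Partition,
      if len μ ≤ r then
        ∑ i : Fin (dimS μ), ∑ j : Fin (dimS μ), ∑ l : Fin (dimS μ),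
          M ⟨μ, (i, j)⟩ ⟨μ, (i, l)⟩ • ∑ α : Fin (dimU r b μ),
            Matrix.single (⟨μ, (j, α)⟩ : SchurLabel r b) (⟨μ, (l, α)⟩ : SchurLabel r b)
              (1 / (dimU r b μ : ℂ))
      else
        ∑ i : Fin (dimS μ), ∑ j : Fin (dimS μ),
          M ⟨μ, (i, j)⟩ ⟨μ, (i, j)⟩ •
            ((1 / (r : ℂ) ^ n) • (1 : Matrix (SchurLabel r b) (SchurLabel r b) ℂ)) := rfl

theorem isTracePreserving_replaceChannel (hr : 1 ≤ r) (u : WeylBases r b) :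
    IsTracePreserving (replaceChannel r b) := by
  intro M
  rw [replaceChannel_apply, Matrix.trace_sum]
  conv_rhs => rw [Matrix.trace, Fintype.sum_sigma]
  refine Finset.sum_congr rfl fun μ _ => ?_
  rw [Fintype.sum_prod_type]
  split_ifs with h
  · have hd : (dimU r b μ : ℂ) ≠ 0 := Nat.cast_ne_zero.2 (dimU_pos h).ne'
    rw [Matrix.trace_sum]
    refine Finset.sum_congr rfl fun i _ => ?_
    rw [Matrix.trace_sum]
    refine Finset.sum_congr rfl fun j _ => ?_
    rw [Matrix.trace_sum, Finset.sum_eq_single j]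
    · simp only [Matrix.trace_smul, Matrix.trace_sum, Matrix.trace_single_eq_same]
      rw [Finset.sum_const, Finset.card_univ, Fintype.card_fin, nsmul_eq_mul, mul_one_div_cancel hd,
        smul_eq_mul, mul_one]
      rfl
    · intro l _ hl
      rw [Matrix.trace_smul, Matrix.trace_sum, Finset.sum_eq_zero, smul_zero]
      intro α _
      refine Matrix.trace_single_eq_of_ne _ _ _ fun h1 => hl ?_
      simp only [Sigma.mk.injEq, heq_eq_eq, true_and, Prod.mk.injEq] at h1
      exact h1.1.symm
    · simp
  -- The label space has dimension `r^n`, so the replacement state has trace one.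
  · have hrn : (r : ℂ) ^ n ≠ 0 := pow_ne_zero _ (Nat.cast_ne_zero.2 (by omega))
    simp only [Matrix.trace_sum, Matrix.trace_smul, Matrix.trace_one, card_schurLabel u,
      smul_eq_mul, Nat.cast_pow, one_div, inv_mul_cancel₀ hrn, mul_one]
    rfl

theorem conj_smul_single {X Y : Type*} [Fintype X] [DecidableEq X] [DecidableEq Y] {c : ℝ}
    (hc : 0 ≤ c) {m : Type*} [Fintype m] (f : m → Y) (g : m → X) (M : Matrix X X ℂ) :
    conj (∑ j, Matrix.single (f j) (g j) ((Real.sqrt c : ℝ) : ℂ)) M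
      = ∑ j, ∑ l, M (g j) (g l) • Matrix.single (f j) (f l) (c : ℂ) := by
  rw [conj_apply, Matrix.conjTranspose_sum, Matrix.sum_mul, Matrix.sum_mul]
  refine Finset.sum_congr rfl fun j _ => ?_
  rw [Matrix.mul_sum]
  refine Finset.sum_congr rfl fun l _ => ?_
  rw [Matrix.conjTranspose_single, Matrix.single_mul_mul_single, Matrix.smul_single,
    ← sqrt_mul_sqrt_complex hc, Complex.star_def, Complex.conj_ofReal, smul_eq_mul]
  congr 1
  ring

theorem sum_conj_kraus_of_len_le (μ : n.Partition) (i : Fin (dimS μ))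
    (M : Matrix (FourierLabel n) (FourierLabel n) ℂ) :
    ∑ α : Fin (dimU r b μ), conj (∑ j : Fin (dimS μ),
        Matrix.single (⟨μ, (j, α)⟩ : SchurLabel r b)
          (⟨μ, (i, j)⟩ : FourierLabel n) ((Real.sqrt (1 / dimU r b μ) : ℝ) : ℂ)) M
      = ∑ j : Fin (dimS μ), ∑ l : Fin (dimS μ),
          M ⟨μ, (i, j)⟩ ⟨μ, (i, l)⟩ • ∑ α : Fin (dimU r b μ),
            Matrix.single (⟨μ, (j, α)⟩ : SchurLabel r b) (⟨μ, (l, α)⟩ : SchurLabel r b)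
              (1 / (dimU r b μ : ℂ)) := by
  have hc : (0 : ℝ) ≤ 1 / dimU r b μ := by positivity
  rw [Finset.sum_congr rfl fun α _ => conj_smul_single hc
    (fun j : Fin (dimS μ) => (⟨μ, (j, α)⟩ : SchurLabel r b))
    (fun j : Fin (dimS μ) => (⟨μ, (i, j)⟩ : FourierLabel n)) M]
  rw [Finset.sum_comm]
  refine Finset.sum_congr rfl fun j _ => ?_
  rw [Finset.sum_comm]
  refine Finset.sum_congr rfl fun l _ => ?_
  rw [Finset.smul_sum]
  push_cast
  rfl

theorem sum_conj_kraus_of_lt_len (a : FourierLabel n)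
    (M : Matrix (FourierLabel n) (FourierLabel n) ℂ) :
    ∑ s : SchurLabel r b, conj (∑ _x : Unit, Matrix.single s a
        ((Real.sqrt (1 / r ^ n) : ℝ) : ℂ)) M
      = M a a • ((1 / (r : ℂ) ^ n) • (1 : Matrix (SchurLabel r b) (SchurLabel r b) ℂ)) := by
  have hc : (0 : ℝ) ≤ 1 / r ^ n := by positivity
  rw [Finset.sum_congr rfl fun s _ => conj_smul_single hc (fun _ : Unit => s)
    (fun _ : Unit => a) M]
  simp only [Finset.univ_unique, Finset.sum_singleton]
  rw [← Finset.smul_sum, Matrix.smul_one_eq_diagonal, ← Matrix.sum_single_eq_diagonal]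
  push_cast
  rfl

theorem hasKrausForm_replaceChannel : HasKrausForm (replaceChannel r b) := by
  -- Kraus labels are the discarded data: the row `i` with the new label `α` in the first branch,
  -- and the whole Fourier label with the new basis state `s` in the second.
  have h : replaceChannel r b = ∑ μ : n.Partition,
      if len μ ≤ r then
        ∑ i : Fin (dimS μ), ∑ α : Fin (dimU r b μ),
          conj (∑ j : Fin (dimS μ), Matrix.single (⟨μ, (j, α)⟩ : SchurLabel r b)
            (⟨μ, (i, j)⟩ : FourierLabel n) ((Real.sqrt (1 / dimU r b μ) : ℝ) : ℂ))
      else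
        ∑ i : Fin (dimS μ), ∑ j : Fin (dimS μ), ∑ s : SchurLabel r b,
          conj (∑ _x : Unit, Matrix.single s
            (⟨μ, (i, j)⟩ : FourierLabel n) ((Real.sqrt (1 / r ^ n) : ℝ) : ℂ)) := by
    refine LinearMap.ext fun M => ?_
    rw [replaceChannel_apply, LinearMap.sum_apply]
    refine Finset.sum_congr rfl fun μ _ => ?_
    split_ifs
    · simp only [LinearMap.sum_apply, sum_conj_kraus_of_len_le]
    · simp only [LinearMap.sum_apply, sum_conj_kraus_of_lt_len]
  rw [h]
  refine hasKrausForm_sum fun μ => ?_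
  split_ifs
  · exact hasKrausForm_sum fun i => hasKrausForm_sum fun α => hasKrausForm_conj _
  · exact hasKrausForm_sum fun i => hasKrausForm_sum fun j => hasKrausForm_sum fun s =>
      hasKrausForm_conj _

theorem isQuantumChannel_circuit {A B : Type*} [Fintype A] [DecidableEq A] [Fintype B]
    [DecidableEq B] (hr : 1 ≤ r) (u : WeylBases r b) {Φ : Matrix A A ℂ →ₗ[ℂ] Matrix B B ℂ}
    (hK : HasKrausForm Φ) (hT : IsTracePreserving Φ) : IsQuantumChannel (circuit b u Φ) := by
  refine HasKrausForm.isQuantumChannel ?_ ?_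
  · exact (hasKrausForm_conj _).tensorId.comp (hasKrausForm_replaceChannel.tensorId.comp
      ((hasKrausForm_conj _).comp ((hK.channelPow n).idTensor.comp (hasKrausForm_conj _))))
  · exact (isTracePreserving_conj (schur_conjTranspose_mul u)).tensorId.comp
      ((isTracePreserving_replaceChannel hr u).tensorId.comp
        ((isTracePreserving_conj (decoder_conjTranspose_mul B)).comp
          ((hT.channelPow n).idTensor.comp
            (isTracePreserving_conj (encoder_conjTranspose_mul n A)))))

/-! ### The action of the circuit -/

variable {A B : Type*}

/-- The tensor power of a Stinespring isometry, with the environments on the left. -/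
def stinePow (n : ℕ) {A B E : Type*} (V : Matrix (B × E) A ℂ) :
    Matrix ((Fin n → E) × (Fin n → B)) (Fin n → A) ℂ :=
  Matrix.of fun p x => ∏ k, V (p.2 k, p.1 k) (x k)

theorem stinePow_apply {A B E : Type*} (V : Matrix (B × E) A ℂ)
    (e : Fin n → E) (y : Fin n → B) (x : Fin n → A) :
    stinePow n V (e, y) x = ∏ k, V (y k, e k) (x k) := rfl

theorem stinePow_comp {A B E : Type*} (V : Matrix (B × E) A ℂ) (σ : Equiv.Perm (Fin n))
    (e : Fin n → E) (y : Fin n → B) (x : Fin n → A) :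
    stinePow n V (e ∘ σ, y ∘ σ) (x ∘ σ) = stinePow n V (e, y) x := by
  rw [stinePow_apply, stinePow_apply]
  exact Equiv.prod_comp σ fun k => V (y k, e k) (x k)

/-- The block of `W M W†` at a pair of output basis vectors, where `W` is the tensor power of the
Stinespring isometry. -/
def envBlock [Fintype A] (V : Matrix (B × Fin r) A ℂ) (M : Matrix (Fin n → A) (Fin n → A) ℂ)
    (y y' : Fin n → B) : Matrix (Fin n → Fin r) (Fin n → Fin r) ℂ :=
  Matrix.of fun e e' => (stinePow n V * M * (stinePow n V)ᴴ) (e, y) (e', y')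

theorem isometryPow_apply [Fintype B] [DecidableEq B] (V : Matrix (B × Fin r) A ℂ) (U : Matrix (Fin r) (Fin r) ℂ)
    (e : Fin n → Fin r) (y : Fin n → B) (x : Fin n → A) :
    isometryPow n V U (e, y) x = ∑ e', tensorPow n U e e' * stinePow n V (e', y) x := by
  have h : ∀ k, (Matrix.kronecker (1 : Matrix B B ℂ) U * V) (y k, e k) (x k)
      = ∑ j, U (e k) j * V (y k, j) (x k) := by
    intro k
    rw [Matrix.mul_apply, Fintype.sum_prod_type, Finset.sum_eq_single (y k)]
    · simp [Matrix.kronecker, Matrix.kroneckerMap_apply]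
    · intro z _ hz
      simp [Matrix.kronecker, Matrix.kroneckerMap_apply, Matrix.one_apply_ne hz.symm]
    · simp
  rw [isometryPow, Matrix.of_apply]
  simp only [h, Finset.prod_univ_sum, Fintype.piFinset_univ, Finset.prod_mul_distrib,
    tensorPow_apply, stinePow_apply]

/-- `U` acts on the environments alone, so it conjugates each block with fixed outputs. -/
theorem randomStinespring_apply [Fintype A] [Fintype B] [DecidableEq B] (V : Matrix (B × Fin r) A ℂ)
    (M : Matrix (Fin n → A) (Fin n → A) ℂ) (e e' : Fin n → Fin r) (y y' : Fin n → B) :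
    randomStinespring n V M (e, y) (e', y') = twirl (envBlock V M y y') e e' := by
  rw [randomStinespring, Matrix.of_apply, twirl, Matrix.of_apply]
  congr 1
  ext U
  have h : ∀ y, (Matrix.of fun e x => isometryPow n V U.1 (e, y) x)
      = tensorPow n U.1 * Matrix.of fun e x => stinePow n V (e, y) x := by
    intro y
    ext e x
    rw [Matrix.of_apply, isometryPow_apply, Matrix.mul_apply]
    rfl
  have h1 : (isometryPow n V U.1 * M * (isometryPow n V U.1)ᴴ) (e, y) (e', y')
      = ((Matrix.of fun e x => isometryPow n V U.1 (e, y) x) * M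
        * (Matrix.of fun e x => isometryPow n V U.1 (e, y') x)ᴴ) e e' := rfl
  have h2 : envBlock V M y y' = (Matrix.of fun e x => stinePow n V (e, y) x) * M
        * (Matrix.of fun e x => stinePow n V (e, y') x)ᴴ := rfl
  rw [h1, h, h, conjPow, h2, Matrix.conjTranspose_mul]
  simp only [Matrix.mul_assoc]

theorem channelPow_eq_sum_envBlock [Fintype A] [DecidableEq A] [Fintype B] {Φ : Matrix A A ℂ →ₗ[ℂ] Matrix B B ℂ}
    {V : Matrix (B × Fin r) A ℂ} (hV : IsStinespringIsometry Φ V)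
    (M : Matrix (Fin n → A) (Fin n → A) ℂ) (y y' : Fin n → B) :
    channelPow n Φ M y y' = ∑ e, envBlock V M y y' e e := by
  rw [hV.eq_sum_conj, channelPow_sum_conj, LinearMap.sum_apply, Matrix.sum_apply]
  rfl

theorem encoder_apply [Fintype A] [DecidableEq A] (σ : Equiv.Perm (Fin n)) (x z : Fin n → A) :
    encoder n A (σ, x) z
      = if z = x ∘ σ then ((1 / Real.sqrt (n.factorial : ℝ) : ℝ) : ℂ) else 0 := by
  rw [encoder, Matrix.mul_apply, Fintype.sum_prod_type, Finset.sum_eq_single σ]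
  · rw [Finset.sum_eq_single z]
    · simp [ctrlPerm, uniformSuperposition, permOp, eq_comp_symm_iff]
    · intro w _ hw
      simp [uniformSuperposition, hw]
    · simp
  · intro τ _ hτ
    simp [ctrlPerm, hτ.symm]
  · simp

theorem conj_encoder_apply [Fintype A] [DecidableEq A] (M : Matrix (Fin n → A) (Fin n → A) ℂ) (σ τ : Equiv.Perm (Fin n))
    (x x' : Fin n → A) :
    conj (encoder n A) M (σ, x) (τ, x') = (1 / (n.factorial : ℂ)) * M (x ∘ σ) (x' ∘ τ) := by
  rw [conj_apply, Matrix.mul_apply, Finset.sum_eq_single (x' ∘ τ)]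
  · rw [Matrix.mul_apply, Finset.sum_eq_single (x ∘ σ)]
    · rw [Matrix.conjTranspose_apply, encoder_apply, encoder_apply, if_pos rfl, if_pos rfl,
        Complex.star_def, Complex.conj_ofReal, ← inv_sqrt_factorial_mul_self]
      ring
    · intro z _ hz
      rw [encoder_apply, if_neg hz, zero_mul]
    · simp
  · intro z _ hz
    rw [Matrix.conjTranspose_apply, encoder_apply, if_neg hz, star_zero, mul_zero]
  · simp

/-- Permutations of the inputs pass through `V^{⊗n}` to outputs and environments; left and right
factors may be permuted independently. -/
theorem envBlock_permuted [Fintype A] (V : Matrix (B × Fin r) A ℂ) (M : Matrix (Fin n → A) (Fin n → A) ℂ)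
    (σ τ : Equiv.Perm (Fin n)) (y y' : Fin n → B) (e e' : Fin n → Fin r) :
    envBlock V (Matrix.of fun x x' => M (x ∘ σ) (x' ∘ τ)) y y' e e'
      = envBlock V M (y ∘ σ) (y' ∘ τ) (e ∘ σ) (e' ∘ τ) := by
  simp only [envBlock, Matrix.of_apply, Matrix.mul_apply, Matrix.conjTranspose_apply]
  rw [← Equiv.sum_comp (Equiv.arrowCongr τ (Equiv.refl A))]
  refine Finset.sum_congr rfl fun x' _ => ?_
  rw [← Equiv.sum_comp (Equiv.arrowCongr σ (Equiv.refl A))]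
  have h : ∀ (ρ : Equiv.Perm (Fin n)) (x : Fin n → A),
      Equiv.arrowCongr ρ (Equiv.refl A) x ∘ ρ = x := by
    intro ρ x
    ext k
    simp [Equiv.arrowCongr]
  simp only [← stinePow_comp V σ e y, ← stinePow_comp V τ e' y', h]

theorem idTensor_channelPow_encoder [Fintype A] [DecidableEq A] [Fintype B] {Φ : Matrix A A ℂ →ₗ[ℂ] Matrix B B ℂ}
    {V : Matrix (B × Fin r) A ℂ} (hV : IsStinespringIsometry Φ V)
    (M : Matrix (Fin n → A) (Fin n → A) ℂ) (σ τ : Equiv.Perm (Fin n)) (y y' : Fin n → B) :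
    idTensor (Equiv.Perm (Fin n)) (channelPow n Φ) (conj (encoder n A) M) (σ, y) (τ, y')
      = (1 / (n.factorial : ℂ))
        * ∑ e : Fin n → Fin r, envBlock V M (y ∘ σ) (y' ∘ τ) (e ∘ σ) (e ∘ τ) := by
  have h : (Matrix.of fun x x' => conj (encoder n A) M (σ, x) (τ, x'))
      = (1 / (n.factorial : ℂ)) • Matrix.of fun x x' => M (x ∘ σ) (x' ∘ τ) := by
    ext x x'
    rw [Matrix.of_apply, conj_encoder_apply]
    rfl
  change channelPow n Φ (Matrix.of fun x x' => conj (encoder n A) M (σ, x) (τ, x')) y y' = _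
  rw [h, map_smul, Matrix.smul_apply, smul_eq_mul, channelPow_eq_sum_envBlock hV]
  simp only [envBlock_permuted]

theorem decoder_apply [Fintype B] [DecidableEq B] (a : FourierLabel n) (y z : Fin n → B) (σ : Equiv.Perm (Fin n)) :
    decoder b B (a, y) (σ, z) = if z = y ∘ σ.symm then qft b a σ else 0 := by
  rw [decoder, Matrix.mul_apply, Fintype.sum_prod_type, Finset.sum_eq_single σ]
  · rw [Finset.sum_eq_single y]
    · simp [ctrlPerm, permOp, Matrix.kronecker, Matrix.kroneckerMap_apply]
    · intro w _ hw
      simp [Matrix.kronecker, Matrix.kroneckerMap_apply, Matrix.one_apply_ne hw.symm]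
    · simp
  · intro τ _ hτ
    simp [ctrlPerm, hτ.symm]
  · simp

theorem conj_decoder_apply [Fintype B] [DecidableEq B]
    (N : Matrix (Equiv.Perm (Fin n) × (Fin n → B)) (Equiv.Perm (Fin n) × (Fin n → B)) ℂ)
    (a a' : FourierLabel n) (y y' : Fin n → B) :
    conj (decoder b B) N (a, y) (a', y')
      = ∑ τ, ∑ σ, qft b a σ * N (σ, y ∘ σ.symm) (τ, y' ∘ τ.symm) * star (qft b a' τ) := by
  rw [conj_apply, Matrix.mul_apply, Fintype.sum_prod_type]
  refine Finset.sum_congr rfl fun τ _ => ?_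
  rw [Finset.sum_eq_single (y' ∘ τ.symm)]
  · rw [Matrix.mul_apply, Fintype.sum_prod_type, Finset.sum_mul]
    refine Finset.sum_congr rfl fun σ _ => ?_
    rw [Finset.sum_eq_single (y ∘ σ.symm)]
    · rw [Matrix.conjTranspose_apply, decoder_apply, decoder_apply, if_pos rfl, if_pos rfl]
    · intro z _ hz
      rw [decoder_apply, if_neg hz, zero_mul]
    · simp
  · intro z _ hz
    rw [Matrix.conjTranspose_apply, decoder_apply, if_neg hz, star_zero, mul_zero]
  · simp

/-- Relabelling the traced environment by `τ` leaves only the relative permutation. -/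
theorem sum_comp_perm (N : Matrix (Fin n → Fin r) (Fin n → Fin r) ℂ)
    (σ τ : Equiv.Perm (Fin n)) :
    ∑ e, N (e ∘ σ) (e ∘ τ) = (permOp (Fin r) (τ⁻¹ * σ) * N).trace := by
  rw [Matrix.trace]
  simp only [Matrix.diag_apply, permOp_mul_apply]
  rw [← Equiv.sum_comp (Equiv.arrowCongr τ (Equiv.refl (Fin r)))]
  refine Finset.sum_congr rfl fun e _ => ?_
  congr 1
  all_goals
    ext k
    simp [Equiv.arrowCongr]

/-- The reduced output of the decoder. -/
theorem sum_conj_decoder [Fintype A] [DecidableEq A] [Fintype B] [DecidableEq B] {Φ : Matrix A A ℂ →ₗ[ℂ] Matrix B B ℂ}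
    {V : Matrix (B × Fin r) A ℂ} (hV : IsStinespringIsometry Φ V) (u : WeylBases r b)
    (M : Matrix (Fin n → A) (Fin n → A) ℂ) (y y' : Fin n → B) (μ : n.Partition)
    (j l : Fin (dimS μ)) :
    ∑ i, conj (decoder b B) (idTensor (Equiv.Perm (Fin n)) (channelPow n Φ)
      (conj (encoder n A) M)) (⟨μ, i, j⟩, y) (⟨μ, i, l⟩, y')
      = (isoUnit u μ l j * envBlock V M y y').trace := by
  set N := envBlock V M y y' with hN
  have hf : (n.factorial : ℂ) ≠ 0 := Nat.cast_ne_zero.2 n.factorial_ne_zero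
  have hd := dimS_ne_zero μ
  have h1 : ∀ i, conj (decoder b B) (idTensor (Equiv.Perm (Fin n)) (channelPow n Φ)
      (conj (encoder n A) M)) (⟨μ, i, j⟩, y) (⟨μ, i, l⟩, y')
      = ∑ τ, ∑ σ, ((dimS μ : ℂ) / (n.factorial : ℂ) ^ 2) * (R b μ τ⁻¹ l i * R b μ σ i j)
        * (permOp (Fin r) (τ⁻¹ * σ) * N).trace := by
    intro i
    rw [conj_decoder_apply]
    refine Finset.sum_congr rfl fun τ _ => Finset.sum_congr rfl fun σ _ => ?_
    rw [idTensor_channelPow_encoder hV]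
    have h2 : ∀ (ρ : Equiv.Perm (Fin n)) (y : Fin n → B), (y ∘ ρ.symm) ∘ ρ = y := by
      intro ρ y
      ext k
      simp
    rw [h2, h2, ← hN, sum_comp_perm, qft, Matrix.of_apply, Matrix.of_apply, star_mul',
      star_R_apply, Complex.star_def, Complex.conj_ofReal, R_inv_apply]
    have hs := sqrt_mul_sqrt_complex (x := (dimS μ : ℝ) / (n.factorial : ℝ)) (by positivity)
    push_cast at hs
    have h3 : (dimS μ : ℂ) / (n.factorial : ℂ) ^ 2
        = (dimS μ : ℂ) / (n.factorial : ℂ) * (1 / (n.factorial : ℂ)) := by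
      field_simp
    rw [h3, ← hs]
    ring
  simp only [h1]
  rw [Finset.sum_comm]
  -- The sum over `i` multiplies the representation matrices to `R(τ⁻¹ σ)`. The result depends only
  -- on `τ⁻¹ σ`, so for each `τ` the sum over `σ` is the same, and the sum over `τ` contributes a
  -- factor `n!`.
  have h4 : ∀ τ : Equiv.Perm (Fin n), ∑ i, ∑ σ,
      ((dimS μ : ℂ) / (n.factorial : ℂ) ^ 2) * (R b μ τ⁻¹ l i * R b μ σ i j)
        * (permOp (Fin r) (τ⁻¹ * σ) * N).trace
      = ((dimS μ : ℂ) / (n.factorial : ℂ) ^ 2) * (permOpSum b r μ l j * N).trace := by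
    intro τ
    rw [Finset.sum_comm, permOpSum, Matrix.sum_mul, Matrix.trace_sum, Finset.mul_sum,
      ← Equiv.sum_comp (Equiv.mulLeft τ⁻¹) fun σ => ((dimS μ : ℂ) / (n.factorial : ℂ) ^ 2)
        * ((R b μ σ l j • permOp (Fin r) σ) * N).trace]
    refine Finset.sum_congr rfl fun σ _ => ?_
    rw [Equiv.coe_mulLeft, Matrix.smul_mul, Matrix.trace_smul, R_mul, Matrix.mul_apply,
      smul_eq_mul, Finset.sum_mul, Finset.mul_sum]
    refine Finset.sum_congr rfl fun i _ => ?_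
    ring
  simp only [h4]
  rw [Finset.sum_const, Finset.card_univ, Fintype.card_perm, Fintype.card_fin, nsmul_eq_mul,
    ← isoUnit_eq u, Matrix.smul_mul, Matrix.trace_smul, smul_eq_mul]
  field_simp

theorem schur_mul_sum_single_mul (u : WeylBases r b) (μ : n.Partition) (j l : Fin (dimS μ))
    (c : ℂ) :
    schur b u * (∑ α : Fin (dimU r b μ),
      Matrix.single (⟨μ, (j, α)⟩ : SchurLabel r b) (⟨μ, (l, α)⟩ : SchurLabel r b) c)
      * (schur b u)ᴴ = c • isoUnit u μ j l := by
  ext x y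
  rw [Matrix.mul_sum, Matrix.sum_mul, Matrix.sum_apply, Matrix.smul_apply, isoUnit,
    Matrix.of_apply, smul_eq_mul, Finset.mul_sum]
  refine Finset.sum_congr rfl fun α _ => ?_
  rw [Matrix.mul_apply, Finset.sum_eq_single (⟨μ, (l, α)⟩ : SchurLabel r b)]
  · rw [Matrix.mul_single_apply_same, Matrix.conjTranspose_apply]
    ring
  · intro a _ ha
    rw [Matrix.mul_single_apply_of_ne _ _ _ _ _ ha, zero_mul]
  · simp

/-- The output of the circuit, given the reduced output of the decoder. -/
theorem conj_schur_replaceChannel (u : WeylBases r b)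
    (D : Matrix (FourierLabel n) (FourierLabel n) ℂ)
    (N : Matrix (Fin n → Fin r) (Fin n → Fin r) ℂ)
    (hD : ∀ (μ : n.Partition) (j l : Fin (dimS μ)),
      ∑ i, D ⟨μ, i, j⟩ ⟨μ, i, l⟩ = (isoUnit u μ l j * N).trace) :
    conj (schur b u) (replaceChannel r b D) = twirl N := by
  rw [twirl_eq_sum u, replaceChannel_apply, map_sum]
  refine Finset.sum_congr rfl fun μ _ => ?_
  split_ifs with h
  · rw [Finset.sum_comm, map_sum]
    refine Finset.sum_congr rfl fun j _ => ?_
    rw [Finset.sum_comm, map_sum]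
    refine Finset.sum_congr rfl fun l _ => ?_
    rw [← Finset.sum_smul, hD, map_smul, conj_apply, schur_mul_sum_single_mul, smul_smul,
      mul_one_div]
  -- Too many rows: the matrix units vanish, so both the measured weight and the term of the twirl
  -- are zero.
  · rw [Finset.sum_comm]
    simp only [← Finset.sum_smul, hD, isoUnit_eq_zero u (not_le.1 h), Matrix.zero_mul,
      Matrix.trace_zero, zero_smul, smul_zero, Finset.sum_const_zero, map_zero]

/-- After the decoder everything acts blockwise in the outputs, so it suffices to compare blocks at
fixed `y`, `y'`. -/
theorem circuit_eq_randomStinespring [Fintype A] [DecidableEq A] [Fintype B] [DecidableEq B] {Φ : Matrix A A ℂ →ₗ[ℂ] Matrix B B ℂ}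
    {V : Matrix (B × Fin r) A ℂ} (hV : IsStinespringIsometry Φ V) (u : WeylBases r b)
    (M : Matrix (Fin n → A) (Fin n → A) ℂ) :
    circuit b u Φ M = randomStinespring n V M := by
  ext ⟨e, y⟩ ⟨e', y'⟩
  rw [randomStinespring_apply, ← conj_schur_replaceChannel u
    (Matrix.of fun a a' => conj (decoder b B) (idTensor (Equiv.Perm (Fin n)) (channelPow n Φ)
      (conj (encoder n A) M)) (a, y) (a', y')) _
    fun μ j l => sum_conj_decoder hV u M y y' μ j l]
  rfl

end Circuit

end RandomStinespring

end

open RandomStinespring in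
theorem mainTheorem2 (n r dA dB : ℕ) (hn : 1 ≤ n) (hr : 1 ≤ r)
    (b : SpechtBases n) (u : WeylBases r b) :
    -- the components are isometries, unitaries and channels
    ((encoder n (Fin dA))ᴴ * encoder n (Fin dA) = 1 ∧
      (decoder b (Fin dB))ᴴ * decoder b (Fin dB) = 1 ∧
      decoder b (Fin dB) * (decoder b (Fin dB))ᴴ = 1 ∧
      IsQuantumChannel (replaceChannel r b) ∧
      (schur b u)ᴴ * schur b u = 1 ∧
      schur b u * (schur b u)ᴴ = 1) ∧
    -- the circuit is the channel of the random Stinespring isometry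
    ∀ Φ : Matrix (Fin dA) (Fin dA) ℂ →ₗ[ℂ] Matrix (Fin dB) (Fin dB) ℂ,
      IsQuantumChannel Φ → choiRank Φ ≤ r →
        IsQuantumChannel (circuit b u Φ) ∧
        (∃ V : Matrix (Fin dB × Fin r) (Fin dA) ℂ, IsStinespringIsometry Φ V) ∧
        ∀ V : Matrix (Fin dB × Fin r) (Fin dA) ℂ, IsStinespringIsometry Φ V →
          ∀ M : Matrix (Fin n → Fin dA) (Fin n → Fin dA) ℂ,
            circuit b u Φ M = randomStinespring n V M := by
  refine ⟨⟨encoder_conjTranspose_mul n _, decoder_conjTranspose_mul _, decoder_mul_conjTranspose _,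
    hasKrausForm_replaceChannel.isQuantumChannel (isTracePreserving_replaceChannel hr u),
    schur_conjTranspose_mul u, schur_mul_conjTranspose u⟩, fun Φ hΦ hrank => ?_⟩
  obtain ⟨V, hV⟩ := exists_isStinespringIsometry hΦ hrank
  refine ⟨isQuantumChannel_circuit hr u ?_ hΦ.2, ⟨V, hV⟩,
    fun V hV M => circuit_eq_randomStinespring hV u M⟩
  -- The environment slices of `V` are Kraus operators of `Φ`.
  rw [hV.eq_sum_conj]
  exact hasKrausForm_sum_conj _
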